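/- Let $\mathbb T^3=(\mathbb R/2\pi\mathbb Z)^3$, let $\gamma,\alpha>0$, and let $f\in C^1(\mathbb R)$ satisfy, for some positive constants $C,\kappa,K$ and all $s\in\mathbb R$, $$f(s)s\ge -C+\kappa|s|^2,\qquad f'(s)\ge -K,\qquad |f'(s)|\le C(1+|s|^4).$$ For $w=\sum_{k\in\mathbb Z^3}w_ke^{ik\cdot x}$ put $\|w\|_{H^s}^2=(2\pi)^3\sum_k(1+|k|^2)^s|w_k|^2$ and $(-\Delta)^{\theta}w=\sum_k|k|^{2\theta}w_ke^{ik\cdot x}$, and let $\mathcal E=H^1(\mathbb T^3)\times L^2(\mathbb T^3)$, with norm $\|(w,z)\|_{\mathcal E}^2=\|w\|_{H^1}^2+\|z\|_{L^2}^2$. Given $g\in L^2(\mathbb T^3)$, $T>0$ and $(u_0,u_1)\in\mathcal E$, a weak energy solution on $[0,T]$ of $$\partial_t^2u+\gamma(-\Delta)^{1/2}\partial_tu+\alpha\,\partial_tu-\Delta u+f(u)=g,\qquad u|_{t=0}=u_0,\quad \partial_tu|_{t=0}=u_1, \tag{1}$$ is a function $u$ such that $\xi_u:=(u,\partial_tu)\in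 L^\infty(0,T;\mathcal E)$ (with $\partial_tu$ the distributional time derivative), $\partial_tu\in L^2(0,T;H^{1/2}(\mathbb T^3))$, the initial conditions hold (for the representatives of $u$ and $\partial_tu$ that are continuous in time with values in $L^2$ and $H^{-1}$, respectively), and for every $\phi\in C_0^\infty((0,T)\times\mathbb T^3)$ $$-\int_0^T(\partial_tu,\partial_t\phi)\,dt+\int_0^T(\nabla u,\nabla\phi)\,dt+\alpha\int_0^T(\partial_tu,\phi)\,dt+\gamma\int_0^T(\partial_tu,(-\Delta)^{1/2}\phi)\,dt+\int_0^T(f(u),\phi)\,dt=\int_0^T(g,\phi)\,dt,$$ where $(\cdot,\cdot)$ is the inner product of $L^2(\mathbb T^3)$. Then there is a monotone increasing function $Q:[0,\infty)\to[0,\infty)$, depending only on $\gamma,\alpha$ and $f$, such that for all $g$, $T$, $(u_0,u_1)$ as above every weak energy solution $u$ of (1) on $[0,T]$ belongs to $L^2(0,T;H^{3/2}(\mathbb T^3))$ and satisfies, for every $\tau\ge0$ with $\tau+1\le T$, $$\|u\|_{L^2([\tau,\tau+1],H^{3/2})}\le Q\Big(\|\xi_u\|_{L^\infty([\tau,\tau+1],\mathcal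 E)}+\|\partial_tu\|_{L^2([\tau,\tau+1],H^{1/2})}+\|g\|_{L^2}\Big).$$ -/

import Mathlib

open MeasureTheory Filter Topology
open scoped ENNReal NNReal ContDiff

noncomputable section

namespace QuinticWave

/-- `2π > 0`, needed for the Haar measure of the circle `ℝ / 2πℤ`. -/
instance factTwoPiPos : Fact (0 < 2 * Real.pi) := ⟨Real.two_pi_pos⟩

/-- The torus `𝕋³ = (ℝ / 2πℤ)³`; its `volume` is Lebesgue measure, of total mass `(2π)³`. -/
abbrev Torus : Type := Fin 3 → AddCircle (2 * Real.pi)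

/-- The real Hilbert space `L²(𝕋³)`. -/
abbrev L2 : Type := Lp ℝ 2 (volume : Measure Torus)

/-- The projection `ℝ³ → 𝕋³`. -/
def proj (y : Fin 3 → ℝ) : Torus := fun i => (y i : AddCircle (2 * Real.pi))

/-- `|k|²` for `k ∈ ℤ³`: the eigenvalue of `-Δ` on `𝕋³` at the eigenfunction `e^{ik·x}`. -/
def eig (k : Fin 3 → ℤ) : ℝ := ∑ i, (k i : ℝ) ^ 2

/-- The exponential `x ↦ e^{ik·x}` on `𝕋³`. -/
def expo (k : Fin 3 → ℤ) (x : Torus) : ℂ := ∏ i, fourier (k i) (x i)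

/-- The Fourier coefficient `w_k = (2π)⁻³ ∫ w(x) e^{-ik·x} dx`. -/
def coeff (w : Torus → ℝ) (k : Fin 3 → ℤ) : ℂ :=
  ((2 * (Real.pi : ℂ)) ^ 3)⁻¹ * ∫ x : Torus, (w x : ℂ) * expo (-k) x

/-- The norm of `H^s(𝕋³)`, `‖w‖² = (2π)³ ∑ₖ (1 + |k|²)^s |w_k|²`, with value `∞` when
`w ∈ L²(𝕋³)` is not in `H^s(𝕋³)`. -/
def sobNorm (s : ℝ) (w : L2) : ℝ≥0∞ :=
  (ENNReal.ofReal ((2 * Real.pi) ^ 3) *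
    ∑' k : Fin 3 → ℤ, ENNReal.ofReal ((1 + eig k) ^ s * ‖coeff w k‖ ^ 2)) ^ (1 / 2 : ℝ)

/-- The fractional Laplacian `(-Δ)^θ ψ = ∑ₖ |k|^{2θ} ψ_k e^{ik·x}` of a smooth real function
(the sum is real, since `ψ` is). -/
def fracLap (θ : ℝ) (ψ : Torus → ℝ) (x : Torus) : ℝ :=
  (∑' k : Fin 3 → ℤ, ((eig k ^ θ : ℝ) : ℂ) * coeff ψ k * expo k x).re

/-- The classical partial derivative `∂ᵢψ` of a function on the torus. -/
def partialDeriv (i : Fin 3) (ψ : Torus → ℝ) (x : Torus) : ℝ :=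
  deriv (fun s : ℝ => ψ (x + proj (Pi.single i s))) 0

/-- `ψ ∈ C^∞(𝕋³)`. -/
def SmoothOnTorus (ψ : Torus → ℝ) : Prop :=
  ContDiff ℝ ∞ (fun y : Fin 3 → ℝ => ψ (proj y))

/-- `G ∈ L²` is the weak derivative `∂ᵢw` of `w ∈ L²`. -/
def IsWeakPartial (i : Fin 3) (w G : L2) : Prop :=
  ∀ ψ : Torus → ℝ, SmoothOnTorus ψ →
    ∫ x : Torus, w x * partialDeriv i ψ x = -∫ x : Torus, G x * ψ x

open Classical in
/-- The weak derivative `∂ᵢw`. It is unique when it exists in `L²`, which it does for every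
`w ∈ H¹(𝕋³)`. -/
def weakPartial (i : Fin 3) (w : L2) : L2 :=
  if h : ∃ G : L2, IsWeakPartial i w G then h.choose else 0

/-- `φ ∈ C₀^∞((0,T) × 𝕋³)`. Being boundaryless, the torus puts no support condition in `x`. -/
structure IsTestFunction (T : ℝ) (φ : ℝ → Torus → ℝ) : Prop where
  smooth : ContDiff ℝ ∞ (fun p : ℝ × (Fin 3 → ℝ) => φ p.1 (proj p.2))
  supp : ∃ a b : ℝ, 0 < a ∧ b < T ∧ ∀ t, t ∉ Set.Icc a b → ∀ x, φ t x = 0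

/-- The time derivative `∂ₜφ`. -/
def timeDeriv (φ : ℝ → Torus → ℝ) (t : ℝ) (x : Torus) : ℝ := deriv (fun s => φ s x) t

/-- The norm of `(w, z)` in the energy space `𝓔 = H¹(𝕋³) × L²(𝕋³)`. -/
def energyNorm (w z : L2) : ℝ≥0∞ := (sobNorm 1 w ^ 2 + ‖z‖ₑ ^ 2) ^ (1 / 2 : ℝ)

/-- The norm of `(u, v)` in `L^∞(a, b; 𝓔)`. -/
def normLinftyEnergy (a b : ℝ) (u v : ℝ → L2) : ℝ≥0∞ :=
  essSup (fun t => energyNorm (u t) (v t)) (volume.restrict (Set.Ioo a b))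

/-- The norm of `u` in `L²(a, b; H^s(𝕋³))`. -/
def normL2Sob (s a b : ℝ) (u : ℝ → L2) : ℝ≥0∞ :=
  (∫⁻ t in Set.Ioo a b, sobNorm s (u t) ^ 2) ^ (1 / 2 : ℝ)

/-- `u ∈ L²(a, b; H^s(𝕋³))`, for `s ≥ 0`. -/
def MemL2Sob (s a b : ℝ) (u : ℝ → L2) : Prop :=
  AEStronglyMeasurable u (volume.restrict (Set.Ioo a b)) ∧ normL2Sob s a b u < ⊤

/-- `f ∈ C¹(ℝ)` satisfies the growth and dissipativity assumptions with constants `C`, `κ`, `K`. -/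
structure Nonlinearity (C κ K : ℝ) (f : ℝ → ℝ) : Prop where
  contDiff : ContDiff ℝ 1 f
  dissipative : ∀ s, -C + κ * |s| ^ 2 ≤ f s * s
  deriv_ge : ∀ s, -K ≤ deriv f s
  growth : ∀ s, |deriv f s| ≤ C * (1 + |s| ^ 4)

/-- The pair `ξ_u = (u, v)`, `v = ∂ₜu`, is a weak energy solution on `(0, T) × 𝕋³` of
`∂ₜ²u + γ(-Δ)^{1/2}∂ₜu + α∂ₜu - Δu + f(u) = g`, `u|_{t=0} = u₀`, `∂ₜu|_{t=0} = u₁`.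
A solution on `[0, ∞)` is one that is a solution on `(0, T)` for every `T > 0`. -/
structure IsWeakEnergySolution (γ α : ℝ) (f : ℝ → ℝ) (g : L2) (T : ℝ) (u₀ u₁ : L2)
    (u v : ℝ → L2) : Prop where
  measurable_u : AEStronglyMeasurable u (volume.restrict (Set.Ioo 0 T))
  measurable_v : AEStronglyMeasurable v (volume.restrict (Set.Ioo 0 T))
  /-- `ξ_u ∈ L^∞(0, T; 𝓔)`. -/
  energy : normLinftyEnergy 0 T u v < ⊤
  /-- `∂ₜu ∈ L²(0, T; H^{1/2})`. -/
  dissipation : MemL2Sob (1 / 2) 0 T v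
  /-- `v = ∂ₜu` in the sense of distributions. -/
  time_deriv : ∀ φ : ℝ → Torus → ℝ, IsTestFunction T φ →
    ∫ t in Set.Ioo 0 T, ∫ x : Torus, u t x * timeDeriv φ t x =
      -∫ t in Set.Ioo 0 T, ∫ x : Torus, v t x * φ t x
  /-- The initial data belong to `𝓔`. -/
  initial_energy : energyNorm u₀ u₁ < ⊤
  /-- `u(0) = u₀` for the representative of `u` that is continuous with values in `L²`. -/
  initial_u : Tendsto (fun t => ‖u t - u₀‖) (𝓝[>] (0 : ℝ) ⊓ ae volume) (𝓝 0)
  /-- `∂ₜu(0) = u₁` for the representative of `∂ₜu` that is continuous with values in `H⁻¹`. -/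
  initial_v : Tendsto (fun t => sobNorm (-1) (v t - u₁)) (𝓝[>] (0 : ℝ) ⊓ ae volume) (𝓝 0)
  /-- The equation holds in the sense of distributions. -/
  equation : ∀ φ : ℝ → Torus → ℝ, IsTestFunction T φ →
    -(∫ t in Set.Ioo 0 T, ∫ x : Torus, v t x * timeDeriv φ t x)
      + (∫ t in Set.Ioo 0 T, ∑ i, ∫ x : Torus, weakPartial i (u t) x * partialDeriv i (φ t) x)
      + α * (∫ t in Set.Ioo 0 T, ∫ x : Torus, v t x * φ t x)
      + γ * (∫ t in Set.Ioo 0 T, ∫ x : Torus, v t x * fracLap (1 / 2) (φ t) x)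
      + (∫ t in Set.Ioo 0 T, ∫ x : Torus, f (u t x) * φ t x)
      = ∫ t in Set.Ioo 0 T, ∫ x : Torus, g x * φ t x

end QuinticWave

end

/-!
Test the equation with `m(D)u`, where `m(D) = ∑ᵢ ∑_{j<n} 2^j δ(2^{-j}eᵢ)` and `δ(y)` is the
symmetric second difference `w ↦ w - (w(· + y) + w(· - y)) / 2`. Its symbol is at most a multiple of
`|k|`, and on a given finite set of frequencies it dominates `|k| / 6` once `n` is large. So the
elliptic term `(m(D)(-Δ)u, u)` controls the `H^{3/2}` norm, while all other linear terms are bounded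
by the norms on the right-hand side. The nonlinear term needs no bound: for monotone `h`,
`∫ h(w) δ(y)w = ½ ∫ (h(w(x + y)) - h(w(x))) (w(x + y) - w(x)) dx ≥ 0`, which applies to
`h(s) = f(s) + Ks`, and the correction `K (m(D)u, u)` is of lower order. The growth of `f` enters
only qualitatively: `H¹ ⊂ L⁶` puts `h(u)` in `L^{6/5}`, the dual of `L⁶`, so the pairing makes
sense.

The test is carried out on finitely many Fourier modes, each of which solves a scalar oscillator
equation in time, and the frequency cutoff is removed before the positivity is used.
-/

noncomputable section

namespace QuinticWave

open scoped ComplexConjugate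

/-! ### Fourier series on the torus -/

theorem expo_zero (x : Torus) : expo 0 x = 1 := by simp [expo]

theorem expo_neg (k : Fin 3 → ℤ) (x : Torus) : expo (-k) x = conj (expo k x) := by
  simp only [expo, Pi.neg_apply, fourier_neg, map_prod]

theorem expo_add (k l : Fin 3 → ℤ) (x : Torus) : expo (k + l) x = expo k x * expo l x := by
  simp only [expo, Pi.add_apply, fourier_add, ← Finset.prod_mul_distrib]

theorem norm_expo (k : Fin 3 → ℤ) (x : Torus) : ‖expo k x‖ = 1 := by
  simp only [expo, norm_prod, fourier_apply, Circle.norm_coe, Finset.prod_const_one]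

theorem continuous_expo (k : Fin 3 → ℤ) : Continuous (expo k) := by
  unfold expo; fun_prop

theorem expo_apply_add (k : Fin 3 → ℤ) (x y : Torus) :
    expo k (x + y) = expo k x * expo k y := by
  simp only [expo, Pi.add_apply, fourier_apply, smul_add, AddCircle.toCircle_add, Circle.coe_mul,
    ← Finset.prod_mul_distrib]

theorem expo_apply_neg (k : Fin 3 → ℤ) (x : Torus) : expo k (-x) = conj (expo k x) := by
  rw [← expo_neg]
  simp only [expo, Pi.neg_apply, fourier_apply, smul_neg, neg_smul]

theorem expo_proj (k : Fin 3 → ℤ) (y : Fin 3 → ℝ) :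
    expo k (proj y) = Complex.exp (Complex.I * ((∑ i, (k i : ℝ) * y i : ℝ) : ℂ)) := by
  have hpi : (Real.pi : ℂ) ≠ 0 := by exact_mod_cast Real.pi_ne_zero
  simp only [expo, proj, fourier_coe_apply, ← Complex.exp_sum]
  congr 1
  push_cast
  rw [Finset.mul_sum]
  refine Finset.sum_congr rfl fun i _ => ?_
  field_simp

/-- The total mass `(2π)³` of the torus, which is the squared norm of each `e^{ik·x}`. -/
def vol : ℝ := (2 * Real.pi) ^ 3

theorem vol_pos : 0 < vol := by unfold vol; positivity

theorem ofReal_vol_ne_zero : (vol : ℂ) ≠ 0 := by exact_mod_cast vol_pos.ne'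

theorem ofReal_sqrt_vol_ne_zero : (√vol : ℂ) ≠ 0 := by
  exact_mod_cast (Real.sqrt_pos.2 vol_pos).ne'

theorem ofReal_sqrt_vol_mul_self : (√vol : ℂ) * √vol = vol := by
  exact_mod_cast Real.mul_self_sqrt vol_pos.le

theorem coeff_def (w : Torus → ℝ) (k : Fin 3 → ℤ) :
    coeff w k = (vol : ℂ)⁻¹ * ∫ x : Torus, (w x : ℂ) * expo (-k) x := by
  simp [coeff, vol]

theorem integral_fourier (n : ℤ) :
    ∫ x : AddCircle (2 * Real.pi), fourier n x = if n = 0 then (2 * Real.pi : ℂ) else 0 := by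
  have horth := orthonormal_iff_ite.mp (orthonormal_fourier (T := 2 * Real.pi)) 0 n
  simp only [ContinuousMap.inner_toLp, fourier_zero, map_one, mul_one] at horth
  rw [AddCircle.volume_eq_smul_haarAddCircle, integral_smul_measure, horth,
    ENNReal.toReal_ofReal Real.two_pi_pos.le]
  simp [eq_comm (a := (0 : ℤ))]

theorem integral_expo (k : Fin 3 → ℤ) :
    ∫ x : Torus, expo k x = if k = 0 then (vol : ℂ) else 0 := by
  unfold expo
  rw [integral_fintype_prod_volume_eq_prod
    (f := fun i (x : AddCircle (2 * Real.pi)) => (fourier (k i) x : ℂ))]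
  simp only [integral_fourier]
  split_ifs with h
  · simp [h, vol]
  · obtain ⟨i, hi⟩ := Function.ne_iff.mp h
    exact Finset.prod_eq_zero (Finset.mem_univ i) (if_neg hi)

/-- The exponential `e^{ik·x}` as a continuous map. -/
def expoC (k : Fin 3 → ℤ) : C(Torus, ℂ) := ⟨expo k, continuous_expo k⟩

/-- The rescaling of `(ℝ / 2πℤ)³` to `(ℝ / ℤ)³`, which carries the characters `exp (i k · x)` to
those of `UnitAddTorus`. -/
def toUnitTorus : Torus ≃ₜ UnitAddTorus (Fin 3) :=
  .piCongrRight fun _ => AddCircle.homeomorphAddCircle _ _ Real.two_pi_pos.ne' one_ne_zero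

theorem mFourier_toUnitTorus (k : Fin 3 → ℤ) (x : Torus) :
    UnitAddTorus.mFourier k (toUnitTorus x) = expo k x := by
  simp only [UnitAddTorus.mFourier, expo, ContinuousMap.coe_mk]
  refine Finset.prod_congr rfl fun i _ => ?_
  change fourier (k i) (AddCircle.homeomorphAddCircle _ _ Real.two_pi_pos.ne' one_ne_zero (x i)) = _
  induction x i using QuotientAddGroup.induction_on with | _ y
  have hpi : (Real.pi : ℂ) ≠ 0 := by exact_mod_cast Real.pi_ne_zero
  rw [AddCircle.homeomorphAddCircle_apply_mk, fourier_coe_apply, fourier_coe_apply]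
  congr 1
  push_cast
  field_simp

theorem span_expoC_closure_eq_top :
    (Submodule.span ℂ (Set.range expoC)).topologicalClosure = ⊤ := by
  let pullback : C(UnitAddTorus (Fin 3), ℂ) →L[ℂ] C(Torus, ℂ) :=
    ⟨(ContinuousMap.compRightAlgHom ℂ ℂ (toUnitTorus : C(Torus, _))).toLinearMap,
      ContinuousMap.compRightAlgHom_continuous ℂ ℂ _⟩
  have hsurj : Function.Surjective pullback := fun w =>
    ⟨w.comp (toUnitTorus.symm : C(_, Torus)),
      ContinuousMap.ext fun x => congrArg w (toUnitTorus.symm_apply_apply x)⟩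
  have hpull : ∀ k, pullback (UnitAddTorus.mFourier k) = expoC k := fun k =>
    ContinuousMap.ext (mFourier_toUnitTorus k)
  simpa only [Submodule.map_span, ContinuousLinearMap.coe_coe, ← Set.range_comp,
    Function.comp_def, hpull] using hsurj.denseRange.topologicalClosure_map_submodule
      UnitAddTorus.span_mFourier_closure_eq_top

/-- The complex Hilbert space `L²(𝕋³; ℂ)`. -/
abbrev L2C : Type := Lp ℂ 2 (volume : Measure Torus)

/-- The exponential `e^{ik·x}` as an element of `L²`. -/
def expoL (k : Fin 3 → ℤ) : L2C := ContinuousMap.toLp (E := ℂ) 2 volume ℂ (expoC k)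

theorem coeFn_expoL (k : Fin 3 → ℤ) : expoL k =ᵐ[volume] expo k :=
  ContinuousMap.coeFn_toLp volume (expoC k)

theorem span_expoL_closure_eq_top :
    (Submodule.span ℂ (Set.range expoL)).topologicalClosure = ⊤ := by
  have h := (ContinuousMap.toLp_denseRange ℂ (volume : Measure Torus) ℂ
    (p := 2) (by simp)).topologicalClosure_map_submodule span_expoC_closure_eq_top
  rwa [Submodule.map_span, ContinuousLinearMap.coe_coe, ← Set.range_comp] at h

theorem inner_expoL_left (W : L2C) (k : Fin 3 → ℤ) :
    inner ℂ (expoL k) W = ∫ x : Torus, W x * expo (-k) x := by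
  rw [L2.inner_def]
  refine integral_congr_ae ?_
  filter_upwards [coeFn_expoL k] with x hx
  rw [hx, expo_neg, RCLike.inner_apply]

theorem inner_expoL (k l : Fin 3 → ℤ) :
    inner ℂ (expoL k) (expoL l) = if k = l then (vol : ℂ) else 0 := by
  have h : ∫ x : Torus, expoL l x * expo (-k) x = ∫ x : Torus, expo (l - k) x := by
    refine integral_congr_ae ?_
    filter_upwards [coeFn_expoL l] with x hx
    rw [hx, sub_eq_add_neg, expo_add]
  simp only [inner_expoL_left, h, integral_expo, sub_eq_zero, eq_comm]

theorem orthonormal_smul_expoL : Orthonormal ℂ fun k => (√vol : ℂ)⁻¹ • expoL k := by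
  rw [orthonormal_iff_ite]
  intro k l
  simp only [inner_smul_left, inner_smul_right, inner_expoL, map_inv₀, Complex.conj_ofReal,
    ← ofReal_sqrt_vol_mul_self]
  have := ofReal_sqrt_vol_ne_zero
  split_ifs
  · field_simp
  · simp

/-- The Fourier basis of `L²(𝕋³; ℂ)`: the normalized exponentials `(2π)^{-3/2} e^{ik·x}`. -/
def expoBasis : HilbertBasis (Fin 3 → ℤ) ℂ L2C :=
  .mk orthonormal_smul_expoL <| by
    rw [← Set.smul_set_range, Submodule.span_smul_eq_of_isUnit _ _
      (inv_ne_zero ofReal_sqrt_vol_ne_zero).isUnit, span_expoL_closure_eq_top]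

theorem expoBasis_apply (k : Fin 3 → ℤ) : expoBasis k = (√vol : ℂ)⁻¹ • expoL k := by
  simp [expoBasis]

theorem inner_expoBasis_left (W : L2C) (k : Fin 3 → ℤ) :
    inner ℂ (expoBasis k) W = (√vol : ℂ)⁻¹ * ∫ x : Torus, W x * expo (-k) x := by
  rw [expoBasis_apply, inner_smul_left, inner_expoL_left, map_inv₀, Complex.conj_ofReal]

/-- The complexification of a real square-integrable function. -/
def toC (w : L2) : L2C := Complex.ofRealCLM.compLp w

theorem coeFn_toC (w : L2) : toC w =ᵐ[volume] fun x => (w x : ℂ) :=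
  Complex.ofRealCLM.coeFn_compLp w

theorem inner_expoBasis_toC (w : L2) (k : Fin 3 → ℤ) :
    inner ℂ (expoBasis k) (toC w) = √vol * coeff w k := by
  have h : ∫ x : Torus, toC w x * expo (-k) x = ∫ x : Torus, (w x : ℂ) * expo (-k) x := by
    refine integral_congr_ae ?_
    filter_upwards [coeFn_toC w] with x hx
    rw [hx]
  have := ofReal_sqrt_vol_ne_zero
  rw [inner_expoBasis_left, h, coeff_def, ← ofReal_sqrt_vol_mul_self]
  field_simp

theorem hasSum_coeff_smul_expoL (w : L2) :
    HasSum (fun k => coeff w k • expoL k) (toC w) := by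
  refine (expoBasis.hasSum_repr (toC w)).congr_fun fun k => ?_
  have := ofReal_sqrt_vol_ne_zero
  rw [expoBasis.repr_apply_apply, inner_expoBasis_toC, expoBasis_apply, smul_smul]
  congr 1
  field_simp

theorem hasSum_coeff_mul_conj_coeff (w z : L2) :
    HasSum (fun k => coeff w k * conj (coeff z k)) ((vol⁻¹ * ∫ x, w x * z x : ℝ) : ℂ) := by
  have hinner : inner ℂ (toC z) (toC w) = ((∫ x, w x * z x : ℝ) : ℂ) := by
    rw [L2.inner_def, ← integral_complex_ofReal]
    refine integral_congr_ae ?_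
    filter_upwards [coeFn_toC w, coeFn_toC z] with x hw hz
    simp [hw, hz, RCLike.inner_apply]
  have h := (expoBasis.hasSum_inner_mul_inner (toC z) (toC w)).mul_left (vol : ℂ)⁻¹
  rw [hinner, ← Complex.ofReal_inv, ← Complex.ofReal_mul] at h
  refine h.congr_fun fun k => ?_
  have := ofReal_sqrt_vol_ne_zero
  rw [← inner_conj_symm, inner_expoBasis_toC, inner_expoBasis_toC, map_mul, Complex.conj_ofReal,
    Complex.ofReal_inv, ← ofReal_sqrt_vol_mul_self]
  field_simp

theorem hasSum_norm_sq_coeff (w : L2) :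
    HasSum (fun k => ‖coeff w k‖ ^ 2) (vol⁻¹ * ‖w‖ ^ 2) := by
  have hnorm : ‖w‖ ^ 2 = ∫ x, w x * w x := by
    rw [← real_inner_self_eq_norm_sq, L2.inner_def]
    rfl
  have h := Complex.hasSum_re (hasSum_coeff_mul_conj_coeff w w)
  rw [Complex.ofReal_re, ← hnorm] at h
  refine h.congr_fun fun k => ?_
  rw [Complex.mul_conj']
  norm_cast

theorem vol_mul_sum_norm_sq_coeff_le (w : L2) (S : Finset (Fin 3 → ℤ)) :
    vol * ∑ k ∈ S, ‖coeff w k‖ ^ 2 ≤ ‖w‖ ^ 2 :=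
  (le_inv_mul_iff₀ vol_pos).1
    (sum_le_hasSum S (fun k _ => by positivity) (hasSum_norm_sq_coeff w))

theorem integrable_mul_expo {w : Torus → ℂ} (hw : Integrable w) (k : Fin 3 → ℤ) :
    Integrable fun x => w x * expo k x :=
  hw.mul_bdd (c := 1) (continuous_expo k).aestronglyMeasurable
    (.of_forall fun x => (norm_expo k x).le)

theorem exists_coeff_eq {c : (Fin 3 → ℤ) → ℂ} (hc : Summable fun k => ‖c k‖ ^ 2)
    (hreal : ∀ k, c (-k) = conj (c k)) : ∃ w : L2, ∀ k, coeff w k = c k := by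
  have hmem : Memℓp (fun k => (√vol : ℂ) * c k) 2 := by
    refine memℓp_gen ((hc.mul_left vol).congr fun k => ?_)
    rw [norm_mul, Complex.norm_real, Real.norm_of_nonneg (Real.sqrt_nonneg _),
      ENNReal.toReal_ofNat, Real.rpow_ofNat, mul_pow, Real.sq_sqrt vol_pos.le]
  obtain ⟨W, hW⟩ : ∃ W : L2C, ∀ k, ∫ x, W x * expo (-k) x = vol * c k := by
    refine ⟨expoBasis.repr.symm ⟨_, hmem⟩, fun k => ?_⟩
    have h := expoBasis.repr_apply_apply (expoBasis.repr.symm ⟨_, hmem⟩) k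
    rw [LinearIsometryEquiv.apply_symm_apply, inner_expoBasis_left,
      eq_inv_mul_iff_mul_eq₀ ofReal_sqrt_vol_ne_zero] at h
    rw [← h, ← ofReal_sqrt_vol_mul_self, mul_assoc]
  have hint := integrable_mul_expo ((Lp.memLp W).integrable (by norm_num))
  refine ⟨Complex.reCLM.compLp W, fun k => ?_⟩
  have hre : ∫ x, ((Complex.reCLM.compLp W x : ℝ) : ℂ) * expo (-k) x
      = ∫ x, (W x * expo (-k) x + conj (W x * expo (- -k) x)) / 2 := by
    refine integral_congr_ae ?_
    filter_upwards [Complex.reCLM.coeFn_compLp W] with x hx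
    rw [hx, Complex.reCLM_apply, Complex.re_eq_add_conj, map_mul, expo_neg (-k),
      Complex.conj_conj]
    ring
  have hint_conj : Integrable fun x => conj (W x * expo (- -k) x) :=
    Complex.conjLIE.integrable_comp_iff.2 (hint _)
  rw [coeff_def, hre, integral_div, integral_add (hint _) hint_conj, integral_conj, hW, hW,
    map_mul, hreal, Complex.conj_conj, Complex.conj_ofReal]
  have := ofReal_vol_ne_zero
  field_simp
  ring

/-- The trigonometric polynomial `∑_{k ∈ S} c_k e^{ik·x}`. -/
def partialSum (c : (Fin 3 → ℤ) → ℂ) (S : Finset (Fin 3 → ℤ)) (x : Torus) : ℂ :=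
  ∑ k ∈ S, c k * expo k x

theorem continuous_partialSum (c : (Fin 3 → ℤ) → ℂ) (S : Finset (Fin 3 → ℤ)) :
    Continuous (partialSum c S) :=
  continuous_finsetSum _ fun k _ => continuous_const.mul (continuous_expo k)

theorem coeFn_sum_expoL (c : (Fin 3 → ℤ) → ℂ) (S : Finset (Fin 3 → ℤ)) :
    (∑ k ∈ S, c k • expoL k : L2C) =ᵐ[volume] partialSum c S := by
  have h : (∑ k ∈ S, c k • expoL k : L2C)
      = ContinuousMap.toLp (E := ℂ) 2 volume ℂ (∑ k ∈ S, c k • expoC k) := by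
    simp only [map_sum, map_smul, expoL]
  rw [h]
  refine (ContinuousMap.coeFn_toLp volume _).trans (.of_forall fun x => ?_)
  simp [partialSum, expoC]

theorem eLpNorm_partialSum_two (c : (Fin 3 → ℤ) → ℂ) (S : Finset (Fin 3 → ℤ)) :
    eLpNorm (partialSum c S) 2 volume = ENNReal.ofReal √(vol * ∑ k ∈ S, ‖c k‖ ^ 2) := by
  have hinner : inner ℂ (∑ k ∈ S, c k • expoL k) (∑ k ∈ S, c k • expoL k)
      = ((vol * ∑ k ∈ S, ‖c k‖ ^ 2 : ℝ) : ℂ) := by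
    simp only [sum_inner, inner_sum, inner_smul_left, inner_smul_right, inner_expoL]
    push_cast
    rw [Finset.mul_sum]
    refine Finset.sum_congr rfl fun k hk => ?_
    simp only [mul_ite, mul_zero, Finset.sum_ite_eq', hk, if_true]
    rw [← mul_assoc, Complex.mul_conj', mul_comm]
  rw [← eLpNorm_congr_ae (coeFn_sum_expoL c S), ← Lp.enorm_def, ← ofReal_norm,
    norm_eq_sqrt_re_inner (𝕜 := ℂ), hinner, RCLike.re_to_complex, Complex.ofReal_re]

/-! ### The Sobolev inequality `H¹ ⊂ L⁶` -/

theorem isOpenQuotientMap_proj : IsOpenQuotientMap proj :=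
  IsOpenQuotientMap.piMap fun _ => QuotientAddGroup.isOpenQuotientMap_mk

theorem measurePreserving_proj (a : Fin 3 → ℝ) :
    MeasurePreserving proj
      (volume.restrict (Set.univ.pi fun i => Set.Ioc (a i) (a i + 2 * Real.pi))) volume := by
  have h := measurePreserving_pi
    (fun i => (volume : Measure ℝ).restrict (Set.Ioc (a i) (a i + 2 * Real.pi)))
    (fun _ => (volume : Measure (AddCircle (2 * Real.pi))))
    (fun i => AddCircle.measurePreserving_mk (2 * Real.pi) (a i))
  rwa [← Measure.restrict_pi_pi] at h

theorem map_proj_restrict_closedBall_le :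
    (volume.restrict (Metric.closedBall (0 : Fin 3 → ℝ) (3 * Real.pi / 2))).map proj
      ≤ (8 : ℝ≥0∞) • (volume : Measure Torus) := by
  have hpi := Real.pi_pos
  let a : (Fin 3 → Bool) → Fin 3 → ℝ := fun s i => if s i then -(2 * Real.pi) else 0
  let cube : (Fin 3 → Bool) → Set (Fin 3 → ℝ) := fun s =>
    Set.univ.pi fun i => Set.Ioc (a s i) (a s i + 2 * Real.pi)
  have hcover : Metric.closedBall (0 : Fin 3 → ℝ) (3 * Real.pi / 2) ⊆ ⋃ s, cube s := by
    intro y hy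
    rw [mem_closedBall_zero_iff, pi_norm_le_iff_of_nonneg (by positivity)] at hy
    refine Set.mem_iUnion.2 ⟨fun i => decide (y i ≤ 0), fun i _ => ?_⟩
    have hyi := abs_le.1 (hy i)
    by_cases hi : y i ≤ 0
    · simp only [a, hi, decide_true, if_true, Set.mem_Ioc]
      constructor <;> linarith
    · simp only [a, hi, decide_false, Bool.false_eq_true, if_false, Set.mem_Ioc]
      constructor <;> linarith
  refine Measure.le_iff.2 fun s hs => ?_
  have hproj : Measurable proj := isOpenQuotientMap_proj.continuous.measurable
  calc (volume.restrict (Metric.closedBall 0 (3 * Real.pi / 2))).map proj s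
      = volume.restrict (Metric.closedBall 0 (3 * Real.pi / 2)) (proj ⁻¹' s) :=
        Measure.map_apply hproj hs
    _ ≤ volume.restrict (⋃ s, cube s) (proj ⁻¹' s) := Measure.restrict_mono hcover le_rfl _
    _ ≤ ∑' i, volume.restrict (cube i) (proj ⁻¹' s) := by
        rw [← Measure.sum_apply _ (hproj hs)]
        exact Measure.restrict_iUnion_le _
    _ = ∑' _ : Fin 3 → Bool, volume s :=
        tsum_congr fun i => (measurePreserving_proj (a i)).measure_preimage hs.nullMeasurableSet
    _ = ((8 : ℝ≥0∞) • (volume : Measure Torus)) s := by simp [tsum_fintype]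

/-- A cutoff on `ℝ³` equal to `1` on a fundamental domain of the torus, used to turn periodic
functions into compactly supported ones. -/
def cutoff : ContDiffBump (0 : Fin 3 → ℝ) where
  rIn := Real.pi
  rOut := 3 * Real.pi / 2
  rIn_pos := Real.pi_pos
  rIn_lt_rOut := by linarith [Real.pi_pos]

theorem exists_norm_fderiv_cutoff_smul_le : ∃ M : ℝ≥0, ∀ {W : (Fin 3 → ℝ) → ℂ} {y : Fin 3 → ℝ},
    DifferentiableAt ℝ W y →
      ‖fderiv ℝ (fun y => cutoff y • W y) y‖ ≤ M * (‖W y‖ + ‖fderiv ℝ W y‖) := by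
  have hcont : ContDiff ℝ 1 cutoff := cutoff.contDiff
  obtain ⟨M, hM⟩ := (cutoff.hasCompactSupport.fderiv ℝ).exists_bound_of_continuous
    (hcont.continuous_fderiv one_ne_zero)
  refine ⟨(max 1 M).toNNReal, fun {W y} hW => ?_⟩
  have hbump : ‖cutoff y‖ ≤ max 1 M := by
    rw [Real.norm_of_nonneg cutoff.nonneg]
    exact cutoff.le_one.trans (le_max_left _ _)
  rw [Real.coe_toNNReal _ (by positivity), add_comm, mul_add,
    fderiv_fun_smul (hcont.differentiable one_ne_zero y) hW]
  refine (norm_add_le _ _).trans (add_le_add ?_ ?_)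
  · rw [norm_smul]
    gcongr
  · rw [ContinuousLinearMap.norm_smulRight_apply]
    gcongr
    exact (hM y).trans (le_max_right _ _)

theorem fderiv_cutoff_smul_eq_zero (W : (Fin 3 → ℝ) → ℂ) {y : Fin 3 → ℝ}
    (hy : y ∉ Metric.closedBall 0 (3 * Real.pi / 2)) :
    fderiv ℝ (fun y => cutoff y • W y) y = 0 := by
  refine image_eq_zero_of_notMem_tsupport fun h => hy ?_
  have hmem := tsupport_smul_subset_left cutoff W (tsupport_fderiv_subset ℝ h)
  rwa [cutoff.tsupport_eq] at hmem

theorem eLpNorm_six_le_eLpNorm_fderiv_cutoff_smul {w : Torus → ℂ}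
    (hw : ContDiff ℝ 1 fun y => w (proj y)) :
    eLpNorm w 6 volume ≤ SNormLESNormFDerivOfEqConst ℂ (volume : Measure (Fin 3 → ℝ)) 2 *
      eLpNorm (fderiv ℝ fun y => cutoff y • w (proj y)) 2 volume := by
  have hcont : Continuous w := isOpenQuotientMap_proj.isQuotientMap.continuous_iff.2 hw.continuous
  set cube := Set.univ.pi fun _ : Fin 3 => Set.Ioc (-Real.pi) (-Real.pi + 2 * Real.pi)
  have hball : cube ⊆ Metric.closedBall (0 : Fin 3 → ℝ) Real.pi := fun y hy => by
    rw [mem_closedBall_zero_iff, pi_norm_le_iff_of_nonneg Real.pi_pos.le]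
    intro i
    have hyi := hy i trivial
    rw [Real.norm_eq_abs, abs_le]
    constructor <;> linarith [hyi.1, hyi.2]
  have hcutoff : w ∘ proj =ᵐ[volume.restrict cube] fun y => cutoff y • w (proj y) := by
    filter_upwards [ae_restrict_mem (MeasurableSet.univ_pi fun _ => measurableSet_Ioc)] with y hy
    rw [cutoff.one_of_mem_closedBall (hball hy), one_smul, Function.comp_apply]
  calc eLpNorm w 6 volume
      = eLpNorm (w ∘ proj) 6 (volume.restrict cube) :=
        (eLpNorm_comp_measurePreserving hcont.aestronglyMeasurable
          (measurePreserving_proj fun _ => -Real.pi)).symm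
    _ = eLpNorm (fun y => cutoff y • w (proj y)) 6 (volume.restrict cube) :=
        eLpNorm_congr_ae hcutoff
    _ ≤ eLpNorm (fun y => cutoff y • w (proj y)) 6 volume :=
        eLpNorm_mono_measure _ Measure.restrict_le_self
    _ ≤ _ := by
        have hfinrank : (6 : ℝ≥0)⁻¹ = (2 : ℝ≥0)⁻¹ - (Module.finrank ℝ (Fin 3 → ℝ) : ℝ)⁻¹ := by
          simp
          norm_num
        exact eLpNorm_le_eLpNorm_fderiv_of_eq volume (cutoff.contDiff.smul hw)
          cutoff.hasCompactSupport.smul_right (p := 2) (p' := 6) (by norm_num) (by simp) hfinrank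

theorem exists_eLpNorm_six_le : ∃ C : ℝ≥0, ∀ {w : Torus → ℂ} {D : Torus → ℝ},
    ContDiff ℝ 1 (fun y => w (proj y)) → Continuous D →
    (∀ y, ‖w (proj y)‖ + ‖fderiv ℝ (fun y => w (proj y)) y‖ ≤ D (proj y)) →
      eLpNorm w 6 volume ≤ C * eLpNorm D 2 volume := by
  obtain ⟨M, hM⟩ := exists_norm_fderiv_cutoff_smul_le
  set C₀ := SNormLESNormFDerivOfEqConst ℂ (volume : Measure (Fin 3 → ℝ)) 2
  set C₁ : ℝ≥0 := (8 : ℝ≥0) ^ (1 / 2 : ℝ)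
  set B := Metric.closedBall (0 : Fin 3 → ℝ) (3 * Real.pi / 2)
  refine ⟨C₀ * (M * C₁), fun {w D} hw hD hwD => ?_⟩
  set F : (Fin 3 → ℝ) → ℂ := fun y => cutoff y • w (proj y)
  have hF : ∀ y, ‖fderiv ℝ F y‖ ≤ M * ‖B.indicator (D ∘ proj) y‖ := by
    intro y
    by_cases hy : y ∈ B
    · rw [Set.indicator_of_mem hy]
      exact (hM (hw.differentiable one_ne_zero y)).trans
        (mul_le_mul_of_nonneg_left ((hwD y).trans (le_abs_self _)) M.coe_nonneg)
    · rw [fderiv_cutoff_smul_eq_zero _ hy, norm_zero]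
      positivity
  have hproj : Measurable proj := isOpenQuotientMap_proj.continuous.measurable
  have hball : eLpNorm (B.indicator (D ∘ proj)) 2 volume ≤ C₁ * eLpNorm D 2 volume := by
    rw [eLpNorm_indicator_eq_eLpNorm_restrict Metric.isClosed_closedBall.measurableSet,
      ← eLpNorm_map_measure hD.aestronglyMeasurable hproj.aemeasurable]
    refine (eLpNorm_mono_measure D map_proj_restrict_closedBall_le).trans_eq ?_
    rw [eLpNorm_smul_measure_of_ne_top (by simp), smul_eq_mul]
    simp [C₁, ENNReal.coe_rpow_of_nonneg]
  calc eLpNorm w 6 volume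
      ≤ C₀ * eLpNorm (fderiv ℝ F) 2 volume := eLpNorm_six_le_eLpNorm_fderiv_cutoff_smul hw
    _ ≤ C₀ * (M * eLpNorm (B.indicator (D ∘ proj)) 2 volume) := by
        gcongr
        exact eLpNorm_le_nnreal_smul_eLpNorm_of_ae_le_mul (.of_forall hF) 2
    _ ≤ C₀ * (M * (C₁ * eLpNorm D 2 volume)) := by gcongr
    _ = ↑(C₀ * (M * C₁)) * eLpNorm D 2 volume := by push_cast; ring

theorem contDiff_expo_proj (k : Fin 3 → ℤ) : ContDiff ℝ ∞ fun y => expo k (proj y) := by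
  simp only [expo_proj]
  have h : ContDiff ℝ ∞ fun y : Fin 3 → ℝ => ∑ i, (k i : ℝ) * y i :=
    ContDiff.sum fun i _ => contDiff_const.mul (contDiff_apply ℝ ℝ i)
  exact ContDiff.cexp (contDiff_const.mul (Complex.ofRealCLM.contDiff.comp h))

theorem contDiff_partialSum_proj (c : (Fin 3 → ℤ) → ℂ) (S : Finset (Fin 3 → ℤ)) :
    ContDiff ℝ ∞ fun y => partialSum c S (proj y) :=
  ContDiff.sum fun k _ => contDiff_const.mul (contDiff_expo_proj k)

theorem hasFDerivAt_expo_proj (k : Fin 3 → ℤ) (y : Fin 3 → ℝ) :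
    HasFDerivAt (fun y => expo k (proj y))
      (∑ i, (ContinuousLinearMap.proj (R := ℝ) (φ := fun _ : Fin 3 => ℝ) i).smulRight
        (Complex.I * k i * expo k (proj y))) y := by
  simp only [expo_proj]
  have hphase : HasFDerivAt (fun y : Fin 3 → ℝ => ∑ i, (k i : ℝ) * y i)
      (∑ i, (k i : ℝ) • ContinuousLinearMap.proj (R := ℝ) (φ := fun _ : Fin 3 => ℝ) i) y :=
    HasFDerivAt.fun_sum fun i _ => (hasFDerivAt_apply i y).const_mul _
  refine ((Complex.ofRealCLM.hasFDerivAt.comp y hphase).const_mul Complex.I).cexp.congr_fderiv ?_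
  ext v
  simp only [smul_apply, sum_apply, ContinuousLinearMap.smulRight_apply,
    ContinuousLinearMap.proj_apply, ContinuousLinearMap.coe_comp, Function.comp_apply,
    Complex.ofRealCLM_apply, smul_eq_mul, Complex.real_smul, Complex.ofReal_sum,
    Complex.ofReal_mul, Complex.ofReal_intCast, Finset.mul_sum]
  exact Finset.sum_congr rfl fun i _ => by ring

theorem hasFDerivAt_partialSum_proj (c : (Fin 3 → ℤ) → ℂ) (S : Finset (Fin 3 → ℤ))
    (y : Fin 3 → ℝ) :
    HasFDerivAt (fun y => partialSum c S (proj y))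
      (∑ i, (ContinuousLinearMap.proj (R := ℝ) (φ := fun _ : Fin 3 => ℝ) i).smulRight
        (partialSum (fun k => Complex.I * k i * c k) S (proj y))) y := by
  refine (HasFDerivAt.fun_sum (u := S) fun k _ =>
    (hasFDerivAt_expo_proj k y).const_mul (c k)).congr_fderiv ?_
  ext v
  simp only [sum_apply, smul_apply, ContinuousLinearMap.smulRight_apply,
    ContinuousLinearMap.proj_apply, partialSum, Finset.smul_sum]
  rw [Finset.sum_comm]
  refine Finset.sum_congr rfl fun i _ => Finset.sum_congr rfl fun k _ => ?_
  simp only [smul_eq_mul, Complex.real_smul]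
  ring

theorem norm_fderiv_partialSum_proj_le (c : (Fin 3 → ℤ) → ℂ) (S : Finset (Fin 3 → ℤ))
    (y : Fin 3 → ℝ) :
    ‖fderiv ℝ (fun y => partialSum c S (proj y)) y‖
      ≤ ∑ i, ‖partialSum (fun k => Complex.I * k i * c k) S (proj y)‖ := by
  rw [(hasFDerivAt_partialSum_proj c S y).fderiv]
  refine (norm_sum_le _ _).trans (Finset.sum_le_sum fun i _ => ?_)
  rw [ContinuousLinearMap.norm_smulRight_apply]
  refine mul_le_of_le_one_left (norm_nonneg _)
    (ContinuousLinearMap.opNorm_le_bound _ zero_le_one fun v => ?_)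
  simpa using norm_le_pi_norm v i

theorem sq_le_eig (k : Fin 3 → ℤ) (i : Fin 3) : (k i : ℝ) ^ 2 ≤ eig k :=
  Finset.single_le_sum (f := fun i => (k i : ℝ) ^ 2) (fun _ _ => sq_nonneg _) (Finset.mem_univ i)

theorem exists_eLpNorm_partialSum_six_le : ∃ C : ℝ≥0, ∀ (c : (Fin 3 → ℤ) → ℂ)
    (S : Finset (Fin 3 → ℤ)), eLpNorm (partialSum c S) 6 volume
      ≤ C * ENNReal.ofReal √(vol * ∑ k ∈ S, (1 + eig k) * ‖c k‖ ^ 2) := by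
  obtain ⟨C, hC⟩ := exists_eLpNorm_six_le
  refine ⟨C * 4, fun c S => ?_⟩
  set R := ENNReal.ofReal √(vol * ∑ k ∈ S, (1 + eig k) * ‖c k‖ ^ 2)
  have hvol := vol_pos.le
  have htwo : ∀ c' : (Fin 3 → ℤ) → ℂ, (∀ k, ‖c' k‖ ^ 2 ≤ (1 + eig k) * ‖c k‖ ^ 2) →
      eLpNorm (fun x => ‖partialSum c' S x‖) 2 volume ≤ R := fun c' hc' => by
    rw [eLpNorm_norm, eLpNorm_partialSum_two]
    exact ENNReal.ofReal_le_ofReal (Real.sqrt_le_sqrt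
      (mul_le_mul_of_nonneg_left (Finset.sum_le_sum fun k _ => hc' k) hvol))
  set d : Fin 3 → Torus → ℝ := fun i x => ‖partialSum (fun k => Complex.I * k i * c k) S x‖
  have hmeas : ∀ i, AEStronglyMeasurable (d i) volume := fun i =>
    (continuous_partialSum _ S).norm.aestronglyMeasurable
  have hd : ∀ i, eLpNorm (d i) 2 volume ≤ R := fun i => htwo _ fun k => by
    rw [norm_mul, norm_mul, Complex.norm_I, one_mul, mul_pow, Complex.norm_intCast, sq_abs]
    gcongr
    linarith [sq_le_eig k i]
  have hw : ContDiff ℝ 1 fun y => partialSum c S (proj y) :=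
    (contDiff_partialSum_proj c S).of_le (by exact_mod_cast le_top)
  calc eLpNorm (partialSum c S) 6 volume
      ≤ C * eLpNorm ((fun x => ‖partialSum c S x‖) + ∑ i, d i) 2 volume := by
        refine hC hw ((continuous_partialSum c S).norm.add ?_) fun y => ?_
        · rw [Finset.sum_fn]
          exact continuous_finsetSum _ fun i _ => (continuous_partialSum _ S).norm
        · rw [Pi.add_apply, Finset.sum_apply]
          gcongr
          exact norm_fderiv_partialSum_proj_le c S y
    _ ≤ C * (R + ∑ _ : Fin 3, R) := by
        gcongr
        refine (eLpNorm_add_le (continuous_partialSum c S).norm.aestronglyMeasurable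
          (Finset.aestronglyMeasurable_sum _ fun i _ => hmeas i) one_le_two).trans
          (add_le_add ?_ ?_)
        · refine htwo c fun k => le_mul_of_one_le_left (by positivity) ?_
          linarith [sq_le_eig k 0, sq_nonneg (k 0 : ℝ)]
        · exact (eLpNorm_sum_le (fun i _ => hmeas i) one_le_two).trans
            (Finset.sum_le_sum fun i _ => hd i)
    _ = ↑(C * 4) * R := by
        rw [Finset.sum_const, Finset.card_univ, Fintype.card_fin]
        push_cast
        ring

theorem integrable_L2 (w : L2) : Integrable w :=
  (Lp.memLp w).integrable (by norm_num)

theorem integrable_ofReal_mul_expo {w : Torus → ℝ} (hw : Integrable w) (k : Fin 3 → ℤ) :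
    Integrable fun x => w x * expo k x :=
  integrable_mul_expo hw.ofReal k

theorem coeff_congr {w z : Torus → ℝ} (h : w =ᵐ[volume] z) (k : Fin 3 → ℤ) :
    coeff w k = coeff z k := by
  rw [coeff_def, coeff_def]
  congr 1
  refine integral_congr_ae ?_
  filter_upwards [h] with x hx
  rw [hx]

theorem coeff_add {w z : Torus → ℝ} (hw : Integrable w) (hz : Integrable z) (k : Fin 3 → ℤ) :
    coeff (fun x => w x + z x) k = coeff w k + coeff z k := by
  simp only [coeff_def, Complex.ofReal_add, add_mul]
  rw [integral_add (integrable_ofReal_mul_expo hw _) (integrable_ofReal_mul_expo hz _), mul_add]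

theorem coeff_const_mul (c : ℝ) (w : Torus → ℝ) (k : Fin 3 → ℤ) :
    coeff (fun x => c * w x) k = c * coeff w k := by
  simp only [coeff_def, Complex.ofReal_mul, mul_assoc]
  rw [integral_const_mul, mul_left_comm]

theorem norm_coeff_le (w : L2) (k : Fin 3 → ℤ) : ‖coeff w k‖ ≤ (√vol)⁻¹ * ‖w‖ := by
  have h := vol_mul_sum_norm_sq_coeff_le w {k}
  have hpos := Real.sqrt_pos.2 vol_pos
  rw [Finset.sum_singleton, ← Real.sq_sqrt vol_pos.le, ← mul_pow] at h
  rw [le_inv_mul_iff₀ hpos]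
  exact le_of_sq_le_sq h (norm_nonneg w)

/-- The Fourier coefficient as a continuous linear functional on `L²(𝕋³)`. -/
def coeffCLM (k : Fin 3 → ℤ) : L2 →L[ℝ] ℂ :=
  LinearMap.mkContinuous
    { toFun := fun w => coeff w k
      map_add' := fun w z => by
        rw [coeff_congr (Lp.coeFn_add w z)]
        exact coeff_add (integrable_L2 w) (integrable_L2 z) k
      map_smul' := fun c w => by
        rw [coeff_congr (Lp.coeFn_smul c w)]
        exact coeff_const_mul c w k } (√vol)⁻¹ fun w => norm_coeff_le w k

theorem coeffCLM_apply (k : Fin 3 → ℤ) (w : L2) : coeffCLM k w = coeff w k := rfl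

theorem continuous_coeff (k : Fin 3 → ℤ) : Continuous fun w : L2 => coeff w k :=
  (coeffCLM k).continuous

theorem eig_nonneg (k : Fin 3 → ℤ) : 0 ≤ eig k := Finset.sum_nonneg fun _ _ => sq_nonneg _

theorem eig_neg (k : Fin 3 → ℤ) : eig (-k) = eig k := by simp [eig]

theorem one_add_eig_rpow_nonneg (s : ℝ) (k : Fin 3 → ℤ) : 0 ≤ (1 + eig k) ^ s :=
  Real.rpow_nonneg (add_nonneg zero_le_one (eig_nonneg k)) s

theorem sobNorm_sq (s : ℝ) (w : L2) : sobNorm s w ^ 2 =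
    ENNReal.ofReal vol * ∑' k, ENNReal.ofReal ((1 + eig k) ^ s * ‖coeff w k‖ ^ 2) := by
  rw [sobNorm, ← ENNReal.rpow_mul_natCast]
  simp [vol]

theorem ofReal_sum_le_sobNorm_sq (s : ℝ) (w : L2) (S : Finset (Fin 3 → ℤ)) :
    ENNReal.ofReal (vol * ∑ k ∈ S, (1 + eig k) ^ s * ‖coeff w k‖ ^ 2) ≤ sobNorm s w ^ 2 := by
  rw [sobNorm_sq, ENNReal.ofReal_mul vol_pos.le, ENNReal.ofReal_sum_of_nonneg fun k _ =>
    mul_nonneg (one_add_eig_rpow_nonneg s k) (sq_nonneg _)]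
  gcongr
  exact ENNReal.sum_le_tsum S

theorem ofReal_sqrt_sum_le_sobNorm (w : L2) (S : Finset (Fin 3 → ℤ)) :
    ENNReal.ofReal √(vol * ∑ k ∈ S, (1 + eig k) * ‖coeff w k‖ ^ 2) ≤ sobNorm 1 w := by
  have h := ofReal_sum_le_sobNorm_sq 1 w S
  simp only [Real.rpow_one] at h
  have hnonneg : 0 ≤ vol * ∑ k ∈ S, (1 + eig k) * ‖coeff w k‖ ^ 2 :=
    mul_nonneg vol_pos.le (Finset.sum_nonneg fun k _ =>
      mul_nonneg (by linarith [eig_nonneg k]) (sq_nonneg _))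
  rwa [← ENNReal.pow_le_pow_left_iff two_ne_zero, ← ENNReal.ofReal_pow (Real.sqrt_nonneg _),
    Real.sq_sqrt hnonneg]

theorem summable_of_sobNorm_lt_top {w : L2} (h : sobNorm 1 w < ⊤) :
    Summable fun k => (1 + eig k) * ‖coeff w k‖ ^ 2 := by
  have hsum : ∑' k, ENNReal.ofReal ((1 + eig k) ^ (1 : ℝ) * ‖coeff w k‖ ^ 2) ≠ ⊤ := by
    have hsq := ENNReal.pow_lt_top h (n := 2)
    rw [sobNorm_sq] at hsq
    exact (ENNReal.lt_top_of_mul_ne_top_right hsq.ne (by simpa using vol_pos)).ne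
  refine (ENNReal.summable_toReal hsum).congr fun k => ?_
  rw [ENNReal.toReal_ofReal (mul_nonneg (one_add_eig_rpow_nonneg 1 k) (sq_nonneg _)),
    Real.rpow_one]

/-- The constant of the Sobolev embedding `H¹(𝕋³) ⊂ L⁶(𝕋³)`. -/
def sobConst : ℝ≥0 := exists_eLpNorm_partialSum_six_le.choose

theorem eLpNorm_partialSum_six_le (c : (Fin 3 → ℤ) → ℂ) (S : Finset (Fin 3 → ℤ)) :
    eLpNorm (partialSum c S) 6 volume ≤
      sobConst * ENNReal.ofReal √(vol * ∑ k ∈ S, (1 + eig k) * ‖c k‖ ^ 2) :=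
  exists_eLpNorm_partialSum_six_le.choose_spec c S

theorem eLpNorm_partialSum_coeff_six_le (w : L2) (S : Finset (Fin 3 → ℤ)) :
    eLpNorm (partialSum (coeff w) S) 6 volume ≤ sobConst * sobNorm 1 w := by
  refine (eLpNorm_partialSum_six_le _ S).trans ?_
  gcongr
  exact ofReal_sqrt_sum_le_sobNorm w S

theorem eLpNorm_sub_partialSum_six_le (w : L2) (S : Finset (Fin 3 → ℤ)) {R : ℝ≥0∞}
    (hR : ∀ S', S ⊆ S' →
      ENNReal.ofReal √(vol * ∑ k ∈ S' \ S, (1 + eig k) * ‖coeff w k‖ ^ 2) ≤ R) :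
    eLpNorm (fun x => w x - partialSum (coeff w) S x) 6 volume ≤ sobConst * R := by
  set c := coeff w
  have hlim : Tendsto (fun S' : Finset (Fin 3 → ℤ) =>
      (∑ k ∈ S', c k • expoL k : L2C) - ∑ k ∈ S, c k • expoL k) atTop
      (𝓝 (toC w - ∑ k ∈ S, c k • expoL k)) := (hasSum_coeff_smul_expoL w).sub_const _
  have hae : (toC w - ∑ k ∈ S, c k • expoL k : L2C) =ᵐ[volume]
      fun x => w x - partialSum c S x := by
    filter_upwards [Lp.coeFn_sub (toC w) (∑ k ∈ S, c k • expoL k), coeFn_toC w,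
      coeFn_sum_expoL c S] with x hsub hw hS
    rw [hsub, Pi.sub_apply, hw, hS]
  rw [← eLpNorm_congr_ae hae]
  refine eLpNorm_le_of_tendstoInMeasure ?_ (tendstoInMeasure_of_tendsto_Lp hlim)
    fun S' => Lp.aestronglyMeasurable _
  filter_upwards [eventually_ge_atTop S] with S' hS'
  rw [← Finset.sum_sdiff hS', add_sub_cancel_right, eLpNorm_congr_ae (coeFn_sum_expoL c _)]
  refine (eLpNorm_partialSum_six_le c _).trans ?_
  gcongr
  exact hR S' hS'

theorem eLpNorm_six_le (w : L2) : eLpNorm w 6 volume ≤ sobConst * sobNorm 1 w := by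
  refine le_trans (le_of_eq ?_) (eLpNorm_sub_partialSum_six_le w ∅ fun S' _ =>
    ofReal_sqrt_sum_le_sobNorm w (S' \ ∅))
  exact eLpNorm_congr_norm_ae (.of_forall fun x => by simp [partialSum])

theorem memLp_six {w : L2} (hw : sobNorm 1 w < ⊤) : MemLp w 6 volume :=
  ⟨Lp.aestronglyMeasurable w,
    (eLpNorm_six_le w).trans_lt (ENNReal.mul_lt_top ENNReal.coe_lt_top hw)⟩

theorem tendsto_eLpNorm_sub_partialSum {w : L2} (hw : sobNorm 1 w < ⊤) :
    Tendsto (fun S => eLpNorm (fun x => w x - partialSum (coeff w) S x) 6 volume) atTop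
      (𝓝 0) := by
  set e : (Fin 3 → ℤ) → ℝ := fun k => (1 + eig k) * ‖coeff w k‖ ^ 2
  have he : ∀ k, 0 ≤ e k := fun k => mul_nonneg (by linarith [eig_nonneg k]) (sq_nonneg _)
  have hsum : Summable e := summable_of_sobNorm_lt_top hw
  have htail : Tendsto (fun S => sobConst * ENNReal.ofReal √(vol * (∑' k, e k - ∑ k ∈ S, e k)))
      atTop (𝓝 0) := by
    have h := ((hsum.hasSum.const_sub (∑' k, e k)).const_mul vol).sqrt
    rw [sub_self, mul_zero, Real.sqrt_zero] at h
    simpa using ENNReal.Tendsto.const_mul (ENNReal.tendsto_ofReal h)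
      (Or.inr (ENNReal.coe_ne_top (r := sobConst)))
  refine tendsto_of_tendsto_of_tendsto_of_le_of_le tendsto_const_nhds htail
    (fun _ => zero_le) fun S => eLpNorm_sub_partialSum_six_le w S fun S' hS' => ?_
  have hv := vol_pos
  rw [Finset.sum_sdiff_eq_sub hS']
  gcongr
  exact hsum.sum_le_tsum S' fun k _ => he k

instance holderTriple_six : ENNReal.HolderTriple (6 / 5) 6 1 where
  inv_add_inv_eq_inv := by
    rw [ENNReal.inv_div (by simp) (by simp), ← one_div, ← ENNReal.add_div, inv_one,
      show (5 + 1 : ℝ≥0∞) = 6 by norm_num, ENNReal.div_self (by simp) (by simp)]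

theorem integrable_of_memLp_sixFifths {h : Torus → ℝ} (hh : MemLp h (6 / 5) volume) :
    Integrable h :=
  hh.integrable ((ENNReal.le_div_iff_mul_le (by simp) (by simp)).2 (by norm_num))

theorem integrable_ofReal_mul {h : Torus → ℝ} {z : Torus → ℂ} (hh : MemLp h (6 / 5) volume)
    (hz : MemLp z 6 volume) : Integrable fun x => h x * z x :=
  memLp_one_iff_integrable.1 (hz.smul hh)

theorem enorm_integral_ofReal_mul_le {h : Torus → ℝ} {z : Torus → ℂ}
    (hh : AEStronglyMeasurable h volume) (hz : AEStronglyMeasurable z volume) :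
    ‖∫ x, h x * z x‖ₑ ≤ eLpNorm h (6 / 5) volume * eLpNorm z 6 volume := by
  have hsmul : (fun x => h x * z x) = h • z := funext fun x => Complex.real_smul.symm
  refine (enorm_integral_le_lintegral_enorm _).trans ?_
  rw [← eLpNorm_one_eq_lintegral_enorm, hsmul]
  exact eLpNorm_smul_le_mul_eLpNorm hz hh

theorem sum_coeff_mul_conj {h : Torus → ℝ} (hh : Integrable h) (c : (Fin 3 → ℤ) → ℂ)
    (S : Finset (Fin 3 → ℤ)) :
    ∑ k ∈ S, coeff h k * conj (c k)
      = (vol : ℂ)⁻¹ * ∫ x, h x * conj (partialSum c S x) := by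
  have hexpand : ∀ x, (h x : ℂ) * conj (partialSum c S x)
      = ∑ k ∈ S, h x * expo (-k) x * conj (c k) := by
    intro x
    simp only [partialSum, map_sum, map_mul, Finset.mul_sum, expo_neg]
    exact Finset.sum_congr rfl fun k _ => by ring
  simp only [hexpand]
  rw [integral_finsetSum _ fun k _ => (integrable_ofReal_mul_expo hh _).mul_const _,
    Finset.mul_sum]
  refine Finset.sum_congr rfl fun k _ => ?_
  rw [integral_mul_const, coeff_def, mul_assoc]

theorem memLp_conj_partialSum (c : (Fin 3 → ℤ) → ℂ) (S : Finset (Fin 3 → ℤ)) :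
    MemLp (fun x => conj (partialSum c S x)) 6 volume :=
  (Complex.continuous_conj.comp (continuous_partialSum c S)).memLp_of_hasCompactSupport
    (HasCompactSupport.of_compactSpace _)

theorem enorm_sum_coeff_mul_conj_le {h : Torus → ℝ} (hh : MemLp h (6 / 5) volume) (z : L2)
    (S : Finset (Fin 3 → ℤ)) :
    ‖∑ k ∈ S, coeff h k * conj (coeff z k)‖ₑ ≤
      ‖(vol : ℂ)⁻¹‖ₑ * (eLpNorm h (6 / 5) volume * (sobConst * sobNorm 1 z)) := by
  have hconj : eLpNorm (fun x => conj (partialSum (coeff z) S x)) 6 volume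
      = eLpNorm (partialSum (coeff z) S) 6 volume :=
    eLpNorm_congr_norm_ae (.of_forall fun x => RCLike.norm_conj _)
  rw [sum_coeff_mul_conj (integrable_of_memLp_sixFifths hh), enorm_mul]
  gcongr
  refine (enorm_integral_ofReal_mul_le hh.1 (memLp_conj_partialSum _ S).1).trans ?_
  gcongr
  exact hconj.le.trans (eLpNorm_partialSum_coeff_six_le z S)

theorem hasSum_coeff_mul_conj_of_memLp {h : Torus → ℝ} (hh : MemLp h (6 / 5) volume) {z : L2}
    (hz : sobNorm 1 z < ⊤) :
    HasSum (fun k => coeff h k * conj (coeff z k)) ((vol⁻¹ * ∫ x, h x * z x : ℝ) : ℂ) := by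
  have hcast : ((∫ x, h x * z x : ℝ) : ℂ) = ∫ x, (h x : ℂ) * z x := by
    rw [← integral_complex_ofReal]
    simp only [Complex.ofReal_mul]
  simp only [HasSum, SummationFilter.unconditional_filter,
    sum_coeff_mul_conj (integrable_of_memLp_sixFifths hh)]
  rw [Complex.ofReal_mul, Complex.ofReal_inv, hcast]
  refine Tendsto.const_mul _ (tendsto_iff_edist_tendsto_0.2 ?_)
  have hlim := ENNReal.Tendsto.const_mul (tendsto_eLpNorm_sub_partialSum hz) (Or.inr hh.2.ne)
  rw [mul_zero] at hlim
  refine tendsto_of_tendsto_of_tendsto_of_le_of_le tendsto_const_nhds hlim (fun _ => zero_le)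
    fun S => ?_
  have hS := memLp_conj_partialSum (coeff z) S
  have hz6 : MemLp (fun x => (z x : ℂ)) 6 volume := (memLp_six hz).ofReal
  beta_reduce
  rw [edist_comm, edist_eq_enorm_sub,
    ← integral_sub (integrable_ofReal_mul hh hz6) (integrable_ofReal_mul hh hS)]
  simp only [← mul_sub]
  refine (enorm_integral_ofReal_mul_le hh.1 (hz6.1.sub hS.1)).trans (mul_le_mul' le_rfl
    (le_of_eq (eLpNorm_congr_norm_ae (.of_forall fun x => ?_))))
  rw [Pi.sub_apply, ← RCLike.norm_conj, map_sub, Complex.conj_conj, Complex.conj_ofReal]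

/-! ### Trigonometric functions and weak derivatives -/

/-- The real trigonometric function `Re (c e^{ik·x})`. -/
def trig (c : ℂ) (k : Fin 3 → ℤ) (x : Torus) : ℝ := (c * expo k x).re

theorem trig_ofReal_mul (a : ℝ) (c : ℂ) (k : Fin 3 → ℤ) :
    trig (a * c) k = fun x => a * trig c k x := by
  ext x
  simp only [trig, mul_assoc, Complex.re_ofReal_mul]

theorem ofReal_trig (c : ℂ) (k : Fin 3 → ℤ) (x : Torus) :
    (trig c k x : ℂ) = c / 2 * expo k x + conj c / 2 * expo (-k) x := by
  rw [trig, Complex.re_eq_add_conj, map_mul, expo_neg]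
  ring

theorem smoothOnTorus_trig (c : ℂ) (k : Fin 3 → ℤ) : SmoothOnTorus (trig c k) :=
  Complex.reCLM.contDiff.comp (contDiff_const.mul (contDiff_expo_proj k))

theorem proj_zero : proj 0 = 0 := by
  ext
  simp [proj]

theorem proj_add (y z : Fin 3 → ℝ) : proj (y + z) = proj y + proj z := by
  ext
  simp [proj]

theorem hasDerivAt_expo_proj_single (k : Fin 3 → ℤ) (i : Fin 3) :
    HasDerivAt (fun s : ℝ => expo k (proj (Pi.single i s))) (Complex.I * k i) 0 := by
  have h := (hasFDerivAt_expo_proj k (Pi.single i 0)).comp_hasDerivAt (0 : ℝ)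
    (hasDerivAt_single (𝕜 := ℝ) i 0)
  have hone : expo k 0 = 1 := by simp [expo]
  simpa [Function.comp_def, sum_apply, Pi.single_apply, proj_zero, hone] using h

theorem partialDeriv_trig (i : Fin 3) (c : ℂ) (k : Fin 3 → ℤ) :
    partialDeriv i (trig c k) = trig (Complex.I * k i * c) k := by
  ext x
  have h : HasDerivAt (fun s : ℝ => (c * expo k (x + proj (Pi.single i s))).re)
      (c * expo k x * (Complex.I * k i)).re 0 := by
    simpa only [expo_apply_add, mul_assoc, Function.comp_def, Complex.reCLM_apply] using
      Complex.reCLM.hasFDerivAt.comp_hasDerivAt (0 : ℝ)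
        ((hasDerivAt_expo_proj_single k i).const_mul (c * expo k x))
  rw [trig, mul_assoc, mul_comm]
  exact h.deriv

theorem integral_mul_trig {w : Torus → ℝ} (hw : Integrable w) (c : ℂ) (k : Fin 3 → ℤ) :
    ∫ x, w x * trig c k x = vol * (c * coeff w (-k)).re := by
  have hre : ∀ x, w x * trig c k x = Complex.reCLM (c * (w x * expo k x)) := by
    intro x
    rw [Complex.reCLM_apply, mul_left_comm, Complex.re_ofReal_mul, trig]
  simp only [hre]
  rw [Complex.reCLM.integral_comp_comm ((integrable_ofReal_mul_expo hw k).const_mul c),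
    integral_const_mul, Complex.reCLM_apply, ← Complex.re_ofReal_mul, coeff_def, neg_neg,
    mul_left_comm, mul_inv_cancel_left₀ ofReal_vol_ne_zero]

theorem coeff_trig (c : ℂ) (k j : Fin 3 → ℤ) :
    coeff (trig c k) j = (if j = k then c / 2 else 0) + (if j = -k then conj c / 2 else 0) := by
  have hint : ∀ c k, Integrable fun x => c * expo k x * expo (-j) x := fun c k =>
    ((continuous_const.mul (continuous_expo k)).mul
      (continuous_expo (-j))).integrable_of_hasCompactSupport (.of_compactSpace _)
  have hexpo : ∀ k, ∫ x, expo k x * expo (-j) x = if j = k then (vol : ℂ) else 0 := fun k => by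
    simp only [← expo_add, integral_expo, ← sub_eq_add_neg, sub_eq_zero, eq_comm]
  simp only [coeff_def, ofReal_trig, add_mul]
  rw [integral_add (hint _ _) (hint _ _)]
  simp only [mul_assoc, integral_const_mul, hexpo, mul_add]
  have := ofReal_vol_ne_zero
  congr 1 <;> split_ifs <;> field_simp <;> simp

theorem fracLap_trig (θ : ℝ) (c : ℂ) (k : Fin 3 → ℤ) (x : Torus) :
    fracLap θ (trig c k) x = eig k ^ θ * trig c k x := by
  have hsum : HasSum (fun j => ((eig j ^ θ : ℝ) : ℂ) * coeff (trig c k) j * expo j x)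
      (((eig k ^ θ : ℝ) : ℂ) * (c / 2) * expo k x
        + ((eig k ^ θ : ℝ) : ℂ) * (conj c / 2) * expo (-k) x) := by
    refine ((hasSum_ite_eq k _).add (hasSum_ite_eq (-k) _)).congr_fun fun j => ?_
    rw [coeff_trig, mul_add, add_mul]
    congr 1 <;> split_ifs with h
    · rw [h]
    · simp
    · rw [h, eig_neg]
    · simp
  have hval : ((eig k ^ θ : ℝ) : ℂ) * (c / 2) * expo k x
      + ((eig k ^ θ : ℝ) : ℂ) * (conj c / 2) * expo (-k) x
      = ((eig k ^ θ * trig c k x : ℝ) : ℂ) := by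
    rw [Complex.ofReal_mul, ofReal_trig]
    ring
  rw [fracLap, hsum.tsum_eq, hval, Complex.ofReal_re]

theorem SmoothOnTorus.continuous {ψ : Torus → ℝ} (hψ : SmoothOnTorus ψ) : Continuous ψ :=
  isOpenQuotientMap_proj.isQuotientMap.continuous_iff.2 (ContDiff.continuous hψ)

theorem SmoothOnTorus.hasDerivAt_proj_add_single {ψ : Torus → ℝ} (hψ : SmoothOnTorus ψ)
    (i : Fin 3) (y : Fin 3 → ℝ) (s : ℝ) :
    HasDerivAt (fun s : ℝ => ψ (proj y + proj (Pi.single i s)))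
      (fderiv ℝ (fun y => ψ (proj y)) (y + Pi.single i s) (Pi.single i 1)) s := by
  have hd := (ContDiff.differentiable hψ (by simp) (y + Pi.single i s)).hasFDerivAt
  simpa only [Function.comp_def, proj_add] using
    hd.comp_hasDerivAt s ((hasDerivAt_single (𝕜 := ℝ) i s).const_add y)

theorem SmoothOnTorus.partialDeriv_proj {ψ : Torus → ℝ} (hψ : SmoothOnTorus ψ) (i : Fin 3)
    (y : Fin 3 → ℝ) :
    partialDeriv i ψ (proj y) = fderiv ℝ (fun y => ψ (proj y)) y (Pi.single i 1) := by
  simpa [partialDeriv] using (hψ.hasDerivAt_proj_add_single i y 0).deriv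

theorem SmoothOnTorus.continuous_partialDeriv {ψ : Torus → ℝ} (hψ : SmoothOnTorus ψ)
    (i : Fin 3) : Continuous (partialDeriv i ψ) := by
  rw [isOpenQuotientMap_proj.isQuotientMap.continuous_iff]
  have h : partialDeriv i ψ ∘ proj = fun y => fderiv ℝ (fun y => ψ (proj y)) y (Pi.single i 1) :=
    funext fun y => hψ.partialDeriv_proj i y
  rw [h]
  exact (ContDiff.continuous_fderiv hψ (by simp)).clm_apply continuous_const

theorem SmoothOnTorus.hasDerivAt_add_proj_single {ψ : Torus → ℝ} (hψ : SmoothOnTorus ψ)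
    (i : Fin 3) (x : Torus) (s : ℝ) :
    HasDerivAt (fun s : ℝ => ψ (x + proj (Pi.single i s)))
      (partialDeriv i ψ (x + proj (Pi.single i s))) s := by
  obtain ⟨y, rfl⟩ := isOpenQuotientMap_proj.surjective x
  rw [← proj_add, hψ.partialDeriv_proj]
  exact hψ.hasDerivAt_proj_add_single i y s

theorem coeff_comp_add_right (w : Torus → ℝ) (y : Torus) (k : Fin 3 → ℤ) :
    coeff (fun x => w (x + y)) k = expo k y * coeff w k := by
  have hinv : expo k y * expo (-k) y = 1 := by
    rw [← expo_add, add_neg_cancel, expo_zero]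
  have hshift : ∀ x, (w (x + y) : ℂ) * expo (-k) x
      = expo k y * (w (x + y) * expo (-k) (x + y)) := fun x => by
    rw [expo_apply_add]
    linear_combination (-(w (x + y) : ℂ) * expo (-k) x) * hinv
  simp only [coeff_def, hshift]
  rw [integral_const_mul, mul_left_comm,
    integral_add_right_eq_self (fun x => (w x : ℂ) * expo (-k) x) y]

theorem SmoothOnTorus.hasDerivAt_coeff_comp_add_right {ψ : Torus → ℝ} (hψ : SmoothOnTorus ψ)
    (i : Fin 3) (k : Fin 3 → ℤ) :
    HasDerivAt (fun s : ℝ => coeff (fun x => ψ (x + proj (Pi.single i s))) k)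
      (coeff (partialDeriv i ψ) k) 0 := by
  have hcont : ∀ {χ : Torus → ℝ}, Continuous χ → ∀ s,
      Continuous fun x => (χ (x + proj (Pi.single i s)) : ℂ) * expo (-k) x := fun hχ s =>
    (Complex.continuous_ofReal.comp (hχ.comp (continuous_id.add continuous_const))).mul
      (continuous_expo _)
  obtain ⟨M, hM⟩ := isCompact_univ.exists_bound_of_continuousOn
    (hψ.continuous_partialDeriv i).continuousOn
  have h := (hasDerivAt_integral_of_dominated_loc_of_deriv_le (μ := (volume : Measure Torus))
    (F := fun s x => (ψ (x + proj (Pi.single i s)) : ℂ) * expo (-k) x)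
    (F' := fun s x => (partialDeriv i ψ (x + proj (Pi.single i s)) : ℂ) * expo (-k) x)
    (x₀ := (0 : ℝ)) (s := Set.univ) (bound := fun _ => M) univ_mem
    (.of_forall fun s => (hcont hψ.continuous s).aestronglyMeasurable)
    ((hcont hψ.continuous 0).integrable_of_hasCompactSupport (.of_compactSpace _))
    (hcont (hψ.continuous_partialDeriv i) 0).aestronglyMeasurable
    (.of_forall fun x s _ => by
      rw [norm_mul, norm_expo, mul_one, Complex.norm_real]
      exact hM _ trivial)
    (integrable_const M)
    (.of_forall fun x s _ =>
      (hψ.hasDerivAt_add_proj_single i x s).ofReal_comp.mul_const _)).2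
  simpa [coeff_def, proj_zero] using h.const_mul (vol : ℂ)⁻¹

theorem SmoothOnTorus.coeff_partialDeriv {ψ : Torus → ℝ} (hψ : SmoothOnTorus ψ) (i : Fin 3)
    (k : Fin 3 → ℤ) : coeff (partialDeriv i ψ) k = Complex.I * k i * coeff ψ k := by
  have h := hψ.hasDerivAt_coeff_comp_add_right i k
  simp only [coeff_comp_add_right] at h
  exact h.unique ((hasDerivAt_expo_proj_single k i).mul_const _)

theorem coeff_neg (w : Torus → ℝ) (k : Fin 3 → ℤ) : coeff w (-k) = conj (coeff w k) := by
  simp only [coeff_def, map_mul, map_inv₀, Complex.conj_ofReal, ← integral_conj, expo_neg,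
    Complex.conj_conj]

theorem exists_isWeakPartial {w : L2} (hw : sobNorm 1 w < ⊤) (i : Fin 3) :
    ∃ G : L2, IsWeakPartial i w G := by
  have hsum : Summable fun k : Fin 3 → ℤ => ‖Complex.I * k i * coeff w k‖ ^ 2 := by
    refine (summable_of_sobNorm_lt_top hw).of_nonneg_of_le (fun k => by positivity) fun k => ?_
    rw [norm_mul, norm_mul, Complex.norm_I, one_mul, mul_pow, Complex.norm_intCast, sq_abs]
    gcongr
    linarith [sq_le_eig k i]
  obtain ⟨G, hG⟩ := exists_coeff_eq hsum fun k => by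
    simp [coeff_neg]
  refine ⟨G, fun ψ hψ => ?_⟩
  let toL2 (χ : Torus → ℝ) (hχ : Continuous χ) : L2 :=
    ContinuousMap.toLp (E := ℝ) 2 volume ℝ ⟨χ, hχ⟩
  have hae : ∀ χ hχ, toL2 χ hχ =ᵐ[volume] χ := fun χ hχ => ContinuousMap.coeFn_toLp volume _
  have hint : ∀ (v : L2) χ hχ, ∫ x, v x * toL2 χ hχ x = ∫ x, v x * χ x := fun v χ hχ =>
    integral_congr_ae (by filter_upwards [hae χ hχ] with x hx; rw [hx])
  have hψc := hψ.continuous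
  have hDc := hψ.continuous_partialDeriv i
  have hD := hasSum_coeff_mul_conj_coeff w (toL2 _ hDc)
  have hP := (hasSum_coeff_mul_conj_coeff G (toL2 ψ hψc)).neg
  have hterm : ∀ k, coeff w k * conj (coeff (toL2 _ hDc) k)
      = -(coeff G k * conj (coeff (toL2 ψ hψc) k)) := fun k => by
    rw [hG, coeff_congr (hae _ _), coeff_congr (hae _ _), hψ.coeff_partialDeriv]
    simp only [map_mul, Complex.conj_I, map_intCast]
    ring
  simp only [hterm] at hD
  have heq := hD.unique hP
  rw [hint, hint, ← Complex.ofReal_neg, Complex.ofReal_inj, ← mul_neg] at heq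
  exact mul_left_cancel₀ (inv_ne_zero vol_pos.ne') heq

theorem isWeakPartial_weakPartial {w : L2} (hw : sobNorm 1 w < ⊤) (i : Fin 3) :
    IsWeakPartial i w (weakPartial i w) := by
  have h := exists_isWeakPartial hw i
  rw [weakPartial, dif_pos h]
  exact h.choose_spec

theorem integral_weakPartial_mul_partialDeriv_trig {w : L2} (hw : sobNorm 1 w < ⊤) (i : Fin 3)
    (c : ℂ) (k : Fin 3 → ℤ) :
    ∫ x, weakPartial i w x * partialDeriv i (trig c k) x
      = (k i : ℝ) ^ 2 * ∫ x, w x * trig c k x := by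
  have hI : Complex.I * k i * (Complex.I * k i * c) = ((-(k i : ℝ) ^ 2 : ℝ) : ℂ) * c := by
    push_cast
    linear_combination (k i ^ 2 * c) * Complex.I_sq
  have h := isWeakPartial_weakPartial hw i _ (smoothOnTorus_trig (Complex.I * k i * c) k)
  rw [partialDeriv_trig, hI, trig_ofReal_mul, eq_neg_iff_add_eq_zero] at h
  simp only [mul_left_comm _ (-(k i : ℝ) ^ 2), integral_const_mul] at h
  rw [partialDeriv_trig]
  linarith

/-! ### Translations and second differences -/

/-- Translation of `w ∈ L²(𝕋³)` by `y`. -/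
def shift (y : Torus) (w : L2) : L2 :=
  Lp.compMeasurePreserving (fun x => x + y) (measurePreserving_add_right volume y) w

theorem coeFn_shift (y : Torus) (w : L2) : shift y w =ᵐ[volume] fun x => w (x + y) :=
  Lp.coeFn_compMeasurePreserving w (measurePreserving_add_right volume y)

/-- The symmetric second difference `w - (w(· + y) + w(· - y)) / 2`. -/
def secondDiff (y : Torus) (w : L2) : L2 := w - (1 / 2 : ℝ) • (shift y w + shift (-y) w)

theorem coeFn_secondDiff (y : Torus) (w : L2) :
    secondDiff y w =ᵐ[volume] fun x => w x - (w (x + y) + w (x - y)) / 2 := by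
  filter_upwards [Lp.coeFn_sub w ((1 / 2 : ℝ) • (shift y w + shift (-y) w)),
    Lp.coeFn_smul (1 / 2 : ℝ) (shift y w + shift (-y) w),
    Lp.coeFn_add (shift y w) (shift (-y) w), coeFn_shift y w, coeFn_shift (-y) w]
    with x hsub hsmul hadd hpos hneg
  rw [secondDiff, hsub, Pi.sub_apply, hsmul, Pi.smul_apply, hadd, Pi.add_apply, hpos, hneg,
    smul_eq_mul, sub_eq_add_neg x]
  ring

theorem coeff_secondDiff (y : Torus) (w : L2) (k : Fin 3 → ℤ) :
    coeff (secondDiff y w) k = ((1 - (expo k y).re : ℝ) : ℂ) * coeff w k := by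
  rw [← coeffCLM_apply, secondDiff, map_sub, map_smul, map_add]
  simp only [coeffCLM_apply]
  rw [coeff_congr (coeFn_shift y w), coeff_congr (coeFn_shift (-y) w), coeff_comp_add_right,
    coeff_comp_add_right, expo_apply_neg, ← add_mul, Complex.add_conj, Complex.real_smul]
  push_cast
  ring

theorem one_sub_re_expo_mem_Icc (k : Fin 3 → ℤ) (y : Torus) :
    1 - (expo k y).re ∈ Set.Icc 0 2 := by
  have h := abs_le.1 ((Complex.abs_re_le_norm (expo k y)).trans (norm_expo k y).le)
  constructor <;> linarith [h.1, h.2]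

theorem sobNorm_secondDiff_le (y : Torus) (w : L2) :
    sobNorm 1 (secondDiff y w) ≤ 2 * sobNorm 1 w := by
  rw [← ENNReal.pow_le_pow_left_iff two_ne_zero, mul_pow, sobNorm_sq, sobNorm_sq, mul_left_comm]
  refine mul_le_mul' le_rfl ?_
  rw [← ENNReal.tsum_mul_left]
  refine ENNReal.tsum_le_tsum fun k => ?_
  obtain ⟨hnonneg, hle⟩ := one_sub_re_expo_mem_Icc k y
  have hpos := one_add_eig_rpow_nonneg 1 k
  rw [show (2 : ℝ≥0∞) ^ 2 = ENNReal.ofReal (2 ^ 2) by norm_num,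
    ← ENNReal.ofReal_mul (by positivity), coeff_secondDiff, norm_mul, Complex.norm_real, mul_pow,
    Real.norm_of_nonneg hnonneg, mul_left_comm]
  gcongr

theorem integrable_mul_of_memLp {h z : Torus → ℝ} (hh : MemLp h (6 / 5) volume)
    (hz : MemLp z 6 volume) : Integrable fun x => h x * z x :=
  memLp_one_iff_integrable.1 (hz.smul hh)

theorem integral_mul_secondDiff {h : Torus → ℝ} {w : L2} (hh : MemLp h (6 / 5) volume)
    (hw : MemLp w 6 volume) (y : Torus) :
    ∫ x, h x * secondDiff y w x = (∫ x, (h x - h (x + y)) * (w x - w (x + y))) / 2 := by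
  have hshift := measurePreserving_add_right (volume : Measure Torus) y
  have hh' : MemLp (fun x => h (x + y)) (6 / 5) volume := hh.comp_measurePreserving hshift
  have hd : MemLp (fun x => w x - w (x + y)) 6 volume := hw.sub (hw.comp_measurePreserving hshift)
  have hd' : MemLp (fun x => w x - w (x - y)) 6 volume :=
    hw.sub (hw.comp_measurePreserving (measurePreserving_sub_right volume y))
  have hsplit : ∫ x, h x * secondDiff y w x
      = ∫ x, (h x * (w x - w (x + y)) + h x * (w x - w (x - y))) / 2 := by
    refine integral_congr_ae ?_
    filter_upwards [coeFn_secondDiff y w] with x hx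
    rw [hx]
    ring
  have hswap : ∫ x, h x * (w x - w (x - y)) = -∫ x, h (x + y) * (w x - w (x + y)) := by
    rw [← integral_add_right_eq_self (fun x => h x * (w x - w (x - y))) y, ← integral_neg]
    simp only [add_sub_cancel_right, ← mul_neg, neg_sub]
  rw [hsplit, integral_div, integral_add (integrable_mul_of_memLp hh hd)
    (integrable_mul_of_memLp hh hd'), hswap, ← sub_eq_add_neg,
    ← integral_sub (integrable_mul_of_memLp hh hd) (integrable_mul_of_memLp hh' hd)]
  simp only [← sub_mul]

theorem integral_comp_mul_secondDiff_nonneg {h : ℝ → ℝ} (hmono : Monotone h) {w : L2}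
    (hh : MemLp (fun x => h (w x)) (6 / 5) volume) (hw : MemLp w 6 volume) (y : Torus) :
    0 ≤ ∫ x, h (w x) * secondDiff y w x := by
  rw [integral_mul_secondDiff hh hw]
  refine div_nonneg (integral_nonneg fun x => ?_) zero_le_two
  rcases le_total (w x) (w (x + y)) with hle | hle
  · exact mul_nonneg_of_nonpos_of_nonpos (sub_nonpos.2 (hmono hle)) (sub_nonpos.2 hle)
  · exact mul_nonneg (sub_nonneg.2 (hmono hle)) (sub_nonneg.2 hle)

/-! ### The nonlinearity -/

section Nonlinear

/-- At most quintic growth `|h s| ≤ A (1 + |s|⁵)`, the critical rate for `H¹(𝕋³) ⊂ L⁶`. -/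
def QuinticGrowth (A : ℝ) (h : ℝ → ℝ) : Prop := ∀ s, |h s| ≤ A * (1 + |s| ^ 5)

variable {A : ℝ} {h : ℝ → ℝ}

theorem QuinticGrowth.nonneg (hg : QuinticGrowth A h) : 0 ≤ A := by
  simpa using (abs_nonneg _).trans (hg 0)

theorem one_le_six_fifths : (1 : ℝ≥0∞) ≤ 6 / 5 := by
  rw [ENNReal.le_div_iff_mul_le (by simp) (by simp)]
  norm_num

theorem eLpNorm_pow_five (w : Torus → ℝ) :
    eLpNorm (fun x => |w x| ^ 5) (6 / 5) volume = eLpNorm w 6 volume ^ 5 := by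
  have hexp : (6 / 5 : ℝ≥0∞) * ENNReal.ofReal 5 = 6 := by
    rw [ENNReal.ofReal_ofNat]
    exact ENNReal.div_mul_cancel (by simp) (by simp)
  have h := eLpNorm_norm_rpow (μ := (volume : Measure Torus)) (p := 6 / 5) w (q := 5) (by norm_num)
  simpa only [hexp, Real.norm_eq_abs, Real.rpow_ofNat, ENNReal.rpow_ofNat] using h

theorem eLpNorm_comp_le (hg : QuinticGrowth A h) (w : L2) :
    eLpNorm (fun x => h (w x)) (6 / 5) volume ≤ ENNReal.ofReal A *
      (eLpNorm (fun _ : Torus => (1 : ℝ)) (6 / 5) volume + (sobConst * sobNorm 1 w) ^ 5) := by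
  have hfactor : eLpNorm (fun x => A * (1 + |w x| ^ 5)) (6 / 5) volume
      = ENNReal.ofReal A * eLpNorm (fun x => 1 + |w x| ^ 5) (6 / 5) volume := by
    rw [← Real.enorm_of_nonneg hg.nonneg]
    exact eLpNorm_const_smul A (fun x => 1 + |w x| ^ 5) (6 / 5) volume
  refine (eLpNorm_mono_real fun x => hg (w x)).trans (hfactor.trans_le ?_)
  gcongr
  refine (eLpNorm_add_le aestronglyMeasurable_const
    ((Lp.aestronglyMeasurable w).norm.pow 5) one_le_six_fifths).trans ?_
  gcongr
  exact (eLpNorm_pow_five w).trans_le (by gcongr; exact eLpNorm_six_le w)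

theorem memLp_comp (hc : Continuous h) (hg : QuinticGrowth A h) {w : L2} (hw : sobNorm 1 w < ⊤) :
    MemLp (fun x => h (w x)) (6 / 5) volume := by
  refine ⟨hc.comp_aestronglyMeasurable (Lp.aestronglyMeasurable w),
    (eLpNorm_comp_le hg w).trans_lt (ENNReal.mul_lt_top ENNReal.ofReal_lt_top
      (ENNReal.add_lt_top.2 ⟨(memLp_const (1 : ℝ)).2, ?_⟩))⟩
  exact ENNReal.pow_lt_top (ENNReal.mul_lt_top ENNReal.coe_lt_top hw)

theorem integrable_comp (hc : Continuous h) (hg : QuinticGrowth A h) {w : L2}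
    (hw : sobNorm 1 w < ⊤) : Integrable fun x => h (w x) :=
  (memLp_comp hc hg hw).integrable one_le_six_fifths

theorem exists_seq_tendsto_ae {w : ℕ → L2} {w₀ : L2} (hw : Tendsto w atTop (𝓝 w₀)) :
    ∃ φ : ℕ → ℕ, StrictMono φ ∧ ∀ᵐ x, Tendsto (fun n => w (φ n) x) atTop (𝓝 (w₀ x)) :=
  (tendstoInMeasure_of_tendsto_Lp hw).exists_seq_tendsto_ae

theorem continuous_coeff_comp_of_bounded (hc : Continuous h) {B : ℝ} (hB : ∀ s, |h s| ≤ B)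
    (k : Fin 3 → ℤ) : Continuous fun w : L2 => coeff (fun x => h (w x)) k := by
  refine continuous_iff_seqContinuous.2 fun w w₀ hw => ?_
  refine tendsto_of_subseq_tendsto fun ns hns => ?_
  obtain ⟨φ, -, hφ⟩ := exists_seq_tendsto_ae (hw.comp hns)
  refine ⟨φ, Tendsto.const_mul _ ?_⟩
  refine tendsto_integral_of_dominated_convergence (fun _ => B) (fun n => ?_)
    (integrable_const B) (fun n => Eventually.of_forall fun x => ?_) ?_
  · exact (Complex.continuous_ofReal.comp hc).comp_aestronglyMeasurable
      (Lp.aestronglyMeasurable _) |>.mul (continuous_expo _).aestronglyMeasurable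
  · rw [norm_mul, norm_expo, mul_one, Complex.norm_real]
    exact hB _
  · filter_upwards [hφ] with x hx
    exact (((Complex.continuous_ofReal.comp hc).tendsto _).comp hx).mul_const _

theorem abs_max_neg_min_le (M s : ℝ) (hM : 0 ≤ M) : |max (-M) (min s M)| ≤ min |s| M := by
  grind

theorem aestronglyMeasurable_coeff_comp (hc : Continuous h) {μ : Measure ℝ} {u : ℝ → L2}
    (hu : AEStronglyMeasurable u μ) (hi : ∀ᵐ t ∂μ, Integrable fun x => h (u t x))
    (k : Fin 3 → ℤ) : AEStronglyMeasurable (fun t => coeff (fun x => h (u t x)) k) μ := by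
  have habs (n : ℕ) (s : ℝ) := abs_max_neg_min_le n (h s) n.cast_nonneg
  have hcn (n : ℕ) : Continuous fun s => max (-(n : ℝ)) (min (h s) n) :=
    continuous_const.max (hc.min continuous_const)
  refine aestronglyMeasurable_of_tendsto_ae atTop
    (f := fun (n : ℕ) t => coeff (fun x => max (-(n : ℝ)) (min (h (u t x)) n)) k) (fun n => ?_) ?_
  · exact (continuous_coeff_comp_of_bounded (hcn n)
      (fun s => (habs n s).trans (min_le_right _ _)) k).comp_aestronglyMeasurable hu
  filter_upwards [hi] with t ht
  refine Tendsto.const_mul _ ?_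
  refine tendsto_integral_of_dominated_convergence (fun x => |h (u t x)|) (fun n => ?_) ht.abs
    (fun n => Eventually.of_forall fun x => ?_) (Eventually.of_forall fun x => ?_)
  · exact (Complex.continuous_ofReal.comp (hcn n)).comp_aestronglyMeasurable
      (Lp.aestronglyMeasurable (u t)) |>.mul (continuous_expo _).aestronglyMeasurable
  · rw [norm_mul, norm_expo, mul_one, Complex.norm_real]
    exact (habs n (u t x)).trans (min_le_left _ _)
  · refine tendsto_const_nhds.congr' ?_
    filter_upwards [eventually_ge_atTop ⌈|h (u t x)|⌉₊] with n hn
    obtain ⟨hneg, hle⟩ := abs_le.1 ((Nat.le_ceil |h (u t x)|).trans (Nat.cast_le.2 hn))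
    rw [min_eq_left hle, max_eq_right hneg]

variable {C κ K : ℝ} {f : ℝ → ℝ}

theorem Nonlinearity.monotone (hf : Nonlinearity C κ K f) : Monotone fun s => f s + K * s := by
  have hd (s : ℝ) : HasDerivAt (fun s => f s + K * s) (deriv f s + K) s := by
    simpa using (hf.contDiff.differentiable one_ne_zero s).hasDerivAt.fun_add
      ((hasDerivAt_id s).const_mul K)
  refine monotone_of_deriv_nonneg (fun s => (hd s).differentiableAt) fun s => ?_
  rw [(hd s).deriv]
  linarith [hf.deriv_ge s]

theorem Nonlinearity.quinticGrowth (hC : 0 < C) (hf : Nonlinearity C κ K f) :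
    QuinticGrowth (|f 0| + 2 * C) f := by
  intro s
  have hmean : |f s - f 0| ≤ C * (1 + |s| ^ 4) * |s| := by
    have h := (convex_Icc (-|s|) |s|).norm_image_sub_le_of_norm_deriv_le (f := f)
      (C := C * (1 + |s| ^ 4)) (fun x _ => hf.contDiff.differentiable one_ne_zero x)
      (fun x hx => (hf.growth x).trans ?_) (x := 0) (y := s) (by simp) (abs_le.1 le_rfl)
    · simpa using h
    · have := abs_le.2 hx
      gcongr
  have hlin : |s| ≤ 1 + |s| ^ 5 := by
    nlinarith [sq_nonneg (|s| ^ 2 - 1), sq_nonneg (|s| - 1), abs_nonneg s,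
      pow_nonneg (abs_nonneg s) 5, pow_nonneg (abs_nonneg s) 3]
  have hpow : 0 ≤ |s| ^ 5 := by positivity
  calc |f s| ≤ |f 0| + |f s - f 0| := by simpa using abs_add_le (f 0) (f s - f 0)
    _ ≤ |f 0| + C * |s| + C * |s| ^ 5 := by linarith
    _ ≤ |f 0| + C * (1 + |s| ^ 5) + C * |s| ^ 5 := by gcongr
    _ ≤ (|f 0| + 2 * C) * (1 + |s| ^ 5) := by nlinarith [mul_nonneg (abs_nonneg (f 0)) hpow]

end Nonlinear

/-! ### Weak derivatives in time -/

section Time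

/-- Smooth functions of time with compact support in `(0, T)`. -/
structure IsTimeTest (T : ℝ) (θ : ℝ → ℝ) : Prop where
  smooth : ContDiff ℝ ∞ θ
  supp : ∃ a b : ℝ, 0 < a ∧ b < T ∧ ∀ t, t ∉ Set.Icc a b → θ t = 0

/-- `V` is the distributional derivative of `U` on `(0, T)`. -/
def HasWeakDeriv (T : ℝ) (U V : ℝ → ℝ) : Prop :=
  ∀ θ, IsTimeTest T θ →
    ∫ t in Set.Ioo 0 T, deriv θ t * U t = -∫ t in Set.Ioo 0 T, θ t * V t

variable {T : ℝ} {U V N θ ρ : ℝ → ℝ}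

theorem integral_Ioo_eq_intervalIntegral (hT : 0 ≤ T) (F : ℝ → ℝ) :
    ∫ t in Set.Ioo 0 T, F t = ∫ t in (0 : ℝ)..T, F t := by
  rw [intervalIntegral.integral_of_le hT, integral_Ioc_eq_integral_Ioo]

theorem integrableOn_Ioo_continuous_mul (hθ : Continuous θ) (hN : IntegrableOn N (Set.Ioo 0 T)) :
    IntegrableOn (fun t => θ t * N t) (Set.Ioo 0 T) :=
  hN.continuousOn_mul_of_subset hθ.continuousOn isCompact_Icc measurableSet_Ioo
    Set.Ioo_subset_Icc_self

theorem IsTimeTest.of_tsupport (hT : 0 < T) (hθ : ContDiff ℝ ∞ θ) (hc : HasCompactSupport θ)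
    (hs : tsupport θ ⊆ Set.Ioo 0 T) : IsTimeTest T θ := by
  have hcompact : IsCompact (insert (T / 2) (tsupport θ)) := hc.isCompact.insert _
  have hne : (insert (T / 2) (tsupport θ)).Nonempty := Set.insert_nonempty _ _
  have hsub : insert (T / 2) (tsupport θ) ⊆ Set.Ioo 0 T :=
    Set.insert_subset ⟨half_pos hT, half_lt_self hT⟩ hs
  obtain ⟨a, ha⟩ := hcompact.exists_isLeast hne
  obtain ⟨b, hb⟩ := hcompact.exists_isGreatest hne
  refine ⟨hθ, a, b, (hsub ha.1).1, (hsub hb.1).2, fun t ht => ?_⟩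
  refine image_eq_zero_of_notMem_tsupport fun hmem => ht ?_
  exact ⟨ha.2 (Set.mem_insert_of_mem _ hmem), hb.2 (Set.mem_insert_of_mem _ hmem)⟩

theorem IsTimeTest.sub_const_mul (hθ : IsTimeTest T θ) (hρ : IsTimeTest T ρ) (c : ℝ) :
    IsTimeTest T (fun t => θ t - c * ρ t) := by
  obtain ⟨a, b, ha, hb, hab⟩ := hθ.supp
  obtain ⟨a', b', ha', hb', hab'⟩ := hρ.supp
  refine ⟨hθ.smooth.sub (contDiff_const.mul hρ.smooth),
    min a a', max b b', lt_min ha ha', max_lt hb hb', fun t ht => ?_⟩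
  rw [hab t fun h => ht ⟨(min_le_left _ _).trans h.1, h.2.trans (le_max_left _ _)⟩,
    hab' t fun h => ht ⟨(min_le_right _ _).trans h.1, h.2.trans (le_max_right _ _)⟩,
    mul_zero, sub_zero]

theorem IsTimeTest.exists_deriv_eq (hθ : IsTimeTest T θ) (hmean : ∫ t in (0 : ℝ)..T, θ t = 0) :
    ∃ Θ, IsTimeTest T Θ ∧ deriv Θ = θ := by
  have hc : Continuous θ := hθ.smooth.continuous
  have hderiv (t : ℝ) : HasDerivAt (fun t => ∫ s in (0 : ℝ)..t, θ s) (θ t) t :=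
    intervalIntegral.integral_hasDerivAt_right (hc.intervalIntegrable _ _)
      (hc.stronglyMeasurableAtFilter _ _) hc.continuousAt
  have hderiv' : deriv (fun t => ∫ s in (0 : ℝ)..t, θ s) = θ := funext fun t => (hderiv t).deriv
  refine ⟨_, ⟨contDiff_infty_iff_deriv.2
    ⟨fun t => (hderiv t).differentiableAt, hderiv'.symm ▸ hθ.smooth⟩, ?_⟩, hderiv'⟩
  obtain ⟨a, b, ha, hb, hab⟩ := hθ.supp
  have hzero (x y : ℝ) (hxy : Disjoint (Set.uIcc x y) (Set.Icc a b)) : ∫ s in x..y, θ s = 0 :=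
    intervalIntegral.integral_zero_ae
      (.of_forall fun s hs => hab s (hxy.notMem_of_mem_left (Set.uIoc_subset_uIcc hs)))
  refine ⟨a, b, ha, hb, fun t ht => ?_⟩
  rcases lt_or_ge t a with hta | hta
  · refine hzero 0 t (Set.disjoint_left.2 fun s hs hs' => ?_)
    exact (hs.2.trans_lt (max_lt ha hta)).not_ge hs'.1
  · have hbt : b < t := not_le.1 fun h => ht ⟨hta, h⟩
    rw [← intervalIntegral.integral_add_adjacent_intervals (b := T)
      (hc.intervalIntegrable _ _) (hc.intervalIntegrable _ _), hmean, zero_add]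
    exact hzero T t (Set.disjoint_left.2 fun s hs hs' =>
      ((lt_min hb hbt).trans_le hs.1).not_ge hs'.2)

theorem exists_isTimeTest_integral_eq_one (hT : 0 < T) :
    ∃ ρ, IsTimeTest T ρ ∧ ∫ t in (0 : ℝ)..T, ρ t = 1 := by
  let η : ContDiffBump (T / 2 : ℝ) := ⟨T / 8, T / 4, by positivity, by linarith⟩
  have hs : tsupport (η.normed volume) ⊆ Set.Ioo 0 T := by
    rw [η.tsupport_normed_eq, Real.closedBall_eq_Icc]
    have hout : η.rOut = T / 4 := rfl
    exact fun t ht => ⟨by linarith [ht.1], by linarith [ht.2]⟩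
  refine ⟨η.normed volume, .of_tsupport hT η.contDiff_normed η.hasCompactSupport_normed hs, ?_⟩
  rw [intervalIntegral.integral_of_le hT.le,
    setIntegral_eq_integral_of_forall_compl_eq_zero, η.integral_normed]
  exact fun t ht => image_eq_zero_of_notMem_tsupport fun h => ht (Set.Ioo_subset_Ioc_self (hs h))

theorem exists_integral_mul_eq_of_integral_deriv_mul_eq_zero (hT : 0 < T)
    (hN : IntegrableOn N (Set.Ioo 0 T))
    (h : ∀ θ, IsTimeTest T θ → ∫ t in Set.Ioo 0 T, deriv θ t * N t = 0) :
    ∃ c, ∀ θ, IsTimeTest T θ → ∫ t in Set.Ioo 0 T, θ t * (N t - c) = 0 := by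
  obtain ⟨ρ, hρ, hρ1⟩ := exists_isTimeTest_integral_eq_one hT
  refine ⟨∫ t in Set.Ioo 0 T, ρ t * N t, fun θ hθ => ?_⟩
  set c := ∫ t in Set.Ioo 0 T, ρ t * N t
  set I := ∫ t in (0 : ℝ)..T, θ t
  have hmean : ∫ t in (0 : ℝ)..T, (θ t - I * ρ t) = 0 := by
    rw [intervalIntegral.integral_sub (hθ.smooth.continuous.intervalIntegrable _ _)
      ((hρ.smooth.continuous.const_mul I).intervalIntegrable _ _),
      intervalIntegral.integral_const_mul, hρ1, mul_one, sub_self]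
  obtain ⟨Θ, hΘ, hderiv⟩ := (hθ.sub_const_mul hρ I).exists_deriv_eq hmean
  have hθN := integrableOn_Ioo_continuous_mul hθ.smooth.continuous hN
  have hρN := integrableOn_Ioo_continuous_mul hρ.smooth.continuous hN
  have hθc : IntegrableOn (fun t => θ t * c) (Set.Ioo 0 T) :=
    integrableOn_Ioo_continuous_mul hθ.smooth.continuous (integrableOn_const (by simp))
  calc ∫ t in Set.Ioo 0 T, θ t * (N t - c)
      = (∫ t in Set.Ioo 0 T, θ t * N t) - I * c := by
        simp only [mul_sub]
        rw [integral_sub hθN hθc, integral_mul_const, integral_Ioo_eq_intervalIntegral hT.le θ]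
    _ = ∫ t in Set.Ioo 0 T, (θ t - I * ρ t) * N t := by
        rw [← integral_const_mul, ← integral_sub hθN (hρN.const_mul I)]
        simp only [sub_mul, mul_assoc]
    _ = 0 := by simpa only [hderiv] using h Θ hΘ

theorem ae_eq_const_of_integral_deriv_mul_eq_zero (hT : 0 < T) (hN : IntegrableOn N (Set.Ioo 0 T))
    (h : ∀ θ, IsTimeTest T θ → ∫ t in Set.Ioo 0 T, deriv θ t * N t = 0) :
    ∃ c, ∀ᵐ t ∂volume.restrict (Set.Ioo 0 T), N t = c := by
  obtain ⟨c, hc⟩ := exists_integral_mul_eq_of_integral_deriv_mul_eq_zero hT hN h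
  have hNc : IntegrableOn (fun t => N t - c) (Set.Ioo 0 T) :=
    hN.sub (integrableOn_const (by simp))
  have hzero := isOpen_Ioo.ae_eq_zero_of_integral_contDiff_smul_eq_zero hNc.locallyIntegrableOn
    fun θ hθ hcomp hs => by
      rw [← hc θ (.of_tsupport hT hθ hcomp hs)]
      refine (setIntegral_eq_integral_of_forall_compl_eq_zero fun t ht => ?_).symm
      rw [image_eq_zero_of_notMem_tsupport fun h => ht (hs h), zero_smul]
  refine ⟨c, (ae_restrict_iff' measurableSet_Ioo).2 ?_⟩
  filter_upwards [hzero] with t ht hmem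
  exact sub_eq_zero.1 (ht hmem)

theorem absolutelyContinuousOnInterval_primitive (hV : IntervalIntegrable V volume 0 T) (c : ℝ) :
    AbsolutelyContinuousOnInterval (fun t => c + ∫ s in (0 : ℝ)..t, V s) 0 T :=
  .add (LipschitzWith.const c).lipschitzOnWith.absolutelyContinuousOnInterval
    (hV.absolutelyContinuousOnInterval_intervalIntegral (by simp))

theorem deriv_primitive_ae (hV : IntervalIntegrable V volume 0 T) (c : ℝ) :
    ∀ᵐ t, t ∈ Set.uIcc 0 T → deriv (fun t => c + ∫ s in (0 : ℝ)..t, V s) t = V t := by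
  filter_upwards [hV.ae_hasDerivAt_integral] with t ht hmem
  exact ((ht hmem 0 (by simp)).const_add c).deriv

theorem hasWeakDeriv_primitive (hT : 0 < T) (hV : IntervalIntegrable V volume 0 T) (c : ℝ) :
    HasWeakDeriv T (fun t => c + ∫ s in (0 : ℝ)..t, V s) V := by
  rintro θ ⟨hθ, a, b, ha, hb, hab⟩
  have hθ0 : θ 0 = 0 := hab 0 fun h => h.1.not_gt ha
  have hθT : θ T = 0 := hab T fun h => h.2.not_gt hb
  have hparts := (hθ.of_le (by simp)).contDiffOn.absolutelyContinuousOnInterval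
    |>.integral_mul_deriv_eq_deriv_mul (absolutelyContinuousOnInterval_primitive hV c)
  have hcongr : ∫ t in (0 : ℝ)..T, θ t * deriv (fun t => c + ∫ s in (0 : ℝ)..t, V s) t
      = ∫ t in (0 : ℝ)..T, θ t * V t := by
    refine intervalIntegral.integral_congr_ae ?_
    filter_upwards [deriv_primitive_ae hV c] with t ht hmem
    rw [ht (Set.uIoc_subset_uIcc hmem)]
  rw [hθ0, hθT, hcongr] at hparts
  rw [integral_Ioo_eq_intervalIntegral hT.le, integral_Ioo_eq_intervalIntegral hT.le, hparts]
  ring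

theorem HasWeakDeriv.exists_primitive (hT : 0 < T) (hU : IntegrableOn U (Set.Ioo 0 T))
    (hV : IntervalIntegrable V volume 0 T) (h : HasWeakDeriv T U V) :
    ∃ c, ∀ᵐ t ∂volume.restrict (Set.Ioo 0 T), U t = c + ∫ s in (0 : ℝ)..t, V s := by
  have hprim : IntegrableOn (fun t => 0 + ∫ s in (0 : ℝ)..t, V s) (Set.Ioo 0 T) :=
    ((absolutelyContinuousOnInterval_primitive hV 0).continuousOn.integrableOn_uIcc).mono_set
      (Set.uIcc_of_le hT.le ▸ Set.Ioo_subset_Icc_self)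
  obtain ⟨c, hc⟩ := ae_eq_const_of_integral_deriv_mul_eq_zero hT (hU.sub hprim) fun θ hθ => by
    have hθ' : Continuous (deriv θ) := hθ.smooth.continuous_deriv (by simp)
    simp only [Pi.sub_apply, mul_sub]
    rw [integral_sub (integrableOn_Ioo_continuous_mul hθ' hU)
      (integrableOn_Ioo_continuous_mul hθ' hprim), h θ hθ, hasWeakDeriv_primitive hT hV 0 θ hθ,
      sub_self]
  refine ⟨c, ?_⟩
  filter_upwards [hc] with t ht
  rwa [Pi.sub_apply, zero_add, sub_eq_iff_eq_add] at ht

theorem HasWeakDeriv.mul_sub_mul (hT : 0 < T) {A A' B B' : ℝ → ℝ}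
    (hA : IntegrableOn A (Set.Ioo 0 T)) (hA' : IntegrableOn A' (Set.Ioo 0 T))
    (hB : IntegrableOn B (Set.Ioo 0 T)) (hB' : IntegrableOn B' (Set.Ioo 0 T))
    (h₁ : HasWeakDeriv T A A') (h₂ : HasWeakDeriv T B B') :
    ∃ G : Set ℝ, (∀ᵐ t ∂volume.restrict (Set.Ioo 0 T), t ∈ G) ∧ ∀ a ∈ G, ∀ b ∈ G, a ≤ b →
      A b * B b - A a * B a = ∫ t in Set.Ioc a b, (A' t * B t + A t * B' t) := by
  have iA := (intervalIntegrable_iff_integrableOn_Ioo_of_le hT.le).2 hA'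
  have iB := (intervalIntegrable_iff_integrableOn_Ioo_of_le hT.le).2 hB'
  obtain ⟨c, hc⟩ := h₁.exists_primitive hT hA iA
  obtain ⟨d, hd⟩ := h₂.exists_primitive hT hB iB
  refine ⟨{t | t ∈ Set.Ioo 0 T ∧ A t = c + ∫ s in (0 : ℝ)..t, A' s ∧
    B t = d + ∫ s in (0 : ℝ)..t, B' s}, ?_, ?_⟩
  · filter_upwards [hc, hd, ae_restrict_mem measurableSet_Ioo] with t htA htB ht
    exact ⟨ht, htA, htB⟩
  rintro a ⟨ha, hAa, hBa⟩ b ⟨hb, hAb, hBb⟩ hab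
  have hsub : Set.uIcc a b ⊆ Set.uIcc 0 T := by
    rw [Set.uIcc_of_le hab, Set.uIcc_of_le hT.le]
    exact Set.Icc_subset_Icc ha.1.le hb.2.le
  rw [hAa, hBa, hAb, hBb, ← ((absolutelyContinuousOnInterval_primitive iA c).mono hsub)
    |>.integral_deriv_mul_eq_sub ((absolutelyContinuousOnInterval_primitive iB d).mono hsub),
    intervalIntegral.integral_of_le hab]
  refine setIntegral_congr_ae measurableSet_Ioc ?_
  filter_upwards [(ae_restrict_iff' measurableSet_Ioo).1 hc,
    (ae_restrict_iff' measurableSet_Ioo).1 hd, deriv_primitive_ae iA c, deriv_primitive_ae iB d]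
    with t htA htB hA't hB't ht
  have hmem : t ∈ Set.Ioo 0 T := ⟨ha.1.trans ht.1, ht.2.trans_lt hb.2⟩
  have hmem' : t ∈ Set.uIcc 0 T := Set.uIcc_of_le hT.le ▸ Set.Ioo_subset_Icc_self hmem
  rw [hA't hmem', hB't hmem', htA hmem, htB hmem]

end Time

/-! ### A discretization of `(-Δ)^{1/2}` by second differences -/

section Multiplier

/-- The increasing function `s ↦ 6s / (1 + s)` of `s = |x|`. The excess of `2 φ(x/2)` over `φ(x)`
dominates `1 - cos x`, so that `∑ 2^j (1 - cos (x / 2^j))` is bounded by a telescoping sum. -/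
def telescopingBound (x : ℝ) : ℝ := 6 * |x| / (1 + |x|)

theorem one_sub_cos_le_telescopingBound (x : ℝ) :
    1 - Real.cos x ≤ 2 * telescopingBound (x / 2) - telescopingBound x := by
  have hx := abs_nonneg x
  have hexcess : 2 * telescopingBound (x / 2) - telescopingBound x
      = 6 * |x| ^ 2 / ((2 + |x|) * (1 + |x|)) := by
    simp only [telescopingBound, abs_div, abs_two]
    field
  rw [hexcess, le_div_iff₀ (by positivity)]
  rcases le_total |x| 2 with hx2 | hx2
  · have hcos : 1 - Real.cos x ≤ |x| ^ 2 / 2 := by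
      linarith [Real.one_sub_sq_div_two_le_cos (x := x), sq_abs x]
    calc (1 - Real.cos x) * ((2 + |x|) * (1 + |x|)) ≤ |x| ^ 2 / 2 * 12 := by
          gcongr
          nlinarith
      _ = 6 * |x| ^ 2 := by ring
  · calc (1 - Real.cos x) * ((2 + |x|) * (1 + |x|)) ≤ 2 * ((2 + |x|) * (1 + |x|)) := by
          gcongr
          linarith [Real.neg_one_le_cos x]
      _ ≤ 6 * |x| ^ 2 := by nlinarith

theorem sum_dyadic_le_telescopingBound (x : ℝ) (n : ℕ) :
    ∑ j ∈ Finset.range n, 2 ^ j * (1 - Real.cos (x * (1 / 2) ^ j)) ≤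
      2 ^ n * telescopingBound (x * (1 / 2) ^ n) - telescopingBound x := by
  induction n with
  | zero => simp
  | succ n ih =>
    have hstep := one_sub_cos_le_telescopingBound (x * (1 / 2) ^ n)
    rw [show x * (1 / 2) ^ n / 2 = x * (1 / 2) ^ (n + 1) by ring] at hstep
    have hscaled := mul_le_mul_of_nonneg_left hstep (by positivity : (0 : ℝ) ≤ 2 ^ n)
    rw [Finset.sum_range_succ, pow_succ (2 : ℝ) n]
    linarith

theorem sum_dyadic_le (x : ℝ) (n : ℕ) :
    ∑ j ∈ Finset.range n, 2 ^ j * (1 - Real.cos (x * (1 / 2) ^ j)) ≤ 6 * |x| := by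
  have hnonneg : 0 ≤ telescopingBound x := by unfold telescopingBound; positivity
  calc _ ≤ 2 ^ n * telescopingBound (x * (1 / 2) ^ n) :=
        (sum_dyadic_le_telescopingBound x n).trans (sub_le_self _ hnonneg)
    _ ≤ 2 ^ n * (6 * |x * (1 / 2) ^ n|) := by
        gcongr
        exact div_le_self (by positivity) (le_add_of_nonneg_right (abs_nonneg _))
    _ = 6 * |x| := by
        rw [abs_mul, abs_of_pos (by positivity : (0 : ℝ) < (1 / 2) ^ n), one_div, inv_pow]
        field

theorem abs_div_six_le_sum_dyadic (m : ℤ) {n : ℕ} (hn : m.natAbs < n) :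
    |(m : ℝ)| / 6 ≤ ∑ j ∈ Finset.range n, 2 ^ j * (1 - Real.cos ((m : ℝ) * (1 / 2) ^ j)) := by
  have hnonneg (j : ℕ) : 0 ≤ (2 : ℝ) ^ j * (1 - Real.cos ((m : ℝ) * (1 / 2) ^ j)) :=
    mul_nonneg (by positivity) (sub_nonneg.2 (Real.cos_le_one _))
  obtain rfl | hm := eq_or_ne m 0
  · simp
  have hm' : m.natAbs ≠ 0 := Int.natAbs_ne_zero.2 hm
  -- the single term with `1 ≤ |m| / 2^j ≤ 2` suffices
  set j := Nat.log 2 m.natAbs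
  have hj : j ∈ Finset.range n := Finset.mem_range.2 ((Nat.log_lt_self 2 hm').trans hn)
  refine le_trans ?_ (Finset.single_le_sum (fun j _ => hnonneg j) hj)
  have habs : |(m : ℝ)| = m.natAbs := by rw [Nat.cast_natAbs, Int.cast_abs]
  have hlow : (2 : ℝ) ^ j ≤ |(m : ℝ)| := by
    rw [habs]
    exact_mod_cast Nat.pow_log_le_self 2 hm'
  have hupp : |(m : ℝ)| ≤ 2 * 2 ^ j := by
    rw [habs, ← pow_succ']
    exact_mod_cast (Nat.lt_pow_succ_log_self one_lt_two m.natAbs).le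
  have hpos : (0 : ℝ) < 2 ^ j := by positivity
  have hangle : |(m : ℝ) * (1 / 2) ^ j| = |(m : ℝ)| / 2 ^ j := by
    rw [abs_mul, one_div, inv_pow, abs_of_pos (inv_pos.2 hpos), div_eq_mul_inv]
  have hcos : Real.cos ((m : ℝ) * (1 / 2) ^ j) ≤ 2 / 3 := by
    rw [← Real.cos_abs, hangle]
    have h1 : 1 ≤ |(m : ℝ)| / 2 ^ j := (one_le_div hpos).2 hlow
    have h2 : |(m : ℝ)| / 2 ^ j ≤ Real.pi :=
      ((div_le_iff₀ hpos).2 hupp).trans Real.two_le_pi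
    exact (Real.cos_le_cos_of_nonneg_of_le_pi zero_le_one h2 h1).trans
      (Real.cos_one_le.trans (by norm_num))
  nlinarith

/-- The translation by `2^{-j}` in direction `i`, for `p = (i, j)`. -/
def dyadicShift (p : Fin 3 × ℕ) : Torus := proj (Pi.single p.1 ((1 / 2) ^ p.2))

/-- The Fourier multiplier of the operator `w ↦ ∑ᵢ ∑_{j<n} 2^j secondDiff (2^{-j} eᵢ) w`, which is
comparable to `(-Δ)^{1/2}` on the frequencies with `|kᵢ| < n`. -/
def dyadicSymbol (n : ℕ) (k : Fin 3 → ℤ) : ℝ :=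
  ∑ p ∈ Finset.univ ×ˢ Finset.range n, 2 ^ p.2 * (1 - (expo k (dyadicShift p)).re)

theorem dyadicSymbol_eq (n : ℕ) (k : Fin 3 → ℤ) : dyadicSymbol n k =
    ∑ i, ∑ j ∈ Finset.range n, 2 ^ j * (1 - Real.cos ((k i : ℝ) * (1 / 2) ^ j)) := by
  rw [dyadicSymbol, Finset.sum_product]
  refine Finset.sum_congr rfl fun i _ => Finset.sum_congr rfl fun j _ => ?_
  have hsum : ∑ l, (k l : ℝ) * Pi.single (M := fun _ => ℝ) i ((1 / 2) ^ j) l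
      = k i * (1 / 2) ^ j := by
    simp [Pi.single_apply]
  rw [dyadicShift, expo_proj, hsum, mul_comm Complex.I, Complex.exp_ofReal_mul_I_re]

theorem dyadicSymbol_nonneg (n : ℕ) (k : Fin 3 → ℤ) : 0 ≤ dyadicSymbol n k :=
  Finset.sum_nonneg fun _ _ => mul_nonneg (by positivity) (one_sub_re_expo_mem_Icc k _).1

theorem dyadicSymbol_le (n : ℕ) (k : Fin 3 → ℤ) : dyadicSymbol n k ≤ 18 * √(eig k) := by
  rw [dyadicSymbol_eq]
  calc _ ≤ ∑ i, 6 * |(k i : ℝ)| := Finset.sum_le_sum fun i _ => sum_dyadic_le _ _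
    _ ≤ ∑ _i : Fin 3, 6 * √(eig k) := by
        gcongr with i
        exact Real.abs_le_sqrt (sq_le_eig k i)
    _ = 18 * √(eig k) := by
        rw [Fin.sum_const, nsmul_eq_mul]
        ring

theorem sqrt_eig_le_sum_abs (k : Fin 3 → ℤ) : √(eig k) ≤ ∑ i, |(k i : ℝ)| := by
  refine Real.sqrt_le_iff.2 ⟨Finset.sum_nonneg fun i _ => abs_nonneg _, ?_⟩
  simpa only [eig, sq_abs] using
    Finset.sum_sq_le_sq_sum_of_nonneg (s := Finset.univ) fun i _ => abs_nonneg (k i : ℝ)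

theorem sqrt_eig_div_six_le_dyadicSymbol {n : ℕ} {k : Fin 3 → ℤ} (hn : ∀ i, (k i).natAbs < n) :
    √(eig k) / 6 ≤ dyadicSymbol n k := by
  rw [dyadicSymbol_eq]
  calc √(eig k) / 6 ≤ (∑ i, |(k i : ℝ)|) / 6 := by
        gcongr
        exact sqrt_eig_le_sum_abs k
    _ = ∑ i, |(k i : ℝ)| / 6 := Finset.sum_div _ _ _
    _ ≤ _ := Finset.sum_le_sum fun i _ => abs_div_six_le_sum_dyadic (k i) (hn i)

end Multiplier

/-! ### Fourier modes of solutions -/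

section Modes

/-- The real mode `Re (c w_k)` of a function on the torus; the values `c = 1` and `c = -i` give the
real and imaginary parts of `w_k`. -/
def mode (c : ℂ) (k : Fin 3 → ℤ) (w : Torus → ℝ) : ℝ := (c * coeff w k).re

theorem abs_mode_le (c : ℂ) (k : Fin 3 → ℤ) (w : Torus → ℝ) : |mode c k w| ≤ ‖c‖ * ‖coeff w k‖ :=
  (Complex.abs_re_le_norm _).trans (norm_mul _ _).le

section TestFunctions

variable {T : ℝ} {θ : ℝ → ℝ}

theorem isTestFunction_mul_trig (hθ : IsTimeTest T θ) (c : ℂ) (k : Fin 3 → ℤ) :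
    IsTestFunction T fun t x => θ t * trig c k x where
  smooth := (hθ.smooth.comp contDiff_fst).mul ((smoothOnTorus_trig c k).comp contDiff_snd)
  supp := by
    obtain ⟨a, b, ha, hb, hab⟩ := hθ.supp
    exact ⟨a, b, ha, hb, fun t ht x => by rw [hab t ht, zero_mul]⟩

theorem timeDeriv_mul_trig (hθ : IsTimeTest T θ) (c : ℂ) (k : Fin 3 → ℤ) (t : ℝ) (x : Torus) :
    timeDeriv (fun t x => θ t * trig c k x) t x = deriv θ t * trig c k x :=
  deriv_mul_const (hθ.smooth.differentiable (by simp) t) _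

theorem integral_mul_const_mul_trig {w : Torus → ℝ} (hw : Integrable w) (a : ℝ) (c : ℂ)
    (k : Fin 3 → ℤ) : ∫ x, w x * (a * trig c (-k) x) = vol * (a * mode c k w) := by
  simp only [mul_left_comm _ a]
  rw [integral_const_mul, integral_mul_trig hw, neg_neg, mode]

theorem sum_integral_weakPartial_mul_const_mul_trig {w : L2} (hw : sobNorm 1 w < ⊤) (a : ℝ) (c : ℂ)
    (k : Fin 3 → ℤ) :
    ∑ i, ∫ x, weakPartial i w x * partialDeriv i (fun x => a * trig c (-k) x) x =
      vol * (eig k * (a * mode c k w)) := by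
  simp only [← trig_ofReal_mul, integral_weakPartial_mul_partialDeriv_trig hw, ← Finset.sum_mul]
  rw [trig_ofReal_mul, integral_mul_const_mul_trig (integrable_L2 w), ← eig_neg k, eig]
  ring

theorem integral_mul_fracLap_const_mul_trig {w : Torus → ℝ} (hw : Integrable w) (a : ℝ) (c : ℂ)
    (k : Fin 3 → ℤ) :
    ∫ x, w x * fracLap (1 / 2) (fun x => a * trig c (-k) x) x =
      vol * (√(eig k) * (a * mode c k w)) := by
  simp only [← trig_ofReal_mul, fracLap_trig, eig_neg, ← Real.sqrt_eq_rpow]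
  simp only [trig_ofReal_mul, ← mul_assoc _ a]
  exact integral_mul_const_mul_trig hw _ c k

end TestFunctions

section Energy

variable {w z : L2} {E : ℝ}

theorem sq_energyNorm (w z : L2) : energyNorm w z ^ 2 = sobNorm 1 w ^ 2 + ‖z‖ₑ ^ 2 := by
  rw [energyNorm, ← ENNReal.rpow_natCast, ← ENNReal.rpow_mul]
  simp

theorem sobNorm_le_energyNorm (w z : L2) : sobNorm 1 w ≤ energyNorm w z :=
  (ENNReal.pow_le_pow_left_iff two_ne_zero).1 ((sq_energyNorm w z).symm ▸ le_self_add)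

theorem vol_mul_sum_modes_le_sq_energy (hE : 0 ≤ E) (h : energyNorm w z ≤ ENNReal.ofReal E)
    (S : Finset (Fin 3 → ℤ)) :
    vol * ∑ k ∈ S, (1 + eig k) * ‖coeff w k‖ ^ 2 + vol * ∑ k ∈ S, ‖coeff z k‖ ^ 2 ≤ E ^ 2 := by
  have hw : ENNReal.ofReal (vol * ∑ k ∈ S, (1 + eig k) * ‖coeff w k‖ ^ 2) ≤ sobNorm 1 w ^ 2 := by
    simpa only [Real.rpow_one] using ofReal_sum_le_sobNorm_sq 1 w S
  have hz : ENNReal.ofReal (vol * ∑ k ∈ S, ‖coeff z k‖ ^ 2) ≤ ‖z‖ₑ ^ 2 := by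
    rw [← ofReal_norm, ← ENNReal.ofReal_pow (norm_nonneg _)]
    exact ENNReal.ofReal_le_ofReal (vol_mul_sum_norm_sq_coeff_le z S)
  have hvol := vol_pos.le
  rw [← ENNReal.ofReal_le_ofReal_iff (sq_nonneg E), ENNReal.ofReal_add
    (mul_nonneg hvol (Finset.sum_nonneg fun k _ =>
      mul_nonneg (by linarith [eig_nonneg k]) (sq_nonneg _))) (by positivity)]
  calc _ ≤ energyNorm w z ^ 2 := (add_le_add hw hz).trans_eq (sq_energyNorm w z).symm
    _ ≤ ENNReal.ofReal (E ^ 2) := by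
        rw [ENNReal.ofReal_pow hE]
        gcongr

theorem norm_coeff_le_of_energyNorm_le (hE : 0 ≤ E) (h : energyNorm w z ≤ ENNReal.ofReal E)
    (k : Fin 3 → ℤ) : ‖coeff w k‖ ≤ E / √vol ∧ ‖coeff z k‖ ≤ E / √vol := by
  have hsum := vol_mul_sum_modes_le_sq_energy hE h {k}
  rw [Finset.sum_singleton, Finset.sum_singleton] at hsum
  have hw : 0 ≤ vol * ‖coeff w k‖ ^ 2 := mul_nonneg vol_pos.le (sq_nonneg _)
  have hz : 0 ≤ vol * ‖coeff z k‖ ^ 2 := mul_nonneg vol_pos.le (sq_nonneg _)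
  have of_sq_le (a : ℝ) (ha : vol * a ^ 2 ≤ E ^ 2) : a ≤ E / √vol := by
    refine (le_div_iff₀ (Real.sqrt_pos.2 vol_pos)).2 (le_of_sq_le_sq ?_ hE)
    rwa [mul_pow, Real.sq_sqrt vol_pos.le, mul_comm]
  have heig := mul_nonneg hw (eig_nonneg k)
  exact ⟨of_sq_le _ (by linarith), of_sq_le _ (by linarith)⟩

variable {A : ℝ} {h : ℝ → ℝ}

theorem exists_eLpNorm_comp_le (hg : QuinticGrowth A h) (E : ℝ) :
    ∃ N : ℝ≥0, ∀ w : L2, sobNorm 1 w ≤ ENNReal.ofReal E →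
      eLpNorm (fun x => h (w x)) (6 / 5) volume ≤ N := by
  set N : ℝ≥0∞ := ENNReal.ofReal A *
    (eLpNorm (fun _ : Torus => (1 : ℝ)) (6 / 5) volume + (sobConst * ENNReal.ofReal E) ^ 5)
  have hN : N ≠ ⊤ := ENNReal.mul_ne_top ENNReal.ofReal_ne_top (ENNReal.add_ne_top.2
    ⟨(memLp_const 1).2.ne,
      ENNReal.pow_ne_top (ENNReal.mul_ne_top ENNReal.coe_ne_top ENNReal.ofReal_ne_top)⟩)
  refine ⟨N.toNNReal, fun w hw => (eLpNorm_comp_le hg w).trans ?_⟩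
  rw [ENNReal.coe_toNNReal hN]
  dsimp only [N]
  gcongr

theorem exists_norm_coeff_comp_le (hc : Continuous h) (hg : QuinticGrowth A h) (E : ℝ) :
    ∃ B : ℝ, ∀ w : L2, sobNorm 1 w ≤ ENNReal.ofReal E → ∀ k,
      ‖coeff (fun x => h (w x)) k‖ ≤ B := by
  obtain ⟨N, hN⟩ := exists_eLpNorm_comp_le hg E
  set R : ℝ≥0∞ := ‖(vol : ℂ)⁻¹‖ₑ * (N * eLpNorm (fun _ : Torus => (1 : ℝ)) 6 volume)
  have hR : R ≠ ⊤ := ENNReal.mul_ne_top enorm_ne_top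
    (ENNReal.mul_ne_top ENNReal.coe_ne_top (memLp_const 1).2.ne)
  refine ⟨R.toReal, fun w hw k => ?_⟩
  have hm := memLp_comp hc hg (hw.trans_lt ENNReal.ofReal_lt_top)
  have hexpo : eLpNorm (expo (-k)) 6 volume = eLpNorm (fun _ : Torus => (1 : ℝ)) 6 volume :=
    eLpNorm_congr_norm_ae (.of_forall fun x => by simp [norm_expo])
  rw [← toReal_enorm]
  refine ENNReal.toReal_mono hR ?_
  rw [coeff_def, enorm_mul]
  refine mul_le_mul_right ?_ _
  calc _ ≤ eLpNorm (fun x => h (w x)) (6 / 5) volume * eLpNorm (expo (-k)) 6 volume :=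
        enorm_integral_ofReal_mul_le hm.1 (continuous_expo _).aestronglyMeasurable
    _ ≤ _ := by
        rw [hexpo]
        gcongr
        exact hN w hw

end Energy

end Modes

/-! ### The equation for the Fourier modes -/

section ModalEquation

variable {T : ℝ}

theorem integrableOn_of_memLp_top {U : ℝ → ℝ} {s : Set ℝ}
    (hU : MemLp U ⊤ (volume.restrict (Set.Ioo 0 T))) (hs : s ⊆ Set.Ioo 0 T) : IntegrableOn U s :=
  IntegrableOn.mono_set (hU.integrable le_top) hs

theorem Ioc_subset_Ioo_of_mem {a b τ σ : ℝ} (ha : a ∈ Set.Ioo τ σ) (hb : b ∈ Set.Ioo τ σ) :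
    Set.Ioc a b ⊆ Set.Ioo τ σ :=
  fun _ ht => ⟨ha.1.trans ht.1, ht.2.trans_lt hb.2⟩

theorem exists_oscillator_identity {U V F : ℝ → ℝ} {μ β c : ℝ} (hT : 0 < T)
    (hU : MemLp U ⊤ (volume.restrict (Set.Ioo 0 T)))
    (hV : MemLp V ⊤ (volume.restrict (Set.Ioo 0 T)))
    (hF : MemLp F ⊤ (volume.restrict (Set.Ioo 0 T))) (hUV : HasWeakDeriv T U V)
    (hVW : HasWeakDeriv T V fun t => c - μ * U t - β * V t - F t) :
    ∃ G : Set ℝ, (∀ᵐ t ∂volume.restrict (Set.Ioo 0 T), t ∈ G) ∧ ∀ a ∈ G, ∀ b ∈ G, a ≤ b →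
      ∫ t in Set.Ioc a b, (V t * V t + c * U t - μ * (U t * U t) - F t * U t) =
        V b * U b - V a * U a + β / 2 * (U b * U b - U a * U a) := by
  have hW : MemLp (fun t => c - μ * U t - β * V t - F t) ⊤ (volume.restrict (Set.Ioo 0 T)) :=
    (((memLp_const c).sub (hU.const_mul μ)).sub (hV.const_mul β)).sub hF
  obtain ⟨G₁, hG₁, h₁⟩ := hVW.mul_sub_mul hT (hV.integrable le_top) (hW.integrable le_top)
    (hU.integrable le_top) (hV.integrable le_top) hUV
  obtain ⟨G₂, hG₂, h₂⟩ := hUV.mul_sub_mul hT (hU.integrable le_top) (hV.integrable le_top)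
    (hU.integrable le_top) (hV.integrable le_top) hUV
  refine ⟨G₁ ∩ G₂ ∩ Set.Ioo 0 T, ?_, ?_⟩
  · filter_upwards [hG₁, hG₂, ae_restrict_mem measurableSet_Ioo] with t ht₁ ht₂ ht
    exact ⟨⟨ht₁, ht₂⟩, ht⟩
  rintro a ⟨⟨ha₁, ha₂⟩, ha⟩ b ⟨⟨hb₁, hb₂⟩, hb⟩ hab
  have hsub := Ioc_subset_Ioo_of_mem ha hb
  have hint₁ : IntegrableOn (fun t => (c - μ * U t - β * V t - F t) * U t + V t * V t)
      (Set.Ioc a b) :=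
    integrableOn_of_memLp_top ((hU.mul (r := ⊤) hW).add (hV.mul (r := ⊤) hV)) hsub
  have hint₂ : IntegrableOn (fun t => V t * U t + U t * V t) (Set.Ioc a b) :=
    integrableOn_of_memLp_top ((hU.mul (r := ⊤) hV).add (hV.mul (r := ⊤) hU)) hsub
  rw [h₁ a ha₁ b hb₁ hab, h₂ a ha₂ b hb₂ hab, ← integral_const_mul,
    ← integral_add hint₁ (hint₂.const_mul _)]
  congr 1 with t
  ring

namespace IsWeakEnergySolution

variable {γ α : ℝ} {f : ℝ → ℝ} {g u₀ u₁ : L2} {u v : ℝ → L2}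

theorem ae_energyNorm_le (sol : IsWeakEnergySolution γ α f g T u₀ u₁ u v) :
    ∀ᵐ t ∂volume.restrict (Set.Ioo 0 T), energyNorm (u t) (v t) ≤
      ENNReal.ofReal (normLinftyEnergy 0 T u v).toReal := by
  rw [ENNReal.ofReal_toReal sol.energy.ne]
  exact ENNReal.ae_le_essSup _

theorem ae_sobNorm_le (sol : IsWeakEnergySolution γ α f g T u₀ u₁ u v) :
    ∀ᵐ t ∂volume.restrict (Set.Ioo 0 T), sobNorm 1 (u t) ≤
      ENNReal.ofReal (normLinftyEnergy 0 T u v).toReal :=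
  sol.ae_energyNorm_le.mono fun _ ht => (sobNorm_le_energyNorm _ _).trans ht

theorem ae_sobNorm_lt_top (sol : IsWeakEnergySolution γ α f g T u₀ u₁ u v) :
    ∀ᵐ t ∂volume.restrict (Set.Ioo 0 T), sobNorm 1 (u t) < ⊤ :=
  sol.ae_sobNorm_le.mono fun _ ht => ht.trans_lt ENNReal.ofReal_lt_top

theorem memLp_mode_u (sol : IsWeakEnergySolution γ α f g T u₀ u₁ u v) (c : ℂ) (k : Fin 3 → ℤ) :
    MemLp (fun t => mode c k (u t)) ⊤ (volume.restrict (Set.Ioo 0 T)) := by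
  refine memLp_top_of_bound ((Complex.continuous_re.comp (continuous_const.mul
    (continuous_coeff k))).comp_aestronglyMeasurable sol.measurable_u)
    (‖c‖ * ((normLinftyEnergy 0 T u v).toReal / √vol)) ?_
  filter_upwards [sol.ae_energyNorm_le] with t ht
  refine (abs_mode_le c k _).trans ?_
  gcongr
  exact (norm_coeff_le_of_energyNorm_le ENNReal.toReal_nonneg ht k).1

theorem memLp_mode_v (sol : IsWeakEnergySolution γ α f g T u₀ u₁ u v) (c : ℂ) (k : Fin 3 → ℤ) :
    MemLp (fun t => mode c k (v t)) ⊤ (volume.restrict (Set.Ioo 0 T)) := by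
  refine memLp_top_of_bound ((Complex.continuous_re.comp (continuous_const.mul
    (continuous_coeff k))).comp_aestronglyMeasurable sol.measurable_v)
    (‖c‖ * ((normLinftyEnergy 0 T u v).toReal / √vol)) ?_
  filter_upwards [sol.ae_energyNorm_le] with t ht
  refine (abs_mode_le c k _).trans ?_
  gcongr
  exact (norm_coeff_le_of_energyNorm_le ENNReal.toReal_nonneg ht k).2

theorem memLp_mode_comp (sol : IsWeakEnergySolution γ α f g T u₀ u₁ u v) {A : ℝ} {h : ℝ → ℝ}
    (hc : Continuous h) (hg : QuinticGrowth A h) (c : ℂ) (k : Fin 3 → ℤ) :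
    MemLp (fun t => mode c k fun x => h (u t x)) ⊤ (volume.restrict (Set.Ioo 0 T)) := by
  obtain ⟨B, hB⟩ := exists_norm_coeff_comp_le hc hg (normLinftyEnergy 0 T u v).toReal
  have hmeas := aestronglyMeasurable_coeff_comp hc sol.measurable_u
    (sol.ae_sobNorm_lt_top.mono fun _ ht => integrable_comp hc hg ht) k
  refine memLp_top_of_bound ((Complex.continuous_re.comp
    (continuous_const_mul c)).comp_aestronglyMeasurable hmeas) (‖c‖ * B) ?_
  filter_upwards [sol.ae_sobNorm_le] with t ht
  refine (abs_mode_le c k _).trans ?_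
  gcongr
  exact hB _ ht k

theorem hasWeakDeriv_mode_u (sol : IsWeakEnergySolution γ α f g T u₀ u₁ u v) (c : ℂ)
    (k : Fin 3 → ℤ) : HasWeakDeriv T (fun t => mode c k (u t)) fun t => mode c k (v t) := by
  intro θ hθ
  have htest := sol.time_deriv _ (isTestFunction_mul_trig hθ c (-k))
  simp only [timeDeriv_mul_trig hθ, integral_mul_const_mul_trig (integrable_L2 _)] at htest
  rw [integral_const_mul, integral_const_mul, ← mul_neg] at htest
  exact mul_left_cancel₀ vol_pos.ne' htest

theorem hasWeakDeriv_mode_v (sol : IsWeakEnergySolution γ α f g T u₀ u₁ u v) {A : ℝ}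
    (hf : Continuous f) (hA : QuinticGrowth A f) (c : ℂ) (k : Fin 3 → ℤ) :
    HasWeakDeriv T (fun t => mode c k (v t)) fun t => mode c k g - eig k * mode c k (u t)
      - (α + γ * √(eig k)) * mode c k (v t) - mode c k fun x => f (u t x) := by
  intro θ hθ
  have htest := sol.equation _ (isTestFunction_mul_trig hθ c (-k))
  have hgradient : ∫ t in Set.Ioo 0 T, ∑ i, ∫ x, weakPartial i (u t) x *
      partialDeriv i (fun x => θ t * trig c (-k) x) x
      = vol * (eig k * ∫ t in Set.Ioo 0 T, θ t * mode c k (u t)) := by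
    rw [← integral_const_mul, ← integral_const_mul]
    exact integral_congr_ae (sol.ae_sobNorm_lt_top.mono fun t ht =>
      sum_integral_weakPartial_mul_const_mul_trig ht (θ t) c k)
  have hnonlinear : ∫ t in Set.Ioo 0 T, ∫ x, f (u t x) * (θ t * trig c (-k) x)
      = vol * ∫ t in Set.Ioo 0 T, θ t * mode c k fun x => f (u t x) := by
    rw [← integral_const_mul]
    exact integral_congr_ae (sol.ae_sobNorm_lt_top.mono fun t ht =>
      integral_mul_const_mul_trig (integrable_comp hf hA ht) (θ t) c k)
  rw [hgradient, hnonlinear] at htest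
  simp only [timeDeriv_mul_trig hθ, integral_mul_const_mul_trig (integrable_L2 _),
    integral_mul_fracLap_const_mul_trig (integrable_L2 _), integral_const_mul] at htest
  have hint {N : ℝ → ℝ} (hN : MemLp N ⊤ (volume.restrict (Set.Ioo 0 T))) :=
    integrableOn_Ioo_continuous_mul hθ.smooth.continuous (hN.integrable le_top)
  have hint_g := hint (memLp_const (mode c k g))
  have hint_u := (hint (sol.memLp_mode_u c k)).const_mul (eig k)
  have hint_v := (hint (sol.memLp_mode_v c k)).const_mul (α + γ * √(eig k))
  simp only [mul_sub, mul_left_comm (θ _)]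
  rw [integral_sub ?_ (hint (sol.memLp_mode_comp hf hA c k)), integral_sub ?_ hint_v,
    integral_sub hint_g hint_u, integral_const_mul, integral_const_mul]
  rotate_left
  · exact hint_g.sub hint_u
  · exact (hint_g.sub hint_u).sub hint_v
  refine mul_left_cancel₀ vol_pos.ne' ?_
  linear_combination -htest

end IsWeakEnergySolution

end ModalEquation

/-! ### Truncated Fourier multipliers -/

section Multipliers

/-- The pairing `(m(D)w, z)` in `L²(𝕋³)` of the Fourier multiplier `m` restricted to the finitely
many modes `k ∈ S`. -/
def multPairing (m : (Fin 3 → ℤ) → ℝ) (S : Finset (Fin 3 → ℤ)) (w z : Torus → ℝ) : ℝ :=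
  vol * ∑ k ∈ S, m k * (coeff w k * conj (coeff z k)).re

variable {m : (Fin 3 → ℤ) → ℝ}

theorem re_coeff_mul_conj_coeff (w z : Torus → ℝ) (k : Fin 3 → ℤ) :
    (coeff w k * conj (coeff z k)).re =
      mode 1 k w * mode 1 k z + mode (-Complex.I) k w * mode (-Complex.I) k z := by
  simp [mode]

theorem multPairing_self (m : (Fin 3 → ℤ) → ℝ) (S : Finset (Fin 3 → ℤ)) (w : Torus → ℝ) :
    multPairing m S w w = vol * ∑ k ∈ S, m k * ‖coeff w k‖ ^ 2 := by
  simp only [multPairing, Complex.mul_conj, Complex.ofReal_re, Complex.normSq_eq_norm_sq]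

theorem multPairing_self_nonneg (hm : ∀ k, 0 ≤ m k) (S : Finset (Fin 3 → ℤ)) (w : Torus → ℝ) :
    0 ≤ multPairing m S w w := by
  rw [multPairing_self]
  exact mul_nonneg vol_pos.le (Finset.sum_nonneg fun k _ => mul_nonneg (hm k) (sq_nonneg _))

theorem multPairing_self_mono (hm : ∀ k, 0 ≤ m k) {S S' : Finset (Fin 3 → ℤ)} (hS : S ⊆ S')
    (w : Torus → ℝ) : multPairing m S w w ≤ multPairing m S' w w := by
  rw [multPairing_self, multPairing_self]
  exact mul_le_mul_of_nonneg_left (Finset.sum_le_sum_of_subset_of_nonneg hS fun k _ _ =>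
    mul_nonneg (hm k) (sq_nonneg _)) vol_pos.le

theorem memLp_multPairing {μ : Measure ℝ} {w z : ℝ → Torus → ℝ}
    (hw : ∀ c k, MemLp (fun t => mode c k (w t)) ⊤ μ)
    (hz : ∀ c k, MemLp (fun t => mode c k (z t)) ⊤ μ) (m : (Fin 3 → ℤ) → ℝ)
    (S : Finset (Fin 3 → ℤ)) : MemLp (fun t => multPairing m S (w t) (z t)) ⊤ μ := by
  simp only [multPairing, re_coeff_mul_conj_coeff]
  exact (memLp_finsetSum S fun k _ => (((hz 1 k).mul (r := ⊤) (hw 1 k)).add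
    ((hz (-Complex.I) k).mul (r := ⊤) (hw (-Complex.I) k))).const_mul (m k)).const_mul vol

section Bounds

variable {c : ℝ}

theorem abs_multPairing_le (hm : ∀ k, |m k| ≤ 2 * c * √(eig k)) (hc : 0 ≤ c)
    (S : Finset (Fin 3 → ℤ)) (z w : Torus → ℝ) : |multPairing m S z w| ≤
      c * (vol * ∑ k ∈ S, (1 + eig k) * ‖coeff w k‖ ^ 2 + vol * ∑ k ∈ S, ‖coeff z k‖ ^ 2) := by
  have hterm (k : Fin 3 → ℤ) : |m k * (coeff z k * conj (coeff w k)).re| ≤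
      c * ((1 + eig k) * ‖coeff w k‖ ^ 2 + ‖coeff z k‖ ^ 2) := by
    set x := ‖coeff w k‖
    set y := ‖coeff z k‖
    calc _ ≤ 2 * c * √(eig k) * (y * x) := by
          rw [abs_mul]
          gcongr
          · exact hm k
          · simpa [x, y] using Complex.abs_re_le_norm (coeff z k * conj (coeff w k))
      _ = c * (2 * (√(eig k) * x) * y) := by ring
      _ ≤ c * ((√(eig k) * x) ^ 2 + y ^ 2) := by
          gcongr
          exact two_mul_le_add_sq _ _
      _ ≤ c * ((1 + eig k) * x ^ 2 + y ^ 2) := by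
          rw [mul_pow, Real.sq_sqrt (eig_nonneg k)]
          gcongr
          linarith
  rw [multPairing, abs_mul, abs_of_pos vol_pos, ← mul_add, ← Finset.sum_add_distrib,
    mul_left_comm, Finset.mul_sum]
  exact mul_le_mul_of_nonneg_left ((Finset.abs_sum_le_sum_abs _ _).trans
    (Finset.sum_le_sum fun k _ => hterm k)) vol_pos.le

variable {w z : L2} {E : ℝ}

theorem vol_mul_sum_le_sq_energy (hE : 0 ≤ E) (h : energyNorm w z ≤ ENNReal.ofReal E)
    (S : Finset (Fin 3 → ℤ)) : vol * ∑ k ∈ S, (1 + eig k) * ‖coeff w k‖ ^ 2 ≤ E ^ 2 :=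
  (le_add_of_nonneg_right (mul_nonneg vol_pos.le (Finset.sum_nonneg fun _ _ => sq_nonneg _))).trans
    (vol_mul_sum_modes_le_sq_energy hE h S)

theorem abs_multPairing_self_le (hm : ∀ k, |m k| ≤ c * (1 + eig k)) (hc : 0 ≤ c) (hE : 0 ≤ E)
    (h : energyNorm w z ≤ ENNReal.ofReal E) (S : Finset (Fin 3 → ℤ)) :
    |multPairing m S w w| ≤ c * E ^ 2 := by
  calc |multPairing m S w w|
      ≤ vol * ∑ k ∈ S, c * ((1 + eig k) * ‖coeff w k‖ ^ 2) := by
        rw [multPairing_self, abs_mul, abs_of_pos vol_pos]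
        refine mul_le_mul_of_nonneg_left ((Finset.abs_sum_le_sum_abs _ _).trans
          (Finset.sum_le_sum fun k _ => ?_)) vol_pos.le
        rw [abs_mul, abs_of_nonneg (sq_nonneg ‖coeff w k‖), ← mul_assoc]
        exact mul_le_mul_of_nonneg_right (hm k) (sq_nonneg _)
    _ = c * (vol * ∑ k ∈ S, (1 + eig k) * ‖coeff w k‖ ^ 2) := by
        rw [← Finset.mul_sum]
        ring
    _ ≤ c * E ^ 2 := mul_le_mul_of_nonneg_left (vol_mul_sum_le_sq_energy hE h S) hc

theorem abs_multPairing_le_sq_energy (hm : ∀ k, |m k| ≤ 2 * c * √(eig k)) (hc : 0 ≤ c)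
    (hE : 0 ≤ E) (h : energyNorm w z ≤ ENNReal.ofReal E) (S : Finset (Fin 3 → ℤ)) :
    |multPairing m S z w| ≤ c * E ^ 2 :=
  (abs_multPairing_le hm hc S z w).trans
    (mul_le_mul_of_nonneg_left (vol_mul_sum_modes_le_sq_energy hE h S) hc)

theorem abs_multPairing_le_sq_energy_add (hm : ∀ k, |m k| ≤ 2 * c * √(eig k)) (hc : 0 ≤ c)
    (hE : 0 ≤ E) (h : energyNorm w z ≤ ENNReal.ofReal E) (S : Finset (Fin 3 → ℤ)) (g : L2) :
    |multPairing m S g w| ≤ c * (E ^ 2 + ‖g‖ ^ 2) :=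
  (abs_multPairing_le hm hc S g w).trans (mul_le_mul_of_nonneg_left
    (add_le_add (vol_mul_sum_le_sq_energy hE h S) (vol_mul_sum_norm_sq_coeff_le g S)) hc)

theorem ofReal_multPairing_self_le_sobNorm_sq (hm : ∀ k, m k ≤ c * √(eig k)) (hc : 0 ≤ c)
    (S : Finset (Fin 3 → ℤ)) (z : L2) :
    ENNReal.ofReal (multPairing m S z z) ≤ ENNReal.ofReal c * sobNorm (1 / 2) z ^ 2 := by
  refine le_trans ?_ (mul_le_mul_right (ofReal_sum_le_sobNorm_sq (1 / 2) z S) _)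
  rw [← ENNReal.ofReal_mul hc, multPairing_self, mul_left_comm, Finset.mul_sum S _ c]
  refine ENNReal.ofReal_le_ofReal (mul_le_mul_of_nonneg_left (Finset.sum_le_sum fun k _ => ?_)
    vol_pos.le)
  rw [← mul_assoc, ← Real.sqrt_eq_rpow]
  refine mul_le_mul_of_nonneg_right ((hm k).trans ?_) (sq_nonneg _)
  gcongr
  linarith

end Bounds

section Nonlinear

variable {h : Torus → ℝ}

theorem multPairing_add_const_mul_self (hh : Integrable h) (K : ℝ) (w : L2)
    (m : (Fin 3 → ℤ) → ℝ) (S : Finset (Fin 3 → ℤ)) :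
    multPairing m S (fun x => h x + K * w x) w = multPairing m S h w + K * multPairing m S w w := by
  simp only [multPairing, coeff_add hh ((integrable_L2 w).const_mul K), coeff_const_mul, add_mul,
    Complex.add_re, mul_assoc, Complex.re_ofReal_mul, mul_add, Finset.sum_add_distrib,
    mul_left_comm _ K, Finset.mul_sum]

theorem multPairing_dyadicSymbol (n : ℕ) (S : Finset (Fin 3 → ℤ)) (h : Torus → ℝ) (w : L2) :
    multPairing (dyadicSymbol n) S h w = ∑ p ∈ Finset.univ ×ˢ Finset.range n, 2 ^ p.2 *
      (vol * (∑ k ∈ S, coeff h k * conj (coeff (secondDiff (dyadicShift p) w) k)).re) := by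
  simp only [multPairing, dyadicSymbol, coeff_secondDiff, Complex.re_sum, Finset.sum_mul,
    Finset.mul_sum]
  rw [Finset.sum_comm]
  refine Finset.sum_congr rfl fun p _ => Finset.sum_congr rfl fun k _ => ?_
  rw [map_mul, Complex.conj_ofReal, mul_left_comm (coeff h k), Complex.re_ofReal_mul]
  ring

theorem tendsto_multPairing_dyadicSymbol (hh : MemLp h (6 / 5) volume) {w : L2}
    (hw : sobNorm 1 w < ⊤) (n : ℕ) :
    Tendsto (fun S => multPairing (dyadicSymbol n) S h w) atTop
      (𝓝 (∑ p ∈ Finset.univ ×ˢ Finset.range n,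
        2 ^ p.2 * ∫ x, h x * secondDiff (dyadicShift p) w x)) := by
  simp only [multPairing_dyadicSymbol]
  refine tendsto_finsetSum _ fun p _ => Tendsto.const_mul _ ?_
  have hsum := hasSum_coeff_mul_conj_of_memLp hh ((sobNorm_secondDiff_le (dyadicShift p) w).trans_lt
    (ENNReal.mul_lt_top ENNReal.ofNat_lt_top hw))
  have hlim := ((Complex.continuous_re.tendsto _).comp hsum).const_mul vol
  rwa [Complex.ofReal_re, mul_inv_cancel_left₀ vol_pos.ne'] at hlim

theorem exists_abs_multPairing_dyadicSymbol_comp_le {A : ℝ} {h : ℝ → ℝ} (hc : Continuous h)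
    (hg : QuinticGrowth A h) (E : ℝ) (n : ℕ) : ∃ B : ℝ, ∀ w : L2, sobNorm 1 w ≤ ENNReal.ofReal E →
      ∀ S, |multPairing (dyadicSymbol n) S (fun x => h (w x)) w| ≤ B := by
  obtain ⟨N, hN⟩ := exists_eLpNorm_comp_le hg E
  set R : ℝ≥0∞ := ‖(vol : ℂ)⁻¹‖ₑ * (N * (sobConst * (2 * ENNReal.ofReal E)))
  have hR : R ≠ ⊤ := by finiteness
  refine ⟨∑ p ∈ (Finset.univ : Finset (Fin 3)) ×ˢ Finset.range n, 2 ^ p.2 * (vol * R.toReal),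
    fun w hw S => ?_⟩
  rw [multPairing_dyadicSymbol]
  refine (Finset.abs_sum_le_sum_abs _ _).trans (Finset.sum_le_sum fun p _ => ?_)
  rw [abs_mul, abs_mul, abs_of_pos vol_pos, abs_of_pos (by positivity : (0 : ℝ) < 2 ^ p.2)]
  have hvol := vol_pos.le
  gcongr
  refine (Complex.abs_re_le_norm _).trans ?_
  rw [← toReal_enorm]
  refine ENNReal.toReal_mono hR ((enorm_sum_coeff_mul_conj_le (memLp_comp hc hg
    (hw.trans_lt ENNReal.ofReal_lt_top)) _ S).trans ?_)
  dsimp only [R]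
  gcongr
  · exact hN w hw
  · exact (sobNorm_secondDiff_le _ w).trans (by gcongr)

end Nonlinear

end Multipliers

/-! ### The multiplier estimate -/

section MultiplierEstimate

variable {γ α K T : ℝ}

/-- The functional `(m(D)∂ₜu, u) + ½ (m(D)(α + γ(-Δ)^{1/2})u, u)`, truncated to the modes `k ∈ S`,
at `(u, ∂ₜu) = (w, z)`; its time derivative collects the terms of the equation tested with `m(D)u`
that contain a time derivative, up to `(m(D)∂ₜu, ∂ₜu)`. -/
def multFunctional (γ α : ℝ) (m : (Fin 3 → ℤ) → ℝ) (S : Finset (Fin 3 → ℤ))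
    (w z : Torus → ℝ) : ℝ :=
  multPairing m S z w + multPairing (fun k => m k * ((α + γ * √(eig k)) / 2)) S w w

theorem abs_dyadicSymbol_le (n : ℕ) (k : Fin 3 → ℤ) :
    |dyadicSymbol n k| ≤ 2 * 9 * √(eig k) := by
  rw [abs_of_nonneg (dyadicSymbol_nonneg n k)]
  exact (dyadicSymbol_le n k).trans_eq (by norm_num)

theorem sqrt_le_one_add {e : ℝ} (he : 0 ≤ e) : √e ≤ 1 + e :=
  Real.sqrt_le_iff.2 ⟨by positivity, by nlinarith⟩

theorem abs_dyadicSymbol_le_one_add (n : ℕ) (k : Fin 3 → ℤ) :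
    |dyadicSymbol n k| ≤ 18 * (1 + eig k) := by
  have := sqrt_le_one_add (eig_nonneg k)
  exact (abs_dyadicSymbol_le n k).trans (by linarith)

theorem abs_dyadicSymbol_mul_damping_le (γ α : ℝ) (n : ℕ) (k : Fin 3 → ℤ) :
    |dyadicSymbol n k * ((α + γ * √(eig k)) / 2)| ≤ 9 * (|α| + |γ|) * (1 + eig k) := by
  have hs := Real.sqrt_nonneg (eig k)
  have he := eig_nonneg k
  calc _ = |dyadicSymbol n k| * (|α + γ * √(eig k)| / 2) := by
        rw [abs_mul, abs_div, abs_two]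
    _ ≤ 2 * 9 * √(eig k) * ((|α| + |γ| * √(eig k)) / 2) := by
        gcongr
        · exact abs_dyadicSymbol_le n k
        · refine (abs_add_le _ _).trans_eq ?_
          rw [abs_mul, abs_of_nonneg hs]
    _ = 9 * (|α| * √(eig k) + |γ| * √(eig k) ^ 2) := by ring
    _ ≤ 9 * (|α| * (1 + eig k) + |γ| * (1 + eig k)) := by
        rw [Real.sq_sqrt he]
        gcongr
        · exact sqrt_le_one_add he
        · linarith
    _ = _ := by ring

theorem abs_multFunctional_dyadicSymbol_le {w z : L2} {E : ℝ} (hE : 0 ≤ E)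
    (h : energyNorm w z ≤ ENNReal.ofReal E) (γ α : ℝ) (n : ℕ) (S : Finset (Fin 3 → ℤ)) :
    |multFunctional γ α (dyadicSymbol n) S w z| ≤ 9 * (1 + |α| + |γ|) * E ^ 2 :=
  calc _ ≤ 9 * E ^ 2 + 9 * (|α| + |γ|) * E ^ 2 := (abs_add_le _ _).trans (add_le_add
        (abs_multPairing_le_sq_energy (abs_dyadicSymbol_le n) (by norm_num) hE h S)
        (abs_multPairing_self_le (abs_dyadicSymbol_mul_damping_le γ α n) (by positivity) hE h S))
    _ = _ := by ring

theorem QuinticGrowth.add_const_mul {A : ℝ} {f : ℝ → ℝ} (hf : QuinticGrowth A f) (K : ℝ) :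
    QuinticGrowth (A + |K|) fun s => f s + K * s := by
  intro s
  have hs : |s| ≤ 1 + |s| ^ 5 := by
    rcases le_total |s| 1 with h | h
    · exact le_add_of_le_of_nonneg h (by positivity)
    · exact le_add_of_nonneg_of_le zero_le_one (le_self_pow₀ h (by norm_num))
  calc |f s + K * s| ≤ |f s| + |K| * |s| := (abs_add_le _ _).trans_eq (by rw [abs_mul])
    _ ≤ A * (1 + |s| ^ 5) + |K| * (1 + |s| ^ 5) := by
        gcongr
        exact hf s
    _ = (A + |K|) * (1 + |s| ^ 5) := by ring

theorem setIntegral_Ioc_le_mul {F : ℝ → ℝ} {a b c ℓ : ℝ} (hab : a ≤ b) (hℓ : b - a ≤ ℓ)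
    (hc : 0 ≤ c) (h : ∀ᵐ t ∂volume.restrict (Set.Ioc a b), |F t| ≤ c) :
    ∫ t in Set.Ioc a b, F t ≤ c * ℓ := by
  have hnorm := norm_setIntegral_le_of_norm_le_const_ae (f := F) (C := c) measure_Ioc_lt_top h
  rw [Real.volume_real_Ioc_of_le hab] at hnorm
  exact (Real.le_norm_self _).trans (hnorm.trans (by gcongr))

theorem sq_normL2Sob (s a b : ℝ) (w : ℝ → L2) :
    normL2Sob s a b w ^ 2 = ∫⁻ t in Set.Ioo a b, sobNorm s (w t) ^ 2 := by
  rw [normL2Sob, ← ENNReal.rpow_natCast, ← ENNReal.rpow_mul]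
  simp

namespace IsWeakEnergySolution

variable {A : ℝ} {f : ℝ → ℝ} {g u₀ u₁ : L2} {u v : ℝ → L2}

theorem memLp_multPairing_uu (sol : IsWeakEnergySolution γ α f g T u₀ u₁ u v)
    (m : (Fin 3 → ℤ) → ℝ) (S : Finset (Fin 3 → ℤ)) :
    MemLp (fun t => multPairing m S (u t) (u t)) ⊤ (volume.restrict (Set.Ioo 0 T)) :=
  memLp_multPairing sol.memLp_mode_u sol.memLp_mode_u m S

theorem memLp_multPairing_vv (sol : IsWeakEnergySolution γ α f g T u₀ u₁ u v)
    (m : (Fin 3 → ℤ) → ℝ) (S : Finset (Fin 3 → ℤ)) :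
    MemLp (fun t => multPairing m S (v t) (v t)) ⊤ (volume.restrict (Set.Ioo 0 T)) :=
  memLp_multPairing sol.memLp_mode_v sol.memLp_mode_v m S

theorem memLp_multPairing_gu (sol : IsWeakEnergySolution γ α f g T u₀ u₁ u v)
    (m : (Fin 3 → ℤ) → ℝ) (S : Finset (Fin 3 → ℤ)) :
    MemLp (fun t => multPairing m S g (u t)) ⊤ (volume.restrict (Set.Ioo 0 T)) :=
  memLp_multPairing (fun _ _ => memLp_const _) sol.memLp_mode_u m S

theorem memLp_multPairing_comp (sol : IsWeakEnergySolution γ α f g T u₀ u₁ u v) {h : ℝ → ℝ}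
    (hc : Continuous h) (hg : QuinticGrowth A h) (m : (Fin 3 → ℤ) → ℝ)
    (S : Finset (Fin 3 → ℤ)) :
    MemLp (fun t => multPairing m S (fun x => h (u t x)) (u t)) ⊤
      (volume.restrict (Set.Ioo 0 T)) :=
  memLp_multPairing (sol.memLp_mode_comp hc hg) sol.memLp_mode_u m S

theorem exists_modes_identity (sol : IsWeakEnergySolution γ α f g T u₀ u₁ u v) (hT : 0 < T)
    (hf : Continuous f) (hA : QuinticGrowth A f) :
    ∃ G : Set ℝ, (∀ᵐ t ∂volume.restrict (Set.Ioo 0 T), t ∈ G) ∧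
      ∀ a ∈ G, ∀ b ∈ G, a ≤ b → ∀ k, ∀ c ∈ ({1, -Complex.I} : Set ℂ),
        ∫ t in Set.Ioc a b, (mode c k (v t) * mode c k (v t) + mode c k g * mode c k (u t)
            - eig k * (mode c k (u t) * mode c k (u t))
            - mode c k (fun x => f (u t x)) * mode c k (u t)) =
          mode c k (v b) * mode c k (u b) - mode c k (v a) * mode c k (u a)
            + (α + γ * √(eig k)) / 2
              * (mode c k (u b) * mode c k (u b) - mode c k (u a) * mode c k (u a)) := by
  choose G hG h using fun k c => exists_oscillator_identity hT (sol.memLp_mode_u c k)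
    (sol.memLp_mode_v c k) (sol.memLp_mode_comp hf hA c k) (sol.hasWeakDeriv_mode_u c k)
    (sol.hasWeakDeriv_mode_v hf hA c k)
  refine ⟨{t | ∀ k, t ∈ G k 1 ∧ t ∈ G k (-Complex.I)}, ?_, ?_⟩
  · exact ae_all_iff.2 fun k => (hG k 1).and (hG k (-Complex.I))
  · rintro a ha b hb hab k c (rfl | rfl)
    exacts [h k 1 a (ha k).1 b (hb k).1 hab, h k _ a (ha k).2 b (hb k).2 hab]

theorem exists_multPairing_identity (sol : IsWeakEnergySolution γ α f g T u₀ u₁ u v) (hT : 0 < T)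
    (hf : Continuous f) (hA : QuinticGrowth A f) :
    ∃ G : Set ℝ, (∀ᵐ t ∂volume.restrict (Set.Ioo 0 T), t ∈ G) ∧
      ∀ a ∈ G, ∀ b ∈ G, a ≤ b → Set.Ioc a b ⊆ Set.Ioo 0 T → ∀ m S,
        ∫ t in Set.Ioc a b, (multPairing m S (v t) (v t) + multPairing m S g (u t)
            - multPairing (fun k => m k * eig k) S (u t) (u t)
            - multPairing m S (fun x => f (u t x)) (u t)) =
          multFunctional γ α m S (u b) (v b) - multFunctional γ α m S (u a) (v a) := by
  obtain ⟨G, hG, h⟩ := sol.exists_modes_identity hT hf hA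
  refine ⟨G, hG, fun a ha b hb hab hsub m S => ?_⟩
  set e : ℂ → (Fin 3 → ℤ) → ℝ → ℝ := fun c k t =>
    mode c k (v t) * mode c k (v t) + mode c k g * mode c k (u t)
      - eig k * (mode c k (u t) * mode c k (u t))
      - mode c k (fun x => f (u t x)) * mode c k (u t) with he
  have hint (c : ℂ) (k : Fin 3 → ℤ) : IntegrableOn (e c k) (Set.Ioc a b) := by
    have hu := sol.memLp_mode_u c k
    have hv := sol.memLp_mode_v c k
    have hF := sol.memLp_mode_comp hf hA c k
    exact integrableOn_of_memLp_top (((hv.mul (r := ⊤) hv).add (hu.const_mul _)).sub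
      ((hu.mul (r := ⊤) hu).const_mul _) |>.sub (hu.mul (r := ⊤) hF)) hsub
  have hadd (k : Fin 3 → ℤ) :
      IntegrableOn (fun t => e 1 k t + e (-Complex.I) k t) (Set.Ioc a b) :=
    (hint 1 k).add (hint (-Complex.I) k)
  calc _ = ∫ t in Set.Ioc a b, vol * ∑ k ∈ S, m k * (e 1 k t + e (-Complex.I) k t) := by
        congr 1 with t
        simp only [multPairing, re_coeff_mul_conj_coeff, he, ← mul_add, ← mul_sub,
          ← Finset.sum_add_distrib, ← Finset.sum_sub_distrib]
        congr 1
        exact Finset.sum_congr rfl fun k _ => by ring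
    _ = vol * ∑ k ∈ S, m k * ((∫ t in Set.Ioc a b, e 1 k t)
          + ∫ t in Set.Ioc a b, e (-Complex.I) k t) := by
        rw [integral_const_mul, integral_finsetSum _ fun k _ => (hadd k).const_mul (m k)]
        simp only [integral_const_mul, integral_add (hint 1 _) (hint (-Complex.I) _)]
    _ = _ := by
        simp only [he, h a ha b hb hab _ _ (Set.mem_insert _ _),
          h a ha b hb hab _ _ (Set.mem_insert_of_mem _ rfl), multFunctional, multPairing,
          re_coeff_mul_conj_coeff, ← mul_add, ← mul_sub, ← Finset.sum_add_distrib,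
          ← Finset.sum_sub_distrib]
        congr 1
        exact Finset.sum_congr rfl fun k _ => by ring

end IsWeakEnergySolution

end MultiplierEstimate

/-! ### Regularity -/

section Regularity

variable {γ α K T A : ℝ} {f h : ℝ → ℝ} {g u₀ u₁ : L2} {u v : ℝ → L2} {a b τ σ E D : ℝ}

/-- Bound for `∫ (m(D)(-Δ)u, u) dt` over a time interval of length at most `ℓ`, where `m` is a
dyadic symbol and `E`, `D` and `G` stand for the norms of `ξ_u` in `L^∞(𝓔)`, of `∂ₜu` in
`L²(H^{1/2})` and of `g` in `L²`. -/
def multBound (γ α K ℓ E D G : ℝ) : ℝ :=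
  18 * (1 + |α| + |γ|) * E ^ 2 + 18 * D ^ 2 + (9 * (E ^ 2 + G ^ 2) + 18 * |K| * E ^ 2) * ℓ

/-- The square of the constant in the `L²(H^{3/2})` bound over time intervals of unit length. -/
def regularityConst (γ α K : ℝ) : ℝ≥0 :=
  164 + 108 * (‖α‖₊ + ‖γ‖₊ + ‖K‖₊)

theorem add_multBound_one_le {G : ℝ} (hE : 0 ≤ E) (hD : 0 ≤ D) (hG : 0 ≤ G) :
    2 * E ^ 2 * 1 + 6 * multBound γ α K 1 E D G ≤ regularityConst γ α K * (E + D + G) ^ 2 := by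
  have hsq : E ^ 2 + D ^ 2 + G ^ 2 ≤ (E + D + G) ^ 2 := by
    nlinarith [mul_nonneg hE hD, mul_nonneg hE hG, mul_nonneg hD hG]
  calc _ = (164 + 108 * (|α| + |γ| + |K|)) * E ^ 2 + 108 * D ^ 2 + 54 * G ^ 2 := by
        rw [multBound]
        ring
    _ ≤ (164 + 108 * (|α| + |γ| + |K|)) * (E ^ 2 + D ^ 2 + G ^ 2) := by
        have hc : 0 ≤ |α| + |γ| + |K| := by positivity
        nlinarith [mul_nonneg hc (sq_nonneg D), mul_nonneg hc (sq_nonneg G)]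
    _ ≤ regularityConst γ α K * (E + D + G) ^ 2 := by
        simp only [regularityConst, NNReal.coe_add, NNReal.coe_mul, NNReal.coe_ofNat, coe_nnnorm,
          Real.norm_eq_abs]
        gcongr

theorem normL2Sob_mono {s c d : ℝ} (h : Set.Ioo a b ⊆ Set.Ioo c d) (w : ℝ → L2) :
    normL2Sob s a b w ≤ normL2Sob s c d w :=
  ENNReal.rpow_le_rpow (lintegral_mono_set h) (by norm_num)

theorem normLinftyEnergy_mono {c d : ℝ} (h : Set.Ioo a b ⊆ Set.Ioo c d) (w z : ℝ → L2) :
    normLinftyEnergy a b w z ≤ normLinftyEnergy c d w z :=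
  essSup_mono_measure (Measure.absolutelyContinuous_of_le (Measure.restrict_mono h le_rfl))

theorem exists_natAbs_lt (S : Finset (Fin 3 → ℤ)) : ∃ n : ℕ, ∀ k ∈ S, ∀ i, (k i).natAbs < n := by
  refine ⟨S.sup (fun k => ∑ i, (k i).natAbs) + 1, fun k hk i => Nat.lt_succ_of_le ?_⟩
  exact (Finset.single_le_sum (f := fun j => (k j).natAbs) (fun _ _ => Nat.zero_le _)
    (Finset.mem_univ i)).trans (Finset.le_sup (f := fun k : Fin 3 → ℤ => ∑ i, (k i).natAbs) hk)

theorem rpow_three_halves_le_dyadicSymbol {n : ℕ} {k : Fin 3 → ℤ}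
    (hn : ∀ i, (k i).natAbs < n) :
    (1 + eig k) ^ (3 / 2 : ℝ) ≤ 2 * (1 + eig k) + 6 * (dyadicSymbol n k * eig k) := by
  have he := eig_nonneg k
  have hroot : √(1 + eig k) ≤ 1 + √(eig k) := by
    rw [Real.sqrt_le_left (by positivity), add_sq, Real.sq_sqrt he]
    linarith [Real.sqrt_nonneg (eig k)]
  calc (1 + eig k) ^ (3 / 2 : ℝ) = (1 + eig k) * √(1 + eig k) := by
        rw [Real.sqrt_eq_rpow, show (3 / 2 : ℝ) = 1 + 1 / 2 by norm_num,
          Real.rpow_add (by linarith), Real.rpow_one]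
    _ ≤ (1 + eig k) * (1 + √(eig k)) := by gcongr
    _ = 1 + eig k + √(eig k) + √(eig k) * eig k := by ring
    _ ≤ 1 + eig k + (1 + eig k) + 6 * dyadicSymbol n k * eig k := by
        gcongr
        · exact sqrt_le_one_add he
        · linarith [sqrt_eig_div_six_le_dyadicSymbol hn]
    _ = _ := by ring

theorem multPairing_rpow_le {n : ℕ} {S : Finset (Fin 3 → ℤ)} (hn : ∀ k ∈ S, ∀ i, (k i).natAbs < n)
    (w : L2) : multPairing (fun k => (1 + eig k) ^ (3 / 2 : ℝ)) S w w ≤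
      multPairing (fun k => 2 * (1 + eig k)) S w w
        + 6 * multPairing (fun k => dyadicSymbol n k * eig k) S w w := by
  simp only [multPairing_self]
  rw [mul_left_comm 6, ← mul_add, Finset.mul_sum S _ 6, ← Finset.sum_add_distrib]
  refine mul_le_mul_of_nonneg_left (Finset.sum_le_sum fun k hk => ?_) vol_pos.le
  rw [← mul_assoc 6, ← add_mul]
  exact mul_le_mul_of_nonneg_right (rpow_three_halves_le_dyadicSymbol (hn k hk)) (sq_nonneg _)

theorem sobNorm_sq_eq_iSup (s : ℝ) (w : L2) :
    sobNorm s w ^ 2 = ⨆ S, ENNReal.ofReal (multPairing (fun k => (1 + eig k) ^ s) S w w) := by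
  rw [sobNorm_sq, ENNReal.tsum_eq_iSup_sum, ENNReal.mul_iSup]
  congr 1 with S
  rw [multPairing_self, ENNReal.ofReal_mul vol_pos.le, ENNReal.ofReal_sum_of_nonneg fun k _ =>
    mul_nonneg (one_add_eig_rpow_nonneg s k) (sq_nonneg _)]

theorem aemeasurable_multPairing_self {μ : Measure ℝ} {w : ℝ → L2}
    (hw : AEStronglyMeasurable w μ) (m : (Fin 3 → ℤ) → ℝ) (S : Finset (Fin 3 → ℤ)) :
    AEMeasurable (fun t => multPairing m S (w t) (w t)) μ := by
  simp only [multPairing_self]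
  exact (Finset.aemeasurable_fun_sum S fun k _ => ((((continuous_coeff k).comp_aestronglyMeasurable
    hw).norm.aemeasurable.pow_const 2).const_mul (m k))).const_mul vol

theorem aemeasurable_sobNorm_sq {μ : Measure ℝ} {w : ℝ → L2} (hw : AEStronglyMeasurable w μ)
    (s : ℝ) : AEMeasurable (fun t => sobNorm s (w t) ^ 2) μ := by
  simp only [sobNorm_sq_eq_iSup]
  exact AEMeasurable.iSup fun S => (aemeasurable_multPairing_self hw _ S).ennreal_ofReal

theorem lintegral_sobNorm_sq_le {μ : Measure ℝ} {w : ℝ → L2} (hw : AEStronglyMeasurable w μ)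
    {s : ℝ} {c : ℝ≥0∞}
    (h : ∀ S, ∫⁻ t, ENNReal.ofReal (multPairing (fun k => (1 + eig k) ^ s) S (w t) (w t)) ∂μ ≤ c) :
    ∫⁻ t, sobNorm s (w t) ^ 2 ∂μ ≤ c := by
  simp only [sobNorm_sq_eq_iSup]
  rw [lintegral_iSup_directed (fun S => (aemeasurable_multPairing_self hw _ S).ennreal_ofReal)]
  · exact iSup_le h
  · exact Monotone.directed_le fun S S' hS t => ENNReal.ofReal_le_ofReal
      (multPairing_self_mono (one_add_eig_rpow_nonneg s) hS (w t))

theorem lintegral_Ioo_le_of_ae_mem {F : ℝ → ℝ≥0∞} {c : ℝ≥0∞} {G : Set ℝ} (hτσ : τ < σ)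
    (hF : AEMeasurable F (volume.restrict (Set.Ioo τ σ)))
    (hG : ∀ᵐ t ∂volume.restrict (Set.Ioo τ σ), t ∈ G)
    (h : ∀ a ∈ G, ∀ b ∈ G, a ≤ b → ∫⁻ t in Set.Ioc a b, F t ≤ c) :
    ∫⁻ t in Set.Ioo τ σ, F t ≤ c := by
  have hdense : Dense {t | t ∈ Set.Ioo τ σ → t ∈ G} :=
    Measure.dense_of_ae ((ae_restrict_iff' measurableSet_Ioo).1 hG)
  obtain ⟨ρ, hρ⟩ := exists_between hτσ
  obtain ⟨x, -, hx, hxlim⟩ := exists_seq_strictAnti_tendsto' hρ.1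
  obtain ⟨y, -, hy, hylim⟩ := exists_seq_strictMono_tendsto' hρ.2
  choose a haG ha using fun n => hdense.exists_between (hx n).1
  choose b hbG hb using fun n => hdense.exists_between (hy n).2
  have haρ (n : ℕ) : a n < ρ := (ha n).2.trans (hx n).2
  have hρb (n : ℕ) : ρ < b n := (hy n).1.trans (hb n).1
  have halim : Tendsto a atTop (𝓝 τ) := tendsto_of_tendsto_of_tendsto_of_le_of_le
    tendsto_const_nhds hxlim (fun n => (ha n).1.le) fun n => (ha n).2.le
  have hblim : Tendsto b atTop (𝓝 σ) := tendsto_of_tendsto_of_tendsto_of_le_of_le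
    hylim tendsto_const_nhds (fun n => (hb n).1.le) fun n => (hb n).2.le
  refine le_of_tendsto' ((aecover_Ioo_of_Ioc halim hblim).lintegral_tendsto_of_countably_generated
    hF) fun n => ?_
  rw [Measure.restrict_restrict measurableSet_Ioc]
  exact (lintegral_mono_set Set.inter_subset_left).trans
    (h _ (haG n ⟨(ha n).1, (haρ n).trans hρ.2⟩) _ (hbG n ⟨hρ.1.trans (hρb n), (hb n).2⟩)
      ((haρ n).trans (hρb n)).le)

namespace IsWeakEnergySolution

theorem normLinftyEnergy_lt_top (sol : IsWeakEnergySolution γ α f g T u₀ u₁ u v)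
    (hsub : Set.Ioo τ σ ⊆ Set.Ioo 0 T) : normLinftyEnergy τ σ u v < ⊤ :=
  (normLinftyEnergy_mono hsub u v).trans_lt sol.energy

theorem normL2Sob_lt_top (sol : IsWeakEnergySolution γ α f g T u₀ u₁ u v)
    (hsub : Set.Ioo τ σ ⊆ Set.Ioo 0 T) : normL2Sob (1 / 2) τ σ v < ⊤ :=
  (normL2Sob_mono hsub v).trans_lt sol.dissipation.2

theorem integral_multPairing_vv_le (sol : IsWeakEnergySolution γ α f g T u₀ u₁ u v)
    (hsubT : Set.Ioc a b ⊆ Set.Ioo 0 T) (hsub : Set.Ioc a b ⊆ Set.Ioo τ σ)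
    (hD : normL2Sob (1 / 2) τ σ v ≤ ENNReal.ofReal D) (hD0 : 0 ≤ D) (n : ℕ)
    (S : Finset (Fin 3 → ℤ)) :
    ∫ t in Set.Ioc a b, multPairing (dyadicSymbol n) S (v t) (v t) ≤ 18 * D ^ 2 := by
  have hnonneg (t : ℝ) : 0 ≤ multPairing (dyadicSymbol n) S (v t) (v t) :=
    multPairing_self_nonneg (dyadicSymbol_nonneg n) S (v t)
  refine (ENNReal.ofReal_le_ofReal_iff (by positivity)).1 ?_
  calc _ = ∫⁻ t in Set.Ioc a b,
          ENNReal.ofReal (multPairing (dyadicSymbol n) S (v t) (v t)) :=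
        ofReal_integral_eq_lintegral_ofReal
          (integrableOn_of_memLp_top (sol.memLp_multPairing_vv _ S) hsubT)
          (Eventually.of_forall hnonneg)
    _ ≤ ∫⁻ t in Set.Ioc a b, ENNReal.ofReal 18 * sobNorm (1 / 2) (v t) ^ 2 :=
        lintegral_mono fun t => ofReal_multPairing_self_le_sobNorm_sq (dyadicSymbol_le n)
          (by norm_num) S (v t)
    _ ≤ ENNReal.ofReal 18 * normL2Sob (1 / 2) τ σ v ^ 2 := by
        rw [lintegral_const_mul' _ _ ENNReal.ofReal_ne_top, sq_normL2Sob]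
        gcongr
    _ ≤ ENNReal.ofReal 18 * ENNReal.ofReal D ^ 2 := by gcongr
    _ = ENNReal.ofReal (18 * D ^ 2) := by
        rw [ENNReal.ofReal_mul (by norm_num), ENNReal.ofReal_pow hD0]

theorem integral_multPairing_gu_le (hE : 0 ≤ E) (hsub : Set.Ioc a b ⊆ Set.Ioo τ σ) (hab : a ≤ b)
    (hℓ : b - a ≤ σ - τ) (hen : ∀ᵐ t ∂volume.restrict (Set.Ioo τ σ),
      energyNorm (u t) (v t) ≤ ENNReal.ofReal E) (n : ℕ) (S : Finset (Fin 3 → ℤ)) :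
    ∫ t in Set.Ioc a b, multPairing (dyadicSymbol n) S g (u t) ≤
      9 * (E ^ 2 + ‖g‖ ^ 2) * (σ - τ) :=
  setIntegral_Ioc_le_mul hab hℓ (by positivity) <|
    (ae_restrict_of_ae_restrict_of_subset hsub hen).mono fun _ ht =>
      abs_multPairing_le_sq_energy_add (abs_dyadicSymbol_le n) (by norm_num) hE ht S g

theorem const_mul_integral_multPairing_uu_le (K : ℝ) (hE : 0 ≤ E)
    (hsub : Set.Ioc a b ⊆ Set.Ioo τ σ) (hab : a ≤ b) (hℓ : b - a ≤ σ - τ)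
    (hen : ∀ᵐ t ∂volume.restrict (Set.Ioo τ σ), energyNorm (u t) (v t) ≤ ENNReal.ofReal E)
    (n : ℕ) (S : Finset (Fin 3 → ℤ)) :
    K * ∫ t in Set.Ioc a b, multPairing (dyadicSymbol n) S (u t) (u t) ≤
      18 * |K| * E ^ 2 * (σ - τ) := by
  rw [← integral_const_mul]
  refine setIntegral_Ioc_le_mul hab hℓ (by positivity) ?_
  filter_upwards [ae_restrict_of_ae_restrict_of_subset hsub hen] with t ht
  rw [abs_mul, mul_comm 18, mul_assoc]
  exact mul_le_mul_of_nonneg_left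
    (abs_multPairing_self_le (abs_dyadicSymbol_le_one_add n) (by norm_num) hE ht S) (abs_nonneg K)

theorem integral_multPairing_add_comp_eq (sol : IsWeakEnergySolution γ α f g T u₀ u₁ u v)
    (hf : Continuous f) (hA : QuinticGrowth A f) (K : ℝ) (hsub : Set.Ioc a b ⊆ Set.Ioo 0 T)
    (m : (Fin 3 → ℤ) → ℝ) (S : Finset (Fin 3 → ℤ)) :
    (∫ t in Set.Ioc a b, multPairing (fun k => m k * eig k) S (u t) (u t))
        + ∫ t in Set.Ioc a b, multPairing m S (fun x => f (u t x) + K * u t x) (u t) =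
      (∫ t in Set.Ioc a b, multPairing m S (v t) (v t))
        + (∫ t in Set.Ioc a b, multPairing m S g (u t))
        + (K * ∫ t in Set.Ioc a b, multPairing m S (u t) (u t))
        - ∫ t in Set.Ioc a b, (multPairing m S (v t) (v t) + multPairing m S g (u t)
            - multPairing (fun k => m k * eig k) S (u t) (u t)
            - multPairing m S (fun x => f (u t x)) (u t)) := by
  have hvv := integrableOn_of_memLp_top (sol.memLp_multPairing_vv m S) hsub
  have hgu := integrableOn_of_memLp_top (sol.memLp_multPairing_gu m S) hsub
  have huu := integrableOn_of_memLp_top (sol.memLp_multPairing_uu m S) hsub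
  have heig := integrableOn_of_memLp_top
    (sol.memLp_multPairing_uu (fun k => m k * eig k) S) hsub
  have hfu := integrableOn_of_memLp_top (sol.memLp_multPairing_comp hf hA m S) hsub
  have hshift : ∫ t in Set.Ioc a b, multPairing m S (fun x => f (u t x) + K * u t x) (u t) =
      (∫ t in Set.Ioc a b, multPairing m S (fun x => f (u t x)) (u t))
        + K * ∫ t in Set.Ioc a b, multPairing m S (u t) (u t) := by
    rw [← integral_const_mul, ← integral_add hfu (huu.const_mul K)]
    refine integral_congr_ae ?_
    filter_upwards [ae_restrict_of_ae_restrict_of_subset hsub sol.ae_sobNorm_lt_top] with t ht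
    exact multPairing_add_const_mul_self (integrable_comp hf hA ht) K (u t) m S
  have hvg : IntegrableOn (fun t => multPairing m S (v t) (v t) + multPairing m S g (u t))
      (Set.Ioc a b) := hvv.add hgu
  have hvge : IntegrableOn (fun t => multPairing m S (v t) (v t) + multPairing m S g (u t)
      - multPairing (fun k => m k * eig k) S (u t) (u t)) (Set.Ioc a b) := hvg.sub heig
  rw [hshift, integral_sub hvge hfu, integral_sub hvg heig, integral_add hvv hgu]
  ring

theorem exists_integral_multPairing_add_comp_le
    (sol : IsWeakEnergySolution γ α f g T u₀ u₁ u v) (hT : 0 < T) (hf : Continuous f)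
    (hA : QuinticGrowth A f) (K : ℝ) (hsubT : Set.Ioo τ σ ⊆ Set.Ioo 0 T) (hE : 0 ≤ E)
    (hD0 : 0 ≤ D)
    (hen : ∀ᵐ t ∂volume.restrict (Set.Ioo τ σ), energyNorm (u t) (v t) ≤ ENNReal.ofReal E)
    (hD : normL2Sob (1 / 2) τ σ v ≤ ENNReal.ofReal D) :
    ∃ G ⊆ Set.Ioo τ σ, (∀ᵐ t ∂volume.restrict (Set.Ioo τ σ), t ∈ G) ∧
      ∀ a ∈ G, ∀ b ∈ G, a ≤ b → ∀ n S,
        (∫ t in Set.Ioc a b, multPairing (fun k => dyadicSymbol n k * eig k) S (u t) (u t))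
          + (∫ t in Set.Ioc a b,
            multPairing (dyadicSymbol n) S (fun x => f (u t x) + K * u t x) (u t)) ≤
        multBound γ α K (σ - τ) E D ‖g‖ := by
  obtain ⟨G, hG, hid⟩ := sol.exists_multPairing_identity hT hf hA
  refine ⟨{t | t ∈ Set.Ioo τ σ ∧ t ∈ G ∧ energyNorm (u t) (v t) ≤ ENNReal.ofReal E},
    fun t ht => ht.1, ?_, ?_⟩
  · exact (ae_restrict_mem measurableSet_Ioo).and
      ((ae_restrict_of_ae_restrict_of_subset hsubT hG).and hen)
  rintro a ⟨ha, haG, haE⟩ b ⟨hb, hbG, hbE⟩ hab n S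
  have hsub := Ioc_subset_Ioo_of_mem ha hb
  have hℓ : b - a ≤ σ - τ := sub_le_sub hb.2.le ha.1.le
  rw [sol.integral_multPairing_add_comp_eq hf hA K (hsub.trans hsubT),
    hid a haG b hbG hab (hsub.trans hsubT)]
  have hvv := sol.integral_multPairing_vv_le (hsub.trans hsubT) hsub hD hD0 n S
  have hgu := integral_multPairing_gu_le (g := g) hE hsub hab hℓ hen n S
  have huu := const_mul_integral_multPairing_uu_le K hE hsub hab hℓ hen n S
  have hboundary_a := abs_le.1 (abs_multFunctional_dyadicSymbol_le hE haE γ α n S)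
  have hboundary_b := abs_le.1 (abs_multFunctional_dyadicSymbol_le hE hbE γ α n S)
  rw [multBound]
  linarith [hboundary_a.2, hboundary_b.1]

theorem exists_nonneg_tendsto_integral_multPairing_comp
    (sol : IsWeakEnergySolution γ α f g T u₀ u₁ u v) (hc : Continuous h)
    (hg : QuinticGrowth A h) (hmono : Monotone h) (hsub : Set.Ioc a b ⊆ Set.Ioo 0 T) (n : ℕ) :
    ∃ L : ℝ, 0 ≤ L ∧ Tendsto (fun S => ∫ t in Set.Ioc a b,
      multPairing (dyadicSymbol n) S (fun x => h (u t x)) (u t)) atTop (𝓝 L) := by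
  obtain ⟨B, hB⟩ := exists_abs_multPairing_dyadicSymbol_comp_le hc hg
    (normLinftyEnergy 0 T u v).toReal n
  refine ⟨_, ?_, tendsto_integral_filter_of_dominated_convergence (fun _ => B)
    (Eventually.of_forall fun S => ?_) (Eventually.of_forall fun S => ?_)
    (integrableOn_const measure_Ioc_lt_top.ne) ?_ (f := fun t =>
      ∑ p ∈ Finset.univ ×ˢ Finset.range n,
        2 ^ p.2 * ∫ x, h (u t x) * secondDiff (dyadicShift p) (u t) x)⟩
  · refine integral_nonneg_of_ae ?_
    filter_upwards [ae_restrict_of_ae_restrict_of_subset hsub sol.ae_sobNorm_lt_top] with t ht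
    exact Finset.sum_nonneg fun p _ => mul_nonneg (by positivity)
      (integral_comp_mul_secondDiff_nonneg hmono (memLp_comp hc hg ht) (memLp_six ht) _)
  · exact (integrableOn_of_memLp_top (sol.memLp_multPairing_comp hc hg _ S) hsub).1
  · filter_upwards [ae_restrict_of_ae_restrict_of_subset hsub sol.ae_sobNorm_le] with t ht
    exact hB (u t) ht S
  · filter_upwards [ae_restrict_of_ae_restrict_of_subset hsub sol.ae_sobNorm_lt_top] with t ht
    exact tendsto_multPairing_dyadicSymbol (memLp_comp hc hg ht) ht n

theorem exists_integral_multPairing_eig_le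
    (sol : IsWeakEnergySolution γ α f g T u₀ u₁ u v) (hT : 0 < T) (hf : Continuous f)
    (hA : QuinticGrowth A f) (hmono : Monotone fun s => f s + K * s)
    (hsubT : Set.Ioo τ σ ⊆ Set.Ioo 0 T) (hE : 0 ≤ E) (hD0 : 0 ≤ D)
    (hen : ∀ᵐ t ∂volume.restrict (Set.Ioo τ σ), energyNorm (u t) (v t) ≤ ENNReal.ofReal E)
    (hD : normL2Sob (1 / 2) τ σ v ≤ ENNReal.ofReal D) :
    ∃ G ⊆ Set.Ioo τ σ, (∀ᵐ t ∂volume.restrict (Set.Ioo τ σ), t ∈ G) ∧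
      ∀ a ∈ G, ∀ b ∈ G, a ≤ b → ∀ n S,
        ∫ t in Set.Ioc a b, multPairing (fun k => dyadicSymbol n k * eig k) S (u t) (u t) ≤
          multBound γ α K (σ - τ) E D ‖g‖ := by
  obtain ⟨G, hGsub, hG, hle⟩ :=
    sol.exists_integral_multPairing_add_comp_le hT hf hA K hsubT hE hD0 hen hD
  refine ⟨G, hGsub, hG, fun a ha b hb hab n S₀ => ?_⟩
  have hsub := (Ioc_subset_Ioo_of_mem (hGsub ha) (hGsub hb)).trans hsubT
  obtain ⟨L, hL0, hL⟩ := sol.exists_nonneg_tendsto_integral_multPairing_comp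
    (by fun_prop) (hA.add_const_mul K) hmono hsub n
  have hint (S : Finset (Fin 3 → ℤ)) := integrableOn_of_memLp_top
    (sol.memLp_multPairing_uu (fun k => dyadicSymbol n k * eig k) S) hsub
  refine (le_add_of_nonneg_right hL0).trans (le_of_tendsto (hL.const_add _) ?_)
  filter_upwards [eventually_ge_atTop S₀] with S hS
  refine le_trans ?_ (hle a ha b hb hab n S)
  gcongr ?_ + _
  exact setIntegral_mono (hint S₀) (hint S) fun t => multPairing_self_mono
    (fun k => mul_nonneg (dyadicSymbol_nonneg n k) (eig_nonneg k)) hS (u t)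

theorem integral_multPairing_rpow_le (sol : IsWeakEnergySolution γ α f g T u₀ u₁ u v)
    (hab : a ≤ b) (hℓ : b - a ≤ σ - τ) (hsub : Set.Ioc a b ⊆ Set.Ioo τ σ)
    (hsubT : Set.Ioo τ σ ⊆ Set.Ioo 0 T) (hE : 0 ≤ E)
    (hen : ∀ᵐ t ∂volume.restrict (Set.Ioo τ σ), energyNorm (u t) (v t) ≤ ENNReal.ofReal E) {B : ℝ}
    (hB : ∀ n S, ∫ t in Set.Ioc a b,
      multPairing (fun k => dyadicSymbol n k * eig k) S (u t) (u t) ≤ B)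
    (S : Finset (Fin 3 → ℤ)) :
    ∫ t in Set.Ioc a b, multPairing (fun k => (1 + eig k) ^ (3 / 2 : ℝ)) S (u t) (u t) ≤
      2 * E ^ 2 * (σ - τ) + 6 * B := by
  obtain ⟨n, hn⟩ := exists_natAbs_lt S
  have hint (m : (Fin 3 → ℤ) → ℝ) := integrableOn_of_memLp_top (sol.memLp_multPairing_uu m S)
    (hsub.trans hsubT)
  have hlow : ∫ t in Set.Ioc a b, multPairing (fun k => 2 * (1 + eig k)) S (u t) (u t) ≤
      2 * E ^ 2 * (σ - τ) := by
    refine setIntegral_Ioc_le_mul hab hℓ (by positivity) ?_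
    filter_upwards [ae_restrict_of_ae_restrict_of_subset hsub hen] with t ht
    refine abs_multPairing_self_le (fun k => (abs_of_nonneg ?_).le) (by norm_num) hE ht S
    linarith [eig_nonneg k]
  calc _ ≤ ∫ t in Set.Ioc a b, (multPairing (fun k => 2 * (1 + eig k)) S (u t) (u t)
          + 6 * multPairing (fun k => dyadicSymbol n k * eig k) S (u t) (u t)) :=
        setIntegral_mono (hint _) ((hint _).add ((hint _).const_mul 6)) fun t =>
          multPairing_rpow_le hn (u t)
    _ = (∫ t in Set.Ioc a b, multPairing (fun k => 2 * (1 + eig k)) S (u t) (u t))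
          + 6 * ∫ t in Set.Ioc a b,
            multPairing (fun k => dyadicSymbol n k * eig k) S (u t) (u t) := by
        rw [integral_add (hint _) ((hint _).const_mul 6), integral_const_mul]
    _ ≤ _ := by
        gcongr
        exact hB n S

theorem lintegral_sobNorm_Ioo_le (sol : IsWeakEnergySolution γ α f g T u₀ u₁ u v) (hT : 0 < T)
    (hf : Continuous f) (hA : QuinticGrowth A f) (hmono : Monotone fun s => f s + K * s)
    (hτσ : τ < σ) (hsubT : Set.Ioo τ σ ⊆ Set.Ioo 0 T) (hE : 0 ≤ E) (hD0 : 0 ≤ D)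
    (hen : ∀ᵐ t ∂volume.restrict (Set.Ioo τ σ), energyNorm (u t) (v t) ≤ ENNReal.ofReal E)
    (hD : normL2Sob (1 / 2) τ σ v ≤ ENNReal.ofReal D) :
    ∫⁻ t in Set.Ioo τ σ, sobNorm (3 / 2) (u t) ^ 2 ≤
      ENNReal.ofReal (2 * E ^ 2 * (σ - τ) + 6 * multBound γ α K (σ - τ) E D ‖g‖) := by
  obtain ⟨G, hGsub, hG, hle⟩ :=
    sol.exists_integral_multPairing_eig_le hT hf hA hmono hsubT hE hD0 hen hD
  have hmeas {s : Set ℝ} (hs : s ⊆ Set.Ioo 0 T) : AEStronglyMeasurable u (volume.restrict s) :=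
    sol.measurable_u.mono_measure (Measure.restrict_mono hs le_rfl)
  refine lintegral_Ioo_le_of_ae_mem hτσ (aemeasurable_sobNorm_sq (hmeas hsubT) _) hG
    fun a ha b hb hab => ?_
  have hsub := Ioc_subset_Ioo_of_mem (hGsub ha) (hGsub hb)
  refine lintegral_sobNorm_sq_le (hmeas (hsub.trans hsubT)) fun S => ?_
  rw [← ofReal_integral_eq_lintegral_ofReal
    (integrableOn_of_memLp_top (sol.memLp_multPairing_uu _ S) (hsub.trans hsubT))
    (Eventually.of_forall fun t =>
      multPairing_self_nonneg (one_add_eig_rpow_nonneg (3 / 2)) S (u t))]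
  exact ENNReal.ofReal_le_ofReal (sol.integral_multPairing_rpow_le hab
    (sub_le_sub (hGsub hb).2.le (hGsub ha).1.le) hsub hsubT hE hen (hle a ha b hb hab) S)

theorem sq_normL2Sob_le (sol : IsWeakEnergySolution γ α f g T u₀ u₁ u v) (hT : 0 < T)
    (hf : Continuous f) (hA : QuinticGrowth A f) (hmono : Monotone fun s => f s + K * s)
    (hτσ : τ < σ) (hsub : Set.Ioo τ σ ⊆ Set.Ioo 0 T) :
    normL2Sob (3 / 2) τ σ u ^ 2 ≤ ENNReal.ofReal
      (2 * (normLinftyEnergy τ σ u v).toReal ^ 2 * (σ - τ) + 6 * multBound γ α K (σ - τ)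
        (normLinftyEnergy τ σ u v).toReal (normL2Sob (1 / 2) τ σ v).toReal ‖g‖) := by
  rw [sq_normL2Sob]
  refine sol.lintegral_sobNorm_Ioo_le hT hf hA hmono hτσ hsub ENNReal.toReal_nonneg
    ENNReal.toReal_nonneg ?_ ?_
  · rw [ENNReal.ofReal_toReal (sol.normLinftyEnergy_lt_top hsub).ne]
    exact ENNReal.ae_le_essSup _
  · rw [ENNReal.ofReal_toReal (sol.normL2Sob_lt_top hsub).ne]

theorem memL2Sob (sol : IsWeakEnergySolution γ α f g T u₀ u₁ u v) (hT : 0 < T)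
    (hf : Continuous f) (hA : QuinticGrowth A f) (hmono : Monotone fun s => f s + K * s) :
    MemL2Sob (3 / 2) 0 T u :=
  ⟨sol.measurable_u, (ENNReal.pow_lt_top_iff.1 ((sol.sq_normL2Sob_le hT hf hA hmono hT
    subset_rfl).trans_lt ENNReal.ofReal_lt_top)).resolve_right two_ne_zero⟩

theorem normL2Sob_le (sol : IsWeakEnergySolution γ α f g T u₀ u₁ u v) (hT : 0 < T)
    (hf : Continuous f) (hA : QuinticGrowth A f) (hmono : Monotone fun s => f s + K * s)
    (hτ : 0 ≤ τ) (hτT : τ + 1 ≤ T) :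
    normL2Sob (3 / 2) τ (τ + 1) u ≤ ((NNReal.sqrt (regularityConst γ α K) *
      (normLinftyEnergy τ (τ + 1) u v + normL2Sob (1 / 2) τ (τ + 1) v + ‖g‖ₑ).toNNReal :
        ℝ≥0) : ℝ≥0∞) := by
  have hsub : Set.Ioo τ (τ + 1) ⊆ Set.Ioo 0 T := Set.Ioo_subset_Ioo hτ hτT
  have hEfin := (sol.normLinftyEnergy_lt_top hsub).ne
  have hDfin := (sol.normL2Sob_lt_top hsub).ne
  have hsum : ((normLinftyEnergy τ (τ + 1) u v + normL2Sob (1 / 2) τ (τ + 1) v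
      + ‖g‖ₑ).toNNReal : ℝ) = (normLinftyEnergy τ (τ + 1) u v).toReal
        + (normL2Sob (1 / 2) τ (τ + 1) v).toReal + ‖g‖ := by
    rw [ENNReal.coe_toNNReal_eq_toReal, ENNReal.toReal_add (ENNReal.add_ne_top.2 ⟨hEfin, hDfin⟩)
      enorm_ne_top, ENNReal.toReal_add hEfin hDfin, toReal_enorm]
  refine (ENNReal.pow_le_pow_left_iff two_ne_zero).1
    ((sol.sq_normL2Sob_le hT hf hA hmono (lt_add_one τ) hsub).trans ?_)
  rw [← ENNReal.ofReal_coe_nnreal, ← ENNReal.ofReal_pow (NNReal.coe_nonneg _), NNReal.coe_mul,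
    hsum, mul_pow, ← NNReal.coe_pow, NNReal.sq_sqrt, add_sub_cancel_left]
  exact ENNReal.ofReal_le_ofReal (add_multBound_one_le ENNReal.toReal_nonneg
    ENNReal.toReal_nonneg (norm_nonneg g))

end IsWeakEnergySolution

end Regularity

end QuinticWave

end

theorem theorem2p2_general (γ α K : ℝ) :
    ∃ M : ℝ≥0, ∀ (f : ℝ → ℝ) (A : ℝ), Continuous f → QuinticWave.QuinticGrowth A f →
      (Monotone fun s => f s + K * s) →
      ∀ (g u₀ u₁ : QuinticWave.L2) (T : ℝ) (u v : ℝ → QuinticWave.L2), 0 < T →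
        QuinticWave.IsWeakEnergySolution γ α f g T u₀ u₁ u v →
        QuinticWave.MemL2Sob (3 / 2) 0 T u ∧
        ∀ τ : ℝ, 0 ≤ τ → τ + 1 ≤ T →
          QuinticWave.normL2Sob (3 / 2) τ (τ + 1) u ≤
            (M * (QuinticWave.normLinftyEnergy τ (τ + 1) u v
                + QuinticWave.normL2Sob (1 / 2) τ (τ + 1) v + ‖g‖ₑ).toNNReal : ℝ≥0) :=
  ⟨NNReal.sqrt (QuinticWave.regularityConst γ α K),
    fun _ _ hf hA hmono _ _ _ _ _ _ hT sol => ⟨sol.memL2Sob hT hf hA hmono,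
      fun _ hτ hτT => sol.normL2Sob_le hT hf hA hmono hτ hτT⟩⟩

theorem theorem2p2 (γ α C κ K : ℝ) (hγ : 0 < γ) (hα : 0 < α) (hC : 0 < C) (hκ : 0 < κ)
    (hK : 0 < K) (f : ℝ → ℝ) (hf : QuinticWave.Nonlinearity C κ K f) :
    ∃ Q : ℝ≥0 → ℝ≥0, Monotone Q ∧
      ∀ (g u₀ u₁ : QuinticWave.L2) (T : ℝ) (u v : ℝ → QuinticWave.L2), 0 < T →
        QuinticWave.IsWeakEnergySolution γ α f g T u₀ u₁ u v →
        QuinticWave.MemL2Sob (3 / 2) 0 T u ∧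
        ∀ τ : ℝ, 0 ≤ τ → τ + 1 ≤ T →
          QuinticWave.normL2Sob (3 / 2) τ (τ + 1) u ≤
            Q (QuinticWave.normLinftyEnergy τ (τ + 1) u v
                + QuinticWave.normL2Sob (1 / 2) τ (τ + 1) v + ‖g‖ₑ).toNNReal := by
  obtain ⟨M, hM⟩ := theorem2p2_general γ α K
  exact ⟨fun r => M * r, fun _ _ hrs => mul_le_mul_right hrs M,
    hM f (|f 0| + 2 * C) hf.contDiff.continuous (hf.quinticGrowth hC) hf.monotone⟩
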